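/- Let $k$ be a field. For a finite-dimensional $k$-algebra $B$ let $\mathcal D^b(\mathrm{mod}\text{-}B)$ be the bounded derived category of finitely generated right $B$-modules, i.e. the full triangulated subcategory of $\mathcal D(\mathrm{Mod}\text{-}B)$ of complexes with finite-dimensional total cohomology. A recollement of a triangulated category $\mathcal C$ by triangulated categories $\mathcal C'$ and $\mathcal C''$ consists of triangle functors $i_*=i_!:\mathcal C'\to\mathcal C$, $i^*,i^!:\mathcal C\to\mathcal C'$, $j^*=j^!:\mathcal C\to\mathcal C''$, $j_!,j_*:\mathcal C''\to\mathcal C$ such that $(i^*,i_*)$, $(i_!,i^!)$, $(j_!,j^!)$, $(j^*,j_*)$ are adjoint pairs, $i_*,j_!,j_*$ are fully faithful, $i^!j_*=0$, and for every $X\in\mathcal C$ the adjunction morphisms fit into triangles $i_!i^!X\to X\to j_*j^*X\to i_!i^!X[1]$ and $j_!j^!X\to X\to i_*i^*X\to j_!j^!X[1]$. It is nontrivial if none of $i_*,j_!,j_*$ is an equivalence. The category $\mathcal D^b(\mathrm{mod}\text{-}B)$ is called simple if $B\neq 0$ and there is no nontrivial recollement of it by bounded derived categories $\mathcal D^b(\mathrm{mod}\text{-}B')$,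 $\mathcal D^b(\mathrm{mod}\text{-}B'')$ of finite-dimensional $k$-algebras $B',B''$. A stratification of $\mathcal D^b(\mathrm{mod}\text{-}A)$ is a full rooted binary tree, possibly infinite, whose nodes are bounded derived categories of finite-dimensional $k$-algebras, whose root is $\mathcal D^b(\mathrm{mod}\text{-}A)$, whose leaves are simple (they are called the simple factors), and in which every node that is not a leaf is the middle term of a nontrivial recollement by its two child nodes. A block of $A$ is an indecomposable (in particular nonzero) algebra direct summand of $A$, i.e. an algebra $eA$ with $e\in A$ a central idempotent that is nonzero and not isomorphic to a product of two nonzero algebras. Let $A$ be a finite-dimensional symmetric $k$-algebra, i.e. $\operatorname{Hom}_k(A,k)\cong A$ as $A$-$A$-bimodules. Then every stratification of $\mathcal D^b(\mathrm{mod}\text{-}A)$ is finite. Moreover, the simple factors of any two stratifications coincide, with multiplicities and up to triangle equivalence, and they are precisely the bounded derived categories of the blocks of $A$: for every stratification there is a bijection from its leaves to the blocks of $A$ such that each leaf is triangle equivalent to $\mathcal D^b(\mathrm{mod}\text{-}A_i)$ for the corresponding block $A_i$. If $A\neq 0$, a stratification exists. -/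

import Mathlib

open CategoryTheory CategoryTheory.Limits CategoryTheory.Pretriangulated

universe u

/-! ### Finite-dimensional algebras, symmetric algebras, blocks -/

/-- A finite-dimensional (unital, associative) algebra over the field `k`. -/
structure FinDimAlg (k : Type u) [Field k] : Type (u + 1) where
  /-- The underlying type. -/
  carrier : Type u
  [ring : Ring carrier]
  [algebra : Algebra k carrier]
  [finite : Module.Finite k carrier]

attribute [instance] FinDimAlg.ring FinDimAlg.algebra FinDimAlg.finite

/-- A finite-dimensional algebra is symmetric if its `k`-dual `DA = Hom_k(A, k)`, with the bimodule
structure `(a f b)(y) = f (b y a)`, is isomorphic to `A` as an `A`-`A`-bimodule. -/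
def IsSymmetricAlg (k : Type u) [Field k] (A : Type u) [Ring A] [Algebra k A] : Prop :=
  ∃ φ : A ≃ₗ[k] Module.Dual k A, ∀ a x b y : A, φ (a * x * b) y = φ x (b * y * a)

/-- A nonzero algebra which is not isomorphic to a direct product of two nonzero algebras. -/
def IsIndecomposableAlgebra (k : Type u) [Field k] (A : Type u) [Ring A] [Algebra k A] : Prop :=
  Nontrivial A ∧
    ∀ (B C : Type u) [Ring B] [Algebra k B] [Ring C] [Algebra k C],
      Nontrivial B → Nontrivial C → IsEmpty (A ≃ₐ[k] B × C)

section Corner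

variable {k A : Type u} [Field k] [Ring A] [Algebra k A] {e : A}

/-- The `k`-subspace `eAe` of `A` which underlies the corner ring `eAe`. -/
def cornerSubmodule (k : Type u) [Field k] [Algebra k A] (he : IsIdempotentElem e) :
    Submodule k A where
  carrier := Subsemigroup.corner e
  zero_mem' := (NonUnitalRing.corner e).zero_mem
  add_mem' := (NonUnitalRing.corner e).add_mem
  smul_mem' c x hx := by
    rw [SetLike.mem_coe, Subsemigroup.mem_corner_iff he] at hx ⊢
    rw [mul_smul_comm, smul_mul_assoc, hx.1, hx.2]
    exact ⟨rfl, rfl⟩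

instance cornerModule (he : IsIdempotentElem e) : Module k he.Corner where
  smul c x := ⟨c • x.1, (cornerSubmodule k he).smul_mem c x.2⟩
  one_smul x := Subtype.ext (one_smul k x.1)
  mul_smul c d x := Subtype.ext (mul_smul c d x.1)
  smul_zero c := Subtype.ext (smul_zero c)
  smul_add c x y := Subtype.ext (smul_add c x.1 y.1)
  add_smul c d x := Subtype.ext (add_smul c d x.1)
  zero_smul x := Subtype.ext (zero_smul k x.1)

instance cornerAlgebra (he : IsIdempotentElem e) : Algebra k he.Corner :=
  Algebra.ofModule (fun c x y => Subtype.ext (smul_mul_assoc c x.1 y.1))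
    (fun c x y => Subtype.ext (mul_smul_comm c x.1 y.1))

instance cornerFinite [Module.Finite k A] (he : IsIdempotentElem e) :
    Module.Finite k he.Corner :=
  Module.Finite.of_injective
    ({ toFun := fun x => x.1
       map_add' := fun _ _ => rfl
       map_smul' := fun _ _ => rfl } : he.Corner →ₗ[k] A) Subtype.val_injective

end Corner

/-- A block of `A`: an indecomposable algebra direct summand.  The algebra direct summands of `A`
are the two-sided ideals `eA = eAe` with `e` a central idempotent, and `e`, being the unit of `eA`,
is determined by the summand. -/
structure Block (k : Type u) [Field k] (A : Type u) [Ring A] [Algebra k A] where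
  /-- The central idempotent that cuts out the block. -/
  idem : A
  isIdempotentElem : IsIdempotentElem idem
  central : ∀ a : A, idem * a = a * idem
  indecomposable : IsIndecomposableAlgebra k isIdempotentElem.Corner

/-- The block as a finite-dimensional algebra in its own right. -/
def Block.alg {k : Type u} [Field k] {A : Type u} [Ring A] [Algebra k A] [Module.Finite k A]
    (b : Block k A) : FinDimAlg k where
  carrier := b.isIdempotentElem.Corner

/-! ### Triangle equivalences and recollements -/

section Triangulated

universe v₁ v₂ v₃ u₁ u₂ u₃

/-- There is a triangle equivalence from `C` to `D`. -/
def TriangleEquivalent (C : Type u₁) [Category.{v₁} C] [HasZeroObject C] [HasShift C ℤ]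
    [Preadditive C] [∀ n : ℤ, (shiftFunctor C n).Additive] [Pretriangulated C]
    (D : Type u₂) [Category.{v₂} D] [HasZeroObject D] [HasShift D ℤ]
    [Preadditive D] [∀ n : ℤ, (shiftFunctor D n).Additive] [Pretriangulated D] : Prop :=
  ∃ (F : C ⥤ D) (_ : F.CommShift ℤ), F.IsTriangulated ∧ F.IsEquivalence

/-- A recollement of the triangulated category `C` by `C'` (on the left) and `C''` (on the
right): `iStar` is `i_* = i_!`, `iUpperStar` is `i^*`, `iUpperShriek` is `i^!`, `jUpperStar` is
`j^* = j^!`, `jShriek` is `j_!`, and `jStar` is `j_*`. -/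
structure Recollement
    (C' : Type u₁) [Category.{v₁} C'] [HasZeroObject C'] [HasShift C' ℤ]
    [Preadditive C'] [∀ n : ℤ, (shiftFunctor C' n).Additive] [Pretriangulated C']
    (C : Type u₂) [Category.{v₂} C] [HasZeroObject C] [HasShift C ℤ]
    [Preadditive C] [∀ n : ℤ, (shiftFunctor C n).Additive] [Pretriangulated C]
    (C'' : Type u₃) [Category.{v₃} C''] [HasZeroObject C''] [HasShift C'' ℤ]
    [Preadditive C''] [∀ n : ℤ, (shiftFunctor C'' n).Additive] [Pretriangulated C''] where
  iStar : C' ⥤ C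
  iUpperStar : C ⥤ C'
  iUpperShriek : C ⥤ C'
  jUpperStar : C ⥤ C''
  jShriek : C'' ⥤ C
  jStar : C'' ⥤ C
  [iStarShift : iStar.CommShift ℤ]
  [iUpperStarShift : iUpperStar.CommShift ℤ]
  [iUpperShriekShift : iUpperShriek.CommShift ℤ]
  [jUpperStarShift : jUpperStar.CommShift ℤ]
  [jShriekShift : jShriek.CommShift ℤ]
  [jStarShift : jStar.CommShift ℤ]
  [iStarTriangulated : iStar.IsTriangulated]
  [iUpperStarTriangulated : iUpperStar.IsTriangulated]
  [iUpperShriekTriangulated : iUpperShriek.IsTriangulated]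
  [jUpperStarTriangulated : jUpperStar.IsTriangulated]
  [jShriekTriangulated : jShriek.IsTriangulated]
  [jStarTriangulated : jStar.IsTriangulated]
  iUpperStarAdj : iUpperStar ⊣ iStar
  iUpperShriekAdj : iStar ⊣ iUpperShriek
  jShriekAdj : jShriek ⊣ jUpperStar
  jStarAdj : jUpperStar ⊣ jStar
  iStar_full : iStar.Full
  iStar_faithful : iStar.Faithful
  jShriek_full : jShriek.Full
  jShriek_faithful : jShriek.Faithful
  jStar_full : jStar.Full
  jStar_faithful : jStar.Faithful
  isZero_iUpperShriek_jStar : ∀ X : C'', IsZero (iUpperShriek.obj (jStar.obj X))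
  exists_triangle_shriek_star : ∀ X : C,
    ∃ δ : jStar.obj (jUpperStar.obj X) ⟶ (iStar.obj (iUpperShriek.obj X))⟦(1 : ℤ)⟧,
      Triangle.mk (iUpperShriekAdj.counit.app X) (jStarAdj.unit.app X) δ ∈ distTriang C
  exists_triangle_star_shriek : ∀ X : C,
    ∃ δ : iStar.obj (iUpperStar.obj X) ⟶ (jShriek.obj (jUpperStar.obj X))⟦(1 : ℤ)⟧,
      Triangle.mk (jShriekAdj.counit.app X) (iUpperStarAdj.unit.app X) δ ∈ distTriang C

/-- A recollement is nontrivial if none of the full embeddings `i_*`, `j_!`, `j_*` is an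
equivalence. -/
def Recollement.IsNontrivial
    {C' : Type u₁} [Category.{v₁} C'] [HasZeroObject C'] [HasShift C' ℤ]
    [Preadditive C'] [∀ n : ℤ, (shiftFunctor C' n).Additive] [Pretriangulated C']
    {C : Type u₂} [Category.{v₂} C] [HasZeroObject C] [HasShift C ℤ]
    [Preadditive C] [∀ n : ℤ, (shiftFunctor C n).Additive] [Pretriangulated C]
    {C'' : Type u₃} [Category.{v₃} C''] [HasZeroObject C''] [HasShift C'' ℤ]
    [Preadditive C''] [∀ n : ℤ, (shiftFunctor C'' n).Additive] [Pretriangulated C'']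
    (R : Recollement C' C C'') : Prop :=
  ¬ R.iStar.IsEquivalence ∧ ¬ R.jShriek.IsEquivalence ∧ ¬ R.jStar.IsEquivalence

end Triangulated

/-! ### The bounded derived category -/

section DerivedCategory

open scoped ModuleCat ZeroObject

variable {k : Type u} [Field k]

noncomputable instance FinDimAlg.hasDerivedCategory (A : FinDimAlg k) :
    HasDerivedCategory.{u + 1} (ModuleCat.{u} A.carrierᵐᵒᵖ) :=
  HasDerivedCategory.standard _

/-- The objects of the derived category of all right `A`-modules (that is, left
`Aᵐᵒᵖ`-modules) whose total cohomology is finite-dimensional over `k`. -/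
def FinDimAlg.finiteCohomology (A : FinDimAlg k) :
    ObjectProperty (DerivedCategory (ModuleCat.{u} A.carrierᵐᵒᵖ)) := fun X =>
  (∀ n : ℤ, Module.Finite k ((DerivedCategory.homologyFunctor (ModuleCat.{u} A.carrierᵐᵒᵖ) n).obj X)) ∧
    {n : ℤ | ¬ IsZero ((DerivedCategory.homologyFunctor (ModuleCat.{u} A.carrierᵐᵒᵖ) n).obj X)}.Finite

/-- In an exact sequence `M → N → P` of modules over a `k`-algebra with `M` and `P`
finite-dimensional, `N` is finite-dimensional. -/
theorem moduleFinite_of_shortComplex_exact {R : Type u} [Ring R] [Algebra k R]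
    (S : ShortComplex (ModuleCat.{u} R)) (hS : S.Exact)
    (h₁ : Module.Finite k S.X₁) (h₃ : Module.Finite k S.X₃) : Module.Finite k S.X₂ := by
  have hex := (ShortComplex.ShortExact.moduleCat_exact_iff_function_exact S).1 hS
  let f : S.X₁ →ₗ[k] S.X₂ := S.f.hom.restrictScalars k
  let g : S.X₂ →ₗ[k] S.X₃ := S.g.hom.restrictScalars k
  have : IsNoetherian k S.X₂ := isNoetherian_of_range_eq_ker f g
    (by ext x; exact (hex x).symm)
  infer_instance

theorem moduleFinite_of_moduleCat_iso {R : Type u} [Ring R] [Algebra k R]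
    {M N : ModuleCat.{u} R} (e : M ≅ N) (h : Module.Finite k M) : Module.Finite k N :=
  Module.Finite.equiv (e.toLinearEquiv.restrictScalars k)

/-- The cohomology of a shifted object. -/
noncomputable def FinDimAlg.homologyShiftIso (A : FinDimAlg k)
    (X : DerivedCategory (ModuleCat.{u} A.carrierᵐᵒᵖ)) (a n : ℤ) :
    (DerivedCategory.homologyFunctor (ModuleCat.{u} A.carrierᵐᵒᵖ) n).obj (X⟦a⟧) ≅
      (DerivedCategory.homologyFunctor (ModuleCat.{u} A.carrierᵐᵒᵖ) (a + n)).obj X :=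
  ((DerivedCategory.homologyFunctor (ModuleCat.{u} A.carrierᵐᵒᵖ) 0).shiftIso a n (a + n) rfl).app X

instance FinDimAlg.finiteCohomology_isTriangulated (A : FinDimAlg k) :
    A.finiteCohomology.IsTriangulated where
  exists_zero := by
    have h (n : ℤ) : IsZero ((DerivedCategory.homologyFunctor
        (ModuleCat.{u} A.carrierᵐᵒᵖ) n).obj 0) := Functor.map_isZero _ (isZero_zero _)
    refine ⟨0, isZero_zero _, fun n => ?_, ?_⟩
    · have := ModuleCat.subsingleton_of_isZero (h n)
      infer_instance
    · convert Set.finite_empty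
      ext n
      simp [h n]
  isStableUnderShiftBy a :=
    ⟨by
      intro X hX
      refine ⟨fun n => moduleFinite_of_moduleCat_iso (A.homologyShiftIso X a n).symm
        (hX.1 (a + n)), ?_⟩
      refine (hX.2.preimage (f := fun n => a + n) (add_right_injective a).injOn).subset ?_
      intro n hn hz
      exact hn (hz.of_iso (A.homologyShiftIso X a n))⟩
  ext₂' T hT h₁ h₃ := by
    refine ObjectProperty.le_isoClosure _ _ ⟨fun n => ?_, ?_⟩
    · exact moduleFinite_of_shortComplex_exact _
        (DerivedCategory.HomologySequence.exact₂ T hT n) (h₁.1 n) (h₃.1 n)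
    · refine (h₁.2.union h₃.2).subset ?_
      intro n hn
      by_contra hcon
      simp only [Set.mem_union, Set.mem_ofPred_eq, not_or, not_not] at hcon
      exact hn ((DerivedCategory.HomologySequence.exact₂ T hT n).isZero_of_both_zeros
        (hcon.1.eq_of_src _ _) (hcon.2.eq_of_tgt _ _))

/-- The bounded derived category of finitely generated right `A`-modules, as the full triangulated
subcategory of the derived category of all right `A`-modules on the complexes whose total
cohomology is finite-dimensional. -/
abbrev FinDimAlg.Db (A : FinDimAlg k) : Type (u + 1) := A.finiteCohomology.FullSubcategory

/-- `A` is simple with respect to bounded derived categories: it is nonzero and there is no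
nontrivial recollement of `D^b(mod-A)` by bounded derived categories of finite-dimensional
algebras. -/
def FinDimAlg.IsDbSimple (A : FinDimAlg k) : Prop :=
  Nontrivial A.carrier ∧
    ∀ (B C : FinDimAlg k) (R : Recollement B.Db A.Db C.Db), ¬ R.IsNontrivial

/-- A stratification of `D^b(mod-A)`: a full rooted binary tree, not assumed to be finite.
A node is recorded as the list of the left (`false`) and right (`true`) turns on the path from the
root to it, the last turn coming first, so that the children of `p` are `false :: p` and
`true :: p`.  The node `p` stands for the bounded derived category of the algebra `label p`
(the values of `label` outside of `nodes` play no role). -/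
structure DbStratification (A : FinDimAlg k) where
  /-- The nodes of the tree. -/
  nodes : Set (List Bool)
  /-- The algebras at the nodes. -/
  label : List Bool → FinDimAlg k
  root_mem : [] ∈ nodes
  parent_mem : ∀ (p : List Bool) (b : Bool), b :: p ∈ nodes → p ∈ nodes
  full : ∀ p : List Bool, false :: p ∈ nodes ↔ true :: p ∈ nodes
  label_root : label [] = A
  isDbSimple_of_leaf : ∀ p ∈ nodes, false :: p ∉ nodes → (label p).IsDbSimple
  exists_recollement : ∀ p ∈ nodes, false :: p ∈ nodes →
    ∃ R : Recollement (label (false :: p)).Db (label p).Db (label (true :: p)).Db, R.IsNontrivial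

/-- The leaves of a stratification; the bounded derived categories `(S.label p.1).Db`, for `p` a
leaf, are the simple factors of the stratification. -/
def DbStratification.Leaf {A : FinDimAlg k} (S : DbStratification A) : Type :=
  {p : List Bool // p ∈ S.nodes ∧ false :: p ∉ S.nodes}

end DerivedCategory

/-! ### Traces on finitely generated projective modules over a symmetric algebra -/

/-! The core is `exists_idempotent_of_recollement`: every recollement of `D^b(mod-A)` comes, up to
triangle equivalence of its outer terms, from a central idempotent of `A`. Put `P = i_* i^* A` and
`Q = j_! j^* A`, so that `Q → A → P → Q[1]` is distinguished.

By adjunction `Hom(P[n], X) = Hom(A[n], i_* i^! X) = H^{-n}(i_* i^! X)`. For `X = A / rad A` this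
vanishes when `n` is very negative, and this forces `P` to be perfect
(`isPerfect_of_subsingleton_hom_dbTop`). For perfect `P` over a symmetric algebra, `Hom(P, Y)` is
dual to `Hom(Y, P)`; only the vanishing statement is needed, and `IsPerfect.hom_eq_zero_of_dual`
obtains it from a trace pairing. Since `j^* i_* = 0`, nothing nonzero maps from `Q` or `Q[1]` to
`P`, hence nothing nonzero maps from `P` to `Q` or `Q[1]`. So `A = P ⊕ Q` with no morphisms between
the summands, and the projection to `P` is a central idempotent `e` with `P = eA` and `Q = (1 -
e)A`. The image of `i_*` is the right orthogonal of all `Q[n]`, that is `D^b(mod-eA)`; the image of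
`j_*` is likewise `D^b(mod-(1-e)A)`.

Conversely, a central idempotent splits `D^b(mod-A)` orthogonally and so gives a recollement,
nontrivial when `e` is neither `0` nor `1`. Thus a nonzero symmetric `A` is simple exactly when it
is indecomposable. Corners of central idempotents are again symmetric and have smaller dimension, so
induction on the dimension of `A` matches leaves with blocks, bounds the tree and also constructs
one. Nodes are known only up to triangle equivalence, hence recollements are transported along
equivalences (`Recollement.exists_transport`). -/

/-- A symmetrizing form on a `k`-algebra. -/
structure SymmetrizingForm (k R : Type*) [Field k] [Ring R] [Algebra k R] where
  form : R →ₗ[k] k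
  comm : ∀ x y, form (x * y) = form (y * x)
  nondeg : ∀ x, (∀ y, form (y * x) = 0) → x = 0

/-- A presentation of a module as a direct summand of a free module of finite rank. -/
structure ProjFrame (R P : Type*) [Ring R] [AddCommGroup P] [Module R P] where
  n : ℕ
  incl : P →ₗ[R] (Fin n → R)
  proj : (Fin n → R) →ₗ[R] P
  proj_incl : proj ∘ₗ incl = LinearMap.id

theorem ProjFrame.nonempty (R P : Type*) [Ring R] [AddCommGroup P] [Module R P]
    [Module.Finite R P] [Module.Projective R P] : Nonempty (ProjFrame R P) := by
  obtain ⟨n, f, g, -, -, h⟩ := Module.Finite.exists_comp_eq_id_of_projective R P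
  exact ⟨⟨n, g, f, h⟩⟩

namespace SymmetrizingForm

variable {k R : Type*} [Field k] [Ring R] [Algebra k R] (t : SymmetrizingForm k R)

/-- The trace of an endomorphism of a free module. -/
noncomputable def freeTrace {n : ℕ} : ((Fin n → R) →ₗ[R] (Fin n → R)) →+ k where
  toFun f := ∑ i, t.form (f (Pi.single i 1) i)
  map_zero' := by simp
  map_add' f g := by simp [Finset.sum_add_distrib]

theorem freeTrace_apply {n : ℕ} (f : (Fin n → R) →ₗ[R] (Fin n → R)) :
    t.freeTrace f = ∑ i, t.form (f (Pi.single i 1) i) := rfl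

theorem apply_eq_sum {n : ℕ} {M : Type*} [AddCommGroup M] [Module R M]
    (f : (Fin n → R) →ₗ[R] M) (x : Fin n → R) :
    f x = ∑ j, x j • f (Pi.single j 1) := by
  conv_lhs => rw [← Finset.univ_sum_single x]
  rw [map_sum]
  refine Finset.sum_congr rfl fun j _ => ?_
  rw [← map_smul, ← Pi.single_smul, smul_eq_mul, mul_one]

/-- Expanding both sides in matrix entries reduces the claim to `form (x * y) = form (y * x)`. -/
theorem freeTrace_comp_comm {m n : ℕ} (f : (Fin n → R) →ₗ[R] (Fin m → R))
    (g : (Fin m → R) →ₗ[R] (Fin n → R)) :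
    t.freeTrace (g ∘ₗ f) = t.freeTrace (f ∘ₗ g) := by
  simp only [freeTrace_apply, LinearMap.comp_apply]
  have h1 : ∀ i, t.form (g (f (Pi.single i 1)) i) =
      ∑ j, t.form (f (Pi.single i 1) j * g (Pi.single j 1) i) := fun i => by
    rw [apply_eq_sum g]; simp
  have h2 : ∀ j, t.form (f (g (Pi.single j 1)) j) =
      ∑ i, t.form (g (Pi.single j 1) i * f (Pi.single i 1) j) := fun i => by
    rw [apply_eq_sum f]; simp
  simp only [h1, h2]
  rw [Finset.sum_comm]
  exact Finset.sum_congr rfl fun j _ => Finset.sum_congr rfl fun i _ => t.comm _ _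

variable {P P' X : Type*} [AddCommGroup P] [Module R P] [AddCommGroup P'] [Module R P']
  [AddCommGroup X] [Module R X]

/-- The trace of an endomorphism of a finitely generated projective module. -/
noncomputable def trace (φ : ProjFrame R P) : (P →ₗ[R] P) →+ k where
  toFun f := t.freeTrace (φ.incl ∘ₗ f ∘ₗ φ.proj)
  map_zero' := by simp
  map_add' f g := by rw [LinearMap.add_comp, LinearMap.comp_add, map_add]

theorem trace_apply (φ : ProjFrame R P) (f : P →ₗ[R] P) :
    t.trace φ f = t.freeTrace (φ.incl ∘ₗ f ∘ₗ φ.proj) := rfl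

/-- With one of the maps an identity, this also shows that the trace does not depend on the chosen
frame. -/
theorem trace_comp_comm (φ : ProjFrame R P) (φ' : ProjFrame R P') (f : P →ₗ[R] P')
    (g : P' →ₗ[R] P) : t.trace φ (g ∘ₗ f) = t.trace φ' (f ∘ₗ g) := by
  have h := t.freeTrace_comp_comm (φ'.incl ∘ₗ f ∘ₗ φ.proj) (φ.incl ∘ₗ g ∘ₗ φ'.proj)
  have e : ∀ x, φ.proj (φ.incl x) = x := fun x => LinearMap.congr_fun φ.proj_incl x
  have e' : ∀ x, φ'.proj (φ'.incl x) = x := fun x => LinearMap.congr_fun φ'.proj_incl x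
  rw [trace_apply, trace_apply]
  convert h using 2 <;> ext <;> simp [e, e']

/-- By nondegeneracy `x ↦ form (· * x)` is an injection of `R` into its dual, hence a bijection by
dimension. -/
theorem exists_form_eq [Module.Finite k R] (l : R →ₗ[k] k) : ∃ x, ∀ y, t.form (y * x) = l y := by
  let F : R →ₗ[k] (R →ₗ[k] k) :=
    LinearMap.mk₂ k (fun x y => t.form (y * x)) (by simp [mul_add]) (by simp)
      (by simp [add_mul]) (by simp)
  have hF : Function.Injective F := by
    rw [injective_iff_map_eq_zero]
    intro x hx
    exact t.nondeg x fun y => LinearMap.congr_fun hx y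
  have hs : Function.Surjective F :=
    (LinearMap.injective_iff_surjective_of_finrank_eq_finrank
      (Subspace.dual_finrank_eq (K := k) (V := R)).symm).1 hF
  obtain ⟨x, hx⟩ := hs l
  exact ⟨x, fun y => LinearMap.congr_fun hx y⟩

theorem form_ext {x x' : R} (h : ∀ y, t.form (y * x) = t.form (y * x')) : x = x' := by
  rw [← sub_eq_zero]
  exact t.nondeg _ fun y => by rw [mul_sub, map_sub, h, sub_self]

variable [Module k X] [IsScalarTower k R X]

/-- The value `g x` is the element of `R` that represents the functional `r ↦ l (r • x)`. Uniqueness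
of representing elements makes `g` an `R`-linear map. -/
theorem exists_form_apply_eq [Module.Finite k R] (l : X →ₗ[k] k) :
    ∃ g : X →ₗ[R] R, ∀ x, t.form (g x) = l x := by
  choose g hg using fun x : X => t.exists_form_eq
    (l ∘ₗ (LinearMap.toSpanSingleton R X x).restrictScalars k)
  simp only [LinearMap.comp_apply, LinearMap.restrictScalars_apply,
    LinearMap.toSpanSingleton_apply] at hg
  refine ⟨{ toFun := g, map_add' := fun x y => ?_, map_smul' := fun r x => ?_ }, fun x => ?_⟩
  · exact t.form_ext fun z => by rw [hg, mul_add, map_add, hg, hg, smul_add, map_add]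
  · exact t.form_ext fun z => by
      rw [hg, RingHom.id_apply, smul_eq_mul, ← mul_assoc, hg, smul_smul]
  · simpa using hg x 1

/-- The linear map that sends the `i`-th basis vector to `x` and the others to zero. -/
noncomputable def basisMap {n : ℕ} (i : Fin n) (x : X) : (Fin n → R) →ₗ[R] X :=
  LinearMap.toSpanSingleton R X x ∘ₗ LinearMap.proj i

omit [Module k X] [IsScalarTower k R X] in
theorem freeTrace_comp_basisMap {n : ℕ} (g : X →ₗ[R] (Fin n → R)) (i : Fin n) (x : X) :
    t.freeTrace (g ∘ₗ basisMap i x) = t.form (g x i) := by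
  rw [freeTrace_apply, Finset.sum_eq_single i]
  · simp [basisMap]
  · intro j _ hj
    simp [basisMap, hj.symm]
  · simp

-- Testing against the rank-one maps `p ↦ (incl p)_i • (y • x)` recovers `form (y * (incl (g x))_i)`
-- for every `y`, so nondegeneracy of the form applies to each coordinate.
omit [Module k X] [IsScalarTower k R X] in
theorem eq_zero_of_trace_comp_eq_zero (φ : ProjFrame R P) (g : X →ₗ[R] P)
    (hg : ∀ h : P →ₗ[R] X, t.trace φ (g ∘ₗ h) = 0) : g = 0 := by
  have key : ∀ x, φ.incl (g x) = 0 := fun x => by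
    ext i
    refine t.nondeg _ fun y => ?_
    have := hg (basisMap i (y • x) ∘ₗ φ.incl)
    rw [trace_apply] at this
    have e := t.freeTrace_comp_comm (φ.incl ∘ₗ φ.proj) (φ.incl ∘ₗ g ∘ₗ basisMap i (y • x))
    have e2 : (φ.incl ∘ₗ φ.proj) ∘ₗ (φ.incl ∘ₗ g ∘ₗ basisMap i (y • x)) =
        (φ.incl ∘ₗ g) ∘ₗ basisMap i (y • x) := by
      rw [LinearMap.comp_assoc, ← LinearMap.comp_assoc _ φ.incl φ.proj, φ.proj_incl]; rfl
    rw [e2, freeTrace_comp_basisMap] at e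
    have e3 : t.freeTrace (φ.incl ∘ₗ (g ∘ₗ basisMap i (y • x) ∘ₗ φ.incl) ∘ₗ φ.proj) =
      t.form ((φ.incl ∘ₗ g) (y • x) i) := e
    rw [this] at e3
    simpa using e3.symm
  ext x
  have := congrArg φ.proj (key x)
  simpa using (LinearMap.congr_fun φ.proj_incl (g x)).symm.trans this

/-- With the preceding lemma, this says that the trace pairing identifies `Hom(X, P)` with the
`k`-dual of `Hom(P, X)`, for `X` of any size. The hypothesis `hl` is `k`-homogeneity of `l`, stated
pointwise. The coordinates of `g` represent the values of `l` on rank-one maps. -/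
theorem exists_trace_comp_eq [Module.Finite k R] (φ : ProjFrame R P)
    (l : (P →ₗ[R] X) →+ k) (hl : ∀ (c : k) (h : P →ₗ[R] X) (h' : P →ₗ[R] X),
      (∀ p, h' p = c • h p) → l h' = c * l h) :
    ∃ g : X →ₗ[R] P, ∀ h, t.trace φ (g ∘ₗ h) = l h := by
  let li (i : Fin φ.n) : X →ₗ[k] k :=
    { toFun := fun x => l (basisMap i x ∘ₗ φ.incl)
      map_add' := fun x y => by
        rw [← map_add]; congr 1; ext; simp [basisMap]
      map_smul' := fun c x => by
        rw [hl c (basisMap i x ∘ₗ φ.incl), RingHom.id_apply, smul_eq_mul]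
        intro p
        simp only [basisMap, LinearMap.comp_apply, LinearMap.toSpanSingleton_apply]
        exact smul_comm _ _ _ }
  choose g hg using fun i => t.exists_form_apply_eq (li i)
  let G : X →ₗ[R] (Fin φ.n → R) := LinearMap.pi g
  refine ⟨φ.proj ∘ₗ G, fun h => ?_⟩
  -- The idempotent `incl ∘ proj` moves around the trace and is absorbed by `proj`.
  have e : t.freeTrace (φ.incl ∘ₗ ((φ.proj ∘ₗ G) ∘ₗ h) ∘ₗ φ.proj) =
      t.freeTrace (G ∘ₗ h ∘ₗ φ.proj) := by
    have := t.freeTrace_comp_comm (G ∘ₗ h ∘ₗ φ.proj) (φ.incl ∘ₗ φ.proj)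
    have e2 : (G ∘ₗ h ∘ₗ φ.proj) ∘ₗ φ.incl ∘ₗ φ.proj = G ∘ₗ h ∘ₗ φ.proj := by
      simp only [LinearMap.comp_assoc]
      rw [← LinearMap.comp_assoc _ φ.incl φ.proj, φ.proj_incl]; rfl
    rw [e2] at this
    exact this
  rw [trace_apply, e, freeTrace_apply]
  have e3 : ∀ i, t.form ((G ∘ₗ h ∘ₗ φ.proj) (Pi.single i 1) i) =
      l (basisMap i (h (φ.proj (Pi.single i 1))) ∘ₗ φ.incl) := fun i => hg i _
  simp only [e3]
  rw [← map_sum]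
  congr 1
  ext p
  have e4 : h p = h (φ.proj (φ.incl p)) := by
    rw [show φ.proj (φ.incl p) = p from LinearMap.congr_fun φ.proj_incl p]
  rw [e4, ← LinearMap.comp_apply, apply_eq_sum (h ∘ₗ φ.proj)]
  simp [basisMap]

end SymmetrizingForm

/-! ### Duality for bounded complexes of finitely generated projective modules -/

section PerfectComplexes

open CochainComplex.HomComplex
open scoped ModuleCat

variable {k R : Type u} [Field k] [Ring R] [Algebra k R]

theorem SymmetrizingForm.exists_trace_hom_eq [Module.Finite k R] (t : SymmetrizingForm k R)
    {P X : ModuleCat.{u} R} (φ : ProjFrame R P) (l : (P ⟶ X) →ₗ[k] k) :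
    ∃ g : X ⟶ P, ∀ h : P ⟶ X, t.trace φ (h ≫ g).hom = l h := by
  obtain ⟨g, hg⟩ := t.exists_trace_comp_eq (X := X) φ
    { toFun := fun h => l (ModuleCat.ofHom h)
      map_zero' := by rw [ModuleCat.ofHom_zero, map_zero]
      map_add' := fun x y => by rw [ModuleCat.ofHom_add, map_add] }
    (fun c h h' H => by
      have : ModuleCat.ofHom h' = c • ModuleCat.ofHom h := by ext p; exact H p
      change l (ModuleCat.ofHom h') = c * l (ModuleCat.ofHom h)
      rw [this, map_smul, smul_eq_mul])
  exact ⟨ModuleCat.ofHom g, fun h => hg h.hom⟩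

theorem SymmetrizingForm.hom_ext (t : SymmetrizingForm k R)
    {P X : ModuleCat.{u} R} (φ : ProjFrame R P) {g g' : X ⟶ P}
    (H : ∀ h : P ⟶ X, t.trace φ (h ≫ g).hom = t.trace φ (h ≫ g').hom) : g = g' := by
  rw [← sub_eq_zero]
  ext1
  refine t.eq_zero_of_trace_comp_eq_zero φ _ fun h => ?_
  have := H (ModuleCat.ofHom h)
  rw [← sub_eq_zero, ← map_sub] at this
  convert this using 2
  ext x
  simp

theorem SymmetrizingForm.trace_hom_comm (t : SymmetrizingForm k R)
    {P P' : ModuleCat.{u} R} (φ : ProjFrame R P) (φ' : ProjFrame R P') (f : P ⟶ P') (g : P' ⟶ P) :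
    t.trace φ (f ≫ g).hom = t.trace φ' (g ≫ f).hom :=
  t.trace_comp_comm φ φ' f.hom g.hom

/-- Finitely generated projective modules over a symmetric algebra are injective. -/
theorem SymmetrizingForm.injective [Module.Finite k R] (t : SymmetrizingForm k R)
    {P : ModuleCat.{u} R} (φ : ProjFrame R P) : Injective P where
  factors {X Y} g f _ := by
    -- Composition with the monomorphism `f` is injective on `Hom(P, X)`, so it has a `k`-linear
    -- retraction `G`. The functional that represents `g` extends through `G` to `Hom(P, Y)`, and
    -- the map representing the extension is the required factorization.
    let F : (P ⟶ X) →ₗ[k] (P ⟶ Y) := Linear.rightComp k P f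
    have hF : LinearMap.ker F = ⊥ := by
      rw [LinearMap.ker_eq_bot']
      intro h hh
      exact zero_of_comp_mono f hh
    obtain ⟨G, hG⟩ := F.exists_leftInverse_of_injective hF
    let l : (P ⟶ X) →ₗ[k] k :=
      { toFun := fun h => t.trace φ (h ≫ g).hom
        map_add' := fun x y => by rw [Preadditive.add_comp, ModuleCat.hom_add, map_add]
        map_smul' := fun c x => by
          have hs : ((c • x) ≫ g).hom = (x ≫ (c • g)).hom := by
            rw [Linear.smul_comp, Linear.comp_smul]
          rw [hs, Linear.comp_smul]
          change ∑ i : Fin φ.n, t.form _ = c • ∑ i : Fin φ.n, t.form _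
          rw [Finset.smul_sum]
          refine Finset.sum_congr rfl fun i _ => ?_
          rw [← map_smul]
          congr 1
          change φ.incl (c • _) i = c • φ.incl _ i
          rw [← algebraMap_smul R c, map_smul, algebraMap_smul]
          rfl }
    obtain ⟨g', hg'⟩ := t.exists_trace_hom_eq φ (l ∘ₗ G)
    refine ⟨g', t.hom_ext φ fun h => ?_⟩
    rw [← Category.assoc, hg']
    exact congrArg l (LinearMap.congr_fun hG h)

/-- A bounded complex of finitely generated projective modules. -/
structure IsPerfectComplex (K : CochainComplex (ModuleCat.{u} R) ℤ) : Prop where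
  finite : ∀ i, Module.Finite R (K.X i)
  projective : ∀ i, Projective (K.X i)
  bounded : ∃ a b : ℤ, K.IsStrictlyGE a ∧ K.IsStrictlyLE b

theorem ProjFrame.nonempty_of_projective (P : ModuleCat.{u} R) (h : Module.Finite R P)
    (h' : Projective P) : Nonempty (ProjFrame R P) := by
  have : Module.Projective R P := (IsProjective.iff_projective P).2 h'
  exact ProjFrame.nonempty R P

variable {K L : CochainComplex (ModuleCat.{u} R) ℤ}

theorem IsPerfectComplex.isKProjective (hK : IsPerfectComplex K) : K.IsKProjective := by
  obtain ⟨a, b, h1, h2⟩ := hK.bounded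
  have := hK.projective
  exact CochainComplex.isKProjective_of_projective K b

theorem IsPerfectComplex.isKInjective [Module.Finite k R] (t : SymmetrizingForm k R)
    (hK : IsPerfectComplex K) : K.IsKInjective := by
  obtain ⟨a, b, h1, h2⟩ := hK.bounded
  have : ∀ i, Injective (K.X i) := fun i =>
    t.injective (ProjFrame.nonempty_of_projective _ (hK.finite i) (hK.projective i)).some
  exact CochainComplex.isKInjective_of_injective K a

/-- This cancellation makes the alternating trace of a null-homotopic endomorphism zero: the two
halves of the homotopy formula contribute `c i` and `c (i + 1)`. -/
theorem finsum_negOnePow_smul_add_eq_zero {M : Type*} [AddCommGroup M] (c : ℤ → M)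
    (hc : (Function.support c).Finite) :
    ∑ᶠ i : ℤ, i.negOnePow • (c i + c (i + 1)) = 0 := by
  have h1 : (Function.support fun i : ℤ => i.negOnePow • c i).Finite :=
    hc.subset fun i hi => by
      intro h; exact hi (by simp [h])
  have h2 : (Function.support fun i : ℤ => i.negOnePow • c (i + 1)).Finite :=
    (hc.preimage (f := fun i : ℤ => i + 1) (add_left_injective 1).injOn).subset fun i hi => by
      intro h; exact hi (by simp [h])
  simp only [smul_add]
  rw [finsum_add_distrib h1 h2]
  have h3 : ∑ᶠ i : ℤ, i.negOnePow • c (i + 1) = - ∑ᶠ i : ℤ, i.negOnePow • c i := by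
    rw [← finsum_comp_equiv (Equiv.addRight (1 : ℤ)) (f := fun i : ℤ => i.negOnePow • c i),
      ← finsum_neg_distrib]
    refine finsum_congr fun i => ?_
    simp [Int.negOnePow_succ]
  rw [h3, add_neg_cancel]

/-- If `f` is not a coboundary, some functional `l` on degree-zero cochains kills the coboundaries
but not `f`. Represented degreewise through the trace pairing, `l` becomes a family `L.X i ⟶ K.X i`,
and vanishing on coboundaries says precisely that this is a chain map `G`. Then `l f` is the
alternating trace of `f ≫ G`, which is zero because `G` is null-homotopic. -/
theorem IsPerfectComplex.homotopy_zero_of_dual [Module.Finite k R] (t : SymmetrizingForm k R)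
    (hK : IsPerfectComplex K) (h : ∀ g : L ⟶ K, Nonempty (Homotopy g 0)) (f : K ⟶ L) :
    Nonempty (Homotopy f 0) := by
  have φ : ∀ i, ProjFrame R (K.X i) := fun i =>
    (ProjFrame.nonempty_of_projective _ (hK.finite i) (hK.projective i)).some
  by_contra hf
  let D : Cochain K L (-1) →ₗ[k] Cochain K L 0 := δ_hom k K L (-1) 0
  have hfD : Cochain.ofHom f ∉ LinearMap.range D := by
    rintro ⟨z, hz⟩
    exact hf ⟨(Cochain.equivHomotopy f 0).symm ⟨z, by
      rw [Cochain.ofHom_zero, add_zero]; exact hz.symm⟩⟩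
  obtain ⟨l, hl, hlD⟩ := Submodule.exists_le_ker_of_notMem hfD
  have hlD' : ∀ z, l (δ (-1) 0 z) = 0 := fun z => hlD ⟨z, rfl⟩
  let li (i : ℤ) : (K.X i ⟶ L.X i) →ₗ[k] k :=
    { toFun := fun u => l (Cochain.single u 0)
      map_add' := fun u v => by
        rw [← map_add]; congr 1; ext p
        by_cases hp : p = i
        · subst hp; simp
        · simp [Cochain.single_v_eq_zero _ _ _ _ _ hp]
      map_smul' := fun c u => by
        rw [RingHom.id_apply, ← map_smul]; congr 1; ext p : 1
        by_cases hp : p = i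
        · subst hp; simp
        · simp [Cochain.single_v_eq_zero _ _ _ _ _ hp] }
  -- The sign cancels the one in the differential of the Hom complex, so that the maps `g i` commute
  -- with `d` rather than anticommute.
  choose g hg using fun i => t.exists_trace_hom_eq (φ i) (i.negOnePow • li i)
  have hg' : ∀ i (u : K.X i ⟶ L.X i),
      t.trace (φ i) (u ≫ g i).hom = i.negOnePow • l (Cochain.single u 0) := hg
  obtain ⟨G, hG⟩ : ∃ G : L ⟶ K, ∀ i, G.f i = g i := by
    refine ⟨{ f := g, comm' := ?_ }, fun _ => rfl⟩
    rintro i j rfl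
    refine t.hom_ext (φ (i + 1)) fun u => ?_
    have e1 : t.trace (φ (i + 1)) (u ≫ g i ≫ K.d i (i + 1)).hom =
        t.trace (φ i) ((K.d i (i + 1) ≫ u) ≫ g i).hom := by
      rw [← Category.assoc, t.trace_hom_comm (φ (i + 1)) (φ i), Category.assoc]
    rw [e1, hg', ← Category.assoc, hg']
    -- The coboundary of the degree `-1` cochain supported on `u` has just two components, one in
    -- degree `i` and one in degree `i + 1`.
    have := hlD' (Cochain.single u (-1))
    rw [Cochain.δ_single u (-1) 0 (by simp) i (i + 1) (by simp) (by simp), map_add] at this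
    simp only [Int.negOnePow_zero, one_smul] at this
    rw [Int.negOnePow_succ, eq_neg_of_add_eq_zero_right this]
    simp
  obtain ⟨H⟩ := h G
  apply hl
  obtain ⟨a, b, ha, hb⟩ := hK.bounded
  have hz : ∀ i, i ∉ Finset.Icc a b → IsZero (K.X i) := fun i hi => by
    rw [Finset.mem_Icc, not_and_or, not_le, not_le] at hi
    rcases hi with hi | hi
    · exact K.isZero_of_isStrictlyGE a i hi
    · exact K.isZero_of_isStrictlyLE b i hi
  have hf1 : Cochain.ofHom f = ∑ i ∈ Finset.Icc a b, Cochain.single (f.f i) 0 := by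
    ext p : 1
    have hsum : (∑ i ∈ Finset.Icc a b, Cochain.single (f.f i) 0).v p p (add_zero p) =
        ∑ i ∈ Finset.Icc a b, (Cochain.single (f.f i) 0).v p p (add_zero p) := by
      induction Finset.Icc a b using Finset.induction_on with
      | empty => simp
      | insert i s hi IH => rw [Finset.sum_insert hi, Finset.sum_insert hi, Cochain.add_v, IH]
    rw [hsum]
    by_cases hp : p ∈ Finset.Icc a b
    · rw [Finset.sum_eq_single_of_mem p hp]
      · simp
      · intro j _ hj
        exact Cochain.single_v_eq_zero _ _ _ _ _ hj.symm
    · exact (hz p hp).eq_of_src _ _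
  have hf2 : l (Cochain.ofHom f) =
      ∑ᶠ i : ℤ, i.negOnePow • t.trace (φ i) (f.f i ≫ G.f i).hom := by
    rw [hf1, map_sum, finsum_eq_sum_of_support_subset (s := Finset.Icc a b)]
    · refine Finset.sum_congr rfl fun i _ => ?_
      rw [hG, hg', smul_smul, ← Int.negOnePow_add, Int.negOnePow_even _ (Even.add_self i), one_smul]
    · intro i hi
      by_contra hi'
      apply hi
      have : f.f i ≫ G.f i = 0 := (hz i hi').eq_of_src _ _
      simp only [this, ModuleCat.hom_zero, map_zero, smul_zero]
  -- The half of the homotopy formula that passes through `K.X (i - 1)`. Cyclicity of the trace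
  -- turns the other half in degree `i` into `c (i + 1)`.
  let c (i : ℤ) : k := t.trace (φ i) (f.f i ≫ H.hom i (i - 1) ≫ K.d (i - 1) i).hom
  rw [hf2, ← finsum_negOnePow_smul_add_eq_zero c]
  · refine finsum_congr fun i => ?_
    congr 1
    rw [H.comm i, dNext_eq _ (show (ComplexShape.up ℤ).Rel i (i + 1) by simp),
      prevD_eq _ (show (ComplexShape.up ℤ).Rel (i - 1) i by simp)]
    have e : c (i + 1) = t.trace (φ i) (f.f i ≫ L.d i (i + 1) ≫ H.hom (i + 1) i).hom := by
      have hi : i + 1 - 1 = i := by lia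
      simp only [c]
      rw [show f.f i ≫ L.d i (i + 1) ≫ H.hom (i + 1) i =
        K.d i (i + 1) ≫ f.f (i + 1) ≫ H.hom (i + 1) i by simp,
        t.trace_hom_comm (φ i) (φ (i + 1))]
      congr 2
      simp only [Category.assoc]
      congr 2 <;> rw [hi]
    rw [e, add_comm (c i), ← map_add, ← ModuleCat.hom_add]
    simp
  · refine (Finset.Icc a b).finite_toSet.subset fun i hi => ?_
    by_contra hi'
    apply hi
    have : f.f i ≫ H.hom i (i - 1) ≫ K.d (i - 1) i = 0 := (hz i hi').eq_of_src _ _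
    simp only [c, this, ModuleCat.hom_zero, map_zero]

variable [HasDerivedCategory.{u + 1} (ModuleCat.{u} R)]

/-- Over a symmetric algebra `K` is both K-projective and K-injective, so morphisms out of and into
`K` in the derived category are homotopy classes of chain maps. -/
theorem IsPerfectComplex.subsingleton_hom_of_dual [Module.Finite k R] (t : SymmetrizingForm k R)
    (hK : IsPerfectComplex K)
    (h : ∀ g : DerivedCategory.Q.obj L ⟶ DerivedCategory.Q.obj K, g = 0)
    (f : DerivedCategory.Q.obj K ⟶ DerivedCategory.Q.obj L) : f = 0 := by
  have := hK.isKProjective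
  have := hK.isKInjective t
  have h' : ∀ g : L ⟶ K, Nonempty (Homotopy g 0) := fun g => by
    refine ⟨HomotopyCategory.homotopyOfEq _ _ ?_⟩
    apply (CochainComplex.IsKInjective.Qh_map_bijective
      ((HomotopyCategory.quotient _ _).obj L) K).1
    rw [Functor.map_zero, Functor.map_zero]
    exact h (DerivedCategory.Q.map g)
  obtain ⟨f', hf'⟩ := (CochainComplex.IsKProjective.Qh_map_bijective K
    ((HomotopyCategory.quotient _ _).obj L)).2 f
  obtain ⟨f'', rfl⟩ := (HomotopyCategory.quotient _ _).map_surjective f'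
  obtain ⟨H⟩ := hK.homotopy_zero_of_dual t h' f''
  have h0 := HomotopyCategory.eq_of_homotopy f'' 0 H
  rw [Functor.map_zero] at h0
  rw [h0, Functor.map_zero] at hf'
  exact hf'.symm

end PerfectComplexes

/-! ### Morphisms from a shifted projective object in the derived category -/

open scoped ZeroObject

namespace DerivedCategory

universe w v'

variable {C : Type u} [Category.{v'} C] [Abelian C]

section

variable [HasDerivedCategory.{w} C]

theorem exists_Q_map_eq_of_isKProjective {K L : CochainComplex C ℤ} [K.IsKProjective]
    (f : Q.obj K ⟶ Q.obj L) : ∃ f' : K ⟶ L, Q.map f' = f := by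
  obtain ⟨f', hf'⟩ := (CochainComplex.IsKProjective.Qh_map_bijective K
    ((HomotopyCategory.quotient _ _).obj L)).2 f
  obtain ⟨f'', rfl⟩ := (HomotopyCategory.quotient _ _).map_surjective f'
  exact ⟨f'', hf'⟩

instance isKProjective_single (M : C) [Projective M] (n : ℤ) :
    ((CochainComplex.singleFunctor C n).obj M).IsKProjective := by
  have : ∀ i, Projective (((CochainComplex.singleFunctor C n).obj M).X i) := fun i => by
    by_cases hi : i = n
    · subst hi
      exact Projective.of_iso (HomologicalComplex.singleObjXSelf (.up ℤ) i M).symm inferInstance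
    · exact Projective.of_iso (HomologicalComplex.isZero_single_obj_X (.up ℤ) n M i hi).isoZero.symm
        inferInstance
  exact CochainComplex.isKProjective_of_projective _ n

/-- The degree `n` homology of `M` placed in degree `n`. -/
noncomputable def homologySingleIso (M : C) (n : ℤ) :
    (homologyFunctor C n).obj ((singleFunctor C n).obj M) ≅ M :=
  (singleFunctorCompHomologyFunctorIso C n).app M

/-- The homology of an object of the derived category that is represented by a complex. -/
noncomputable def homologyQIso (K : CochainComplex C ℤ) (n : ℤ) :
    (homologyFunctor C n).obj (Q.obj K) ≅ K.homology n :=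
  (homologyFunctorFactors C n).app K

theorem homologyMap_Q_map {K L : CochainComplex C ℤ} (f : K ⟶ L) (n : ℤ) :
    (homologyFunctor C n).map (Q.map f) = (homologyQIso K n).hom ≫
      HomologicalComplex.homologyMap f n ≫ (homologyQIso L n).inv := by
  rw [← Category.assoc, Iso.eq_comp_inv]
  exact (homologyFunctorFactors C n).hom.naturality f

end

/-- Projectivity lifts a map from `M` to the cohomology of `L` to the cycles. Together with
`homotopy_zero_of_single` this identifies morphisms from `M` in degree `n` to `L` with morphisms
from `M` to the `n`-th cohomology. -/
theorem exists_single_hom_complex {M : C} [Projective M] (L : CochainComplex C ℤ) {n : ℤ}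
    (φ : ((HomologicalComplex.single C (.up ℤ) n).obj M).homology n ⟶ L.homology n) :
    ∃ f : (HomologicalComplex.single C (.up ℤ) n).obj M ⟶ L,
      HomologicalComplex.homologyMap f n = φ := by
  let ψ := (HomologicalComplex.singleObjHomologySelfIso (.up ℤ) n M).inv ≫ φ
  let c : M ⟶ L.cycles n := Projective.factorThru ψ (L.homologyπ n)
  have hc : c ≫ L.homologyπ n = ψ := Projective.factorThru_comp _ _
  refine ⟨HomologicalComplex.mkHomFromSingle (c ≫ L.iCycles n) (by simp), ?_⟩
  rw [← cancel_epi (HomologicalComplex.singleObjHomologySelfIso (.up ℤ) n M).inv,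
    ← HomologicalComplex.singleObjCyclesSelfIso_inv_homologyπ, Category.assoc,
    HomologicalComplex.homologyπ_naturality, ← Category.assoc,
    HomologicalComplex.singleObjCyclesSelfIso_inv_homologyπ]
  change _ = ψ
  rw [← hc]
  congr 1
  rw [← cancel_mono (L.iCycles n)]
  simp

/-- A map that is zero on cohomology lands in the boundaries; projectivity of `M` lifts it to `L.X
(n - 1)`, and this lift is the homotopy. -/
theorem homotopy_zero_of_single {M : C} [Projective M] {L : CochainComplex C ℤ} {n : ℤ}
    (g : (HomologicalComplex.single C (.up ℤ) n).obj M ⟶ L)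
    (hg : HomologicalComplex.homologyMap g n = 0) : Nonempty (Homotopy g 0) := by
  obtain ⟨g', hd, rfl⟩ : ∃ (g' : M ⟶ L.X n) (hd : ∀ k, (ComplexShape.up ℤ).Rel n k →
      g' ≫ L.d n k = 0), HomologicalComplex.mkHomFromSingle g' hd = g := by
    refine ⟨(HomologicalComplex.singleObjXSelf (.up ℤ) n M).inv ≫ g.f n, ?_, ?_⟩
    · intro k _
      simp
    · apply HomologicalComplex.from_single_hom_ext
      simp
  have hd' : g' ≫ L.d n (n + 1) = 0 := hd _ rfl
  have h3 : L.liftCycles g' (n + 1) (by simp) hd' ≫ L.homologyπ n = 0 := by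
    have h4 := HomologicalComplex.homologyπ_naturality
      (HomologicalComplex.mkHomFromSingle g' hd) n
    rw [hg, comp_zero] at h4
    have h5 : (HomologicalComplex.singleObjCyclesSelfIso (.up ℤ) n M).inv ≫
        HomologicalComplex.cyclesMap (HomologicalComplex.mkHomFromSingle g' hd) n =
        L.liftCycles g' (n + 1) (by simp) hd' := by
      rw [← cancel_mono (L.iCycles n)]
      simp
    rw [← h5, Category.assoc, ← h4, comp_zero]
  have h5 : (ShortComplex.mk (L.toCycles (n - 1) n) (L.homologyπ n) (by simp)).Exact :=
    ShortComplex.exact_of_g_is_cokernel _ (L.homologyIsCokernel (n - 1) n (by simp))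
  let w : M ⟶ L.X (n - 1) := h5.liftFromProjective _ h3
  have h7 : w ≫ L.d (n - 1) n = g' := by
    have h6 : w ≫ L.toCycles (n - 1) n = _ := h5.liftFromProjective_comp _ h3
    have := congrArg (· ≫ L.iCycles n) h6
    simpa using this
  refine ⟨(CochainComplex.HomComplex.Cochain.equivHomotopy _ 0).symm
    ⟨CochainComplex.HomComplex.Cochain.single
      ((HomologicalComplex.singleObjXSelf (.up ℤ) n M).hom ≫ w) (-1), ?_⟩⟩
  rw [CochainComplex.HomComplex.Cochain.δ_single _ (-1) 0 (by simp) (n - 1) n (by simp) (by simp),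
    CochainComplex.HomComplex.Cochain.ofHom_zero, add_zero, Category.assoc, h7]
  ext p : 1
  by_cases hp : p = n
  · subst hp
    simp
  · exact (HomologicalComplex.isZero_single_obj_X (.up ℤ) n M p hp).eq_of_src _ _

variable [HasDerivedCategory.{w} C]

theorem exists_Q_single_hom {M : C} [Projective M] {Y : DerivedCategory C} {n : ℤ}
    (φ : (homologyFunctor C n).obj (Q.obj ((HomologicalComplex.single C (.up ℤ) n).obj M)) ⟶
      (homologyFunctor C n).obj Y) :
    ∃ f : Q.obj ((HomologicalComplex.single C (.up ℤ) n).obj M) ⟶ Y,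
      (homologyFunctor C n).map f = φ := by
  let L := Q.objPreimage Y
  let e : Q.obj L ≅ Y := Q.objObjPreimageIso Y
  obtain ⟨f, hf⟩ := exists_single_hom_complex L ((homologyQIso _ n).inv ≫ φ ≫
    (homologyFunctor C n).map e.inv ≫ (homologyQIso L n).hom)
  refine ⟨Q.map f ≫ e.hom, ?_⟩
  have h1 : (homologyFunctor C n).map (Q.map f) = φ ≫ (homologyFunctor C n).map e.inv := by
    rw [homologyMap_Q_map, hf, Category.assoc, Category.assoc, Category.assoc,
      Iso.hom_inv_id_assoc, Iso.hom_inv_id, Category.comp_id]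
  rw [Functor.map_comp, h1, Category.assoc, ← Functor.map_comp, e.inv_hom_id, CategoryTheory.Functor.map_id,
    Category.comp_id]

theorem Q_single_hom_eq_zero {M : C} [Projective M] {Y : DerivedCategory C} {n : ℤ}
    (f : Q.obj ((HomologicalComplex.single C (.up ℤ) n).obj M) ⟶ Y)
    (hf : (homologyFunctor C n).map f = 0) : f = 0 := by
  let L := Q.objPreimage Y
  let e : Q.obj L ≅ Y := Q.objObjPreimageIso Y
  have : CochainComplex.IsKProjective ((HomologicalComplex.single C (.up ℤ) n).obj M) :=
    isKProjective_single M n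
  obtain ⟨g, hg⟩ := exists_Q_map_eq_of_isKProjective (f ≫ e.inv)
  obtain ⟨H⟩ := homotopy_zero_of_single g (by
    have h2 := homologyMap_Q_map g n
    rw [hg, Functor.map_comp, hf, zero_comp] at h2
    exact zero_of_comp_mono _ (zero_of_epi_comp _ h2.symm))
  rw [Q_map_eq_of_homotopy C H, Functor.map_zero] at hg
  exact zero_of_comp_mono e.inv hg.symm

theorem exists_single_hom {M : C} [Projective M] {Y : DerivedCategory C} {n : ℤ}
    (φ : (homologyFunctor C n).obj ((singleFunctor C n).obj M) ⟶ (homologyFunctor C n).obj Y) :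
    ∃ f : (singleFunctor C n).obj M ⟶ Y, (homologyFunctor C n).map f = φ :=
  exists_Q_single_hom φ

theorem single_hom_eq_zero {M : C} [Projective M] {Y : DerivedCategory C} {n : ℤ}
    (f : (singleFunctor C n).obj M ⟶ Y) (hf : (homologyFunctor C n).map f = 0) : f = 0 :=
  Q_single_hom_eq_zero f hf

theorem single_hom_eq_zero_of_isZero {M : C} [Projective M] {Y : DerivedCategory C} {n : ℤ}
    (hY : IsZero ((homologyFunctor C n).obj Y)) (f : (singleFunctor C n).obj M ⟶ Y) : f = 0 :=
  single_hom_eq_zero f (hY.eq_of_tgt _ _)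

theorem isZero_of_isZero_homology {X : DerivedCategory C}
    (h : ∀ n, IsZero ((homologyFunctor C n).obj X)) : IsZero X := by
  have : IsIso (0 : X ⟶ (0 : DerivedCategory C)) := (isIso_iff _ _).2 fun n =>
    ⟨0, (h n).eq_of_src _ _,
      (Functor.map_isZero (homologyFunctor C n) (isZero_zero _)).eq_of_src _ _⟩
  exact (isZero_zero _).of_iso (asIso (0 : X ⟶ (0 : DerivedCategory C)))

end DerivedCategory

/-! ### Perfect objects -/

section Perfect

open DerivedCategory
open scoped ZeroObject ModuleCat

variable {R : Type u} [Ring R]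

namespace IsPerfectComplex

theorem shift {K : CochainComplex (ModuleCat.{u} R) ℤ} (hK : IsPerfectComplex K) (n : ℤ) :
    IsPerfectComplex (K⟦n⟧) where
  finite i := hK.finite (i + n)
  projective i := hK.projective (i + n)
  bounded := by
    obtain ⟨a, b, h1, h2⟩ := hK.bounded
    exact ⟨a - n, b - n, K.isStrictlyGE_shift a n _ (by lia), K.isStrictlyLE_shift b n _ (by lia)⟩

theorem mappingCone {K L : CochainComplex (ModuleCat.{u} R) ℤ} (hK : IsPerfectComplex K)
    (hL : IsPerfectComplex L) (f : K ⟶ L) : IsPerfectComplex (CochainComplex.mappingCone f) := by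
  have e (i : ℤ) : (CochainComplex.mappingCone f).X i ≅ K.X (i + 1) ⊞ L.X i :=
    HomologicalComplex.homotopyCofiber.XIsoBiprod f i (i + 1) rfl
  refine ⟨fun i => ?_, fun i => ?_, ?_⟩
  · have := hK.finite (i + 1)
    have := hL.finite i
    exact Module.Finite.equiv ((e i).trans (ModuleCat.biprodIsoProd _ _)).symm.toLinearEquiv
  · have := hK.projective (i + 1)
    have := hL.projective i
    exact Projective.of_iso (e i).symm inferInstance
  · obtain ⟨a, b, h1, h2⟩ := hK.bounded
    obtain ⟨a', b', h1', h2'⟩ := hL.bounded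
    refine ⟨min (a - 1) a', max b b', ?_, ?_⟩
    · rw [CochainComplex.isStrictlyGE_iff]
      intro i hi
      refine IsZero.of_iso ?_ (e i)
      rw [biprod_isZero_iff]
      exact ⟨K.isZero_of_isStrictlyGE a _ (by lia), L.isZero_of_isStrictlyGE a' _ (by lia)⟩
    · rw [CochainComplex.isStrictlyLE_iff]
      intro i hi
      refine IsZero.of_iso ?_ (e i)
      rw [biprod_isZero_iff]
      exact ⟨K.isZero_of_isStrictlyLE b _ (by lia), L.isZero_of_isStrictlyLE b' _ (by lia)⟩

theorem single (M : ModuleCat.{u} R) [hM : Module.Finite R M] [Projective M] (n : ℤ) :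
    IsPerfectComplex ((CochainComplex.singleFunctor (ModuleCat.{u} R) n).obj M) := by
  have e1 : ((CochainComplex.singleFunctor (ModuleCat.{u} R) n).obj M).X n ≅ M :=
    HomologicalComplex.singleObjXSelf (.up ℤ) n M
  have e2 (i : ℤ) (hi : i ≠ n) :
      IsZero (((CochainComplex.singleFunctor (ModuleCat.{u} R) n).obj M).X i) :=
    HomologicalComplex.isZero_single_obj_X (.up ℤ) n M i hi
  refine ⟨fun i => ?_, fun i => ?_, n, n, inferInstance, inferInstance⟩
  · by_cases hi : i = n
    · subst hi
      exact Module.Finite.equiv e1.symm.toLinearEquiv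
    · have := ModuleCat.subsingleton_of_isZero (e2 i hi)
      infer_instance
  · by_cases hi : i = n
    · subst hi
      exact Projective.of_iso e1.symm inferInstance
    · exact Projective.of_iso (e2 i hi).isoZero.symm inferInstance

end IsPerfectComplex

variable [HasDerivedCategory.{u + 1} (ModuleCat.{u} R)]

/-- An object of the derived category is perfect if it is isomorphic to a bounded complex of
finitely generated projective modules. -/
def IsPerfect (X : DerivedCategory (ModuleCat.{u} R)) : Prop :=
  ∃ K, IsPerfectComplex K ∧ Nonempty (X ≅ Q.obj K)

namespace IsPerfect

variable {X Y : DerivedCategory (ModuleCat.{u} R)}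

theorem of_iso (e : X ≅ Y) (hX : IsPerfect X) : IsPerfect Y := by
  obtain ⟨K, hK, ⟨e'⟩⟩ := hX
  exact ⟨K, hK, ⟨e.symm ≪≫ e'⟩⟩

theorem shift (hX : IsPerfect X) (n : ℤ) : IsPerfect (X⟦n⟧) := by
  obtain ⟨K, hK, ⟨e⟩⟩ := hX
  exact ⟨K⟦n⟧, hK.shift n,
    ⟨(shiftFunctor (DerivedCategory _) n).mapIso e ≪≫ (Q.commShiftIso n).symm.app K⟩⟩

theorem single (M : ModuleCat.{u} R) [Module.Finite R M] [Projective M] (n : ℤ) :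
    IsPerfect ((singleFunctor (ModuleCat.{u} R) n).obj M) :=
  ⟨_, IsPerfectComplex.single M n, ⟨Iso.refl _⟩⟩

theorem of_isZero (hX : IsZero X) : IsPerfect X := by
  have : Projective (0 : ModuleCat.{u} R) := inferInstance
  have : Module.Finite R (0 : ModuleCat.{u} R) := by
    have := ModuleCat.subsingleton_of_isZero (isZero_zero (ModuleCat.{u} R))
    infer_instance
  refine of_iso ?_ (single 0 0)
  exact (Functor.map_isZero (singleFunctor (ModuleCat.{u} R) 0) (isZero_zero _)).iso hX

/-- K-projectivity realizes the first morphism by a chain map of perfect complexes, whose mapping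
cone is again perfect. -/
theorem obj₃ (T : Triangle (DerivedCategory (ModuleCat.{u} R))) (hT : T ∈ distTriang _)
    (h₁ : IsPerfect T.obj₁) (h₂ : IsPerfect T.obj₂) : IsPerfect T.obj₃ := by
  obtain ⟨K, hK, ⟨e₁⟩⟩ := h₁
  obtain ⟨L, hL, ⟨e₂⟩⟩ := h₂
  have := hK.isKProjective
  obtain ⟨f, hf⟩ := exists_Q_map_eq_of_isKProjective (e₁.inv ≫ T.mor₁ ≫ e₂.hom)
  have hT' := mappingCone_triangle_distinguished f
  let e := isoTriangleOfIso₁₂ T _ hT hT' e₁ e₂ (by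
    change T.mor₁ ≫ e₂.hom = e₁.hom ≫ Q.map f
    rw [hf, Iso.hom_inv_id_assoc])
  exact ⟨_, hK.mappingCone hL f, ⟨Triangle.π₃.mapIso e⟩⟩

theorem obj₂ (T : Triangle (DerivedCategory (ModuleCat.{u} R))) (hT : T ∈ distTriang _)
    (h₁ : IsPerfect T.obj₁) (h₃ : IsPerfect T.obj₃) : IsPerfect T.obj₂ :=
  obj₃ _ (inv_rot_of_distTriang _ hT) (h₃.shift _) h₁

theorem hom_eq_zero_of_dual {k : Type u} [Field k] [Algebra k R] [Module.Finite k R]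
    (t : SymmetrizingForm k R) (hX : IsPerfect X) (h : ∀ g : Y ⟶ X, g = 0) (f : X ⟶ Y) :
    f = 0 := by
  obtain ⟨K, hK, ⟨e⟩⟩ := hX
  let L := Q.objPreimage Y
  let e' : Q.obj L ≅ Y := Q.objObjPreimageIso Y
  have := hK.subsingleton_hom_of_dual t (L := L)
    (fun g => by
      have := h (e'.inv ≫ g ≫ e.inv)
      exact zero_of_comp_mono _ (zero_of_epi_comp _ this)) (e.inv ≫ f ≫ e'.inv)
  exact zero_of_comp_mono _ (zero_of_epi_comp _ this)

end IsPerfect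

end Perfect

/-! ### Simple modules as direct summands of the ring modulo its radical -/

section SimpleModules

variable {R : Type u} [Ring R]

theorem isSemisimpleModule_quotient_jacobson [IsArtinianRing R] :
    IsSemisimpleModule R (R ⧸ Ring.jacobson R) := by
  have h : IsSemisimpleRing (R ⧸ Ring.jacobson R) := IsSemiprimaryRing.isSemisimpleRing
  let l : (R ⧸ Ring.jacobson R) →ₛₗ[Ideal.Quotient.mk (Ring.jacobson R)] (R ⧸ Ring.jacobson R) :=
    { toFun := id
      map_add' := fun _ _ => rfl
      map_smul' := fun r x => by
        obtain ⟨x, rfl⟩ := Ideal.Quotient.mk_surjective x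
        rfl }
  have : RingHomSurjective (Ideal.Quotient.mk (Ring.jacobson R)) := ⟨Ideal.Quotient.mk_surjective⟩
  exact (l.isSemisimpleModule_iff_of_bijective Function.bijective_id).2 h

/-- The radical lies in every maximal left ideal, so `R / rad R` maps onto `S`; the surjection
splits by semisimplicity. -/
theorem exists_retract_quotient_jacobson [IsArtinianRing R] (S : Type u) [AddCommGroup S]
    [Module R S] [IsSimpleModule R S] :
    ∃ (i : S →ₗ[R] R ⧸ Ring.jacobson R) (p : (R ⧸ Ring.jacobson R) →ₗ[R] S),
      p ∘ₗ i = LinearMap.id := by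
  obtain ⟨m, hm, ⟨e⟩⟩ := isSimpleModule_iff_quot_maximal.1 ‹IsSimpleModule R S›
  have := isSemisimpleModule_quotient_jacobson (R := R)
  let p : (R ⧸ Ring.jacobson R) →ₗ[R] S :=
    e.symm.toLinearMap ∘ₗ Submodule.factor (Ring.jacobson_le_of_isMaximal m)
  obtain ⟨i, hi⟩ := IsSemisimpleModule.lifting_property p
    (e.symm.surjective.comp (Submodule.factor_surjective _)) LinearMap.id
  exact ⟨i, p, hi⟩

end SimpleModules

/-! ### A criterion for perfect objects -/

section Criterion

open DerivedCategory DerivedCategory.TStructure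
open scoped ZeroObject ModuleCat

variable {k : Type u} [Field k] (A : FinDimAlg k)

/-- The category of all right `A`-modules. -/
abbrev FinDimAlg.RMod : Type (u + 1) := ModuleCat.{u} A.carrierᵐᵒᵖ

/-- The derived category of all right `A`-modules. -/
abbrev FinDimAlg.D : Type (u + 1) := DerivedCategory A.RMod

/-- The algebra as a right module over itself. -/
abbrev FinDimAlg.regular : A.RMod := ModuleCat.of A.carrierᵐᵒᵖ A.carrierᵐᵒᵖ

instance FinDimAlg.finite_op : Module.Finite k A.carrierᵐᵒᵖ :=
  Module.Finite.equiv (MulOpposite.opLinearEquiv k)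

instance FinDimAlg.isArtinianRing_op : IsArtinianRing A.carrierᵐᵒᵖ :=
  IsArtinianRing.of_finite k A.carrierᵐᵒᵖ

variable {A}

/-- This makes finiteness an intrinsic condition over the ring; it can then be carried along ring
maps that are not assumed `k`-linear, as in `RingSummand`. -/
theorem FinDimAlg.finite_iff (M : A.RMod) :
    Module.Finite k M ↔ Module.Finite A.carrierᵐᵒᵖ M :=
  ⟨fun _ => Module.Finite.of_restrictScalars_finite k A.carrierᵐᵒᵖ M,
    fun _ => Module.Finite.trans A.carrierᵐᵒᵖ M⟩

instance FinDimAlg.finiteCohomology_isClosedUnderIsomorphisms :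
    A.finiteCohomology.IsClosedUnderIsomorphisms where
  of_iso {X Y} e hX := by
    refine ⟨fun n => moduleFinite_of_moduleCat_iso ((homologyFunctor A.RMod n).mapIso e) (hX.1 n),
      hX.2.subset fun n hn hz => hn (hz.of_iso ((homologyFunctor A.RMod n).mapIso e).symm)⟩

theorem FinDimAlg.finiteCohomology_iff (X : A.D) : A.finiteCohomology X ↔
    (∀ n, Module.Finite k ((homologyFunctor A.RMod n).obj X)) ∧ ∃ a b : ℤ, X.IsGE a ∧ X.IsLE b := by
  refine and_congr_right fun _ => ⟨fun h => ?_, ?_⟩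
  · obtain ⟨b, hb⟩ := h.bddAbove
    obtain ⟨a, ha⟩ := h.bddBelow
    refine ⟨a, b, (isGE_iff _ _).2 fun i hi => ?_, (isLE_iff _ _).2 fun i hi => ?_⟩
    · by_contra hc
      exact absurd (ha hc) (by lia)
    · by_contra hc
      exact absurd (hb hc) (by lia)
  · rintro ⟨a, b, ha, hb⟩
    refine (Set.finite_Icc a b).subset fun i hi => ?_
    by_contra hc
    rw [Set.mem_Icc, not_and_or, not_le, not_le] at hc
    rcases hc with hc | hc
    · exact hi (X.isZero_of_isGE a i hc)
    · exact hi (X.isZero_of_isLE b i hc)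

theorem FinDimAlg.finiteCohomology_single (M : A.RMod) (hM : Module.Finite k M) (n : ℤ) :
    A.finiteCohomology ((singleFunctor A.RMod n).obj M) := by
  rw [FinDimAlg.finiteCohomology_iff]
  refine ⟨fun i => ?_, n, n, inferInstance, inferInstance⟩
  by_cases hi : i = n
  · subst hi
    exact moduleFinite_of_moduleCat_iso (homologySingleIso M i).symm hM
  · have : IsZero ((homologyFunctor A.RMod i).obj ((singleFunctor A.RMod n).obj M)) := by
      rcases lt_or_gt_of_ne hi with h | h
      · exact isZero_of_isGE _ n i h
      · exact isZero_of_isLE _ n i h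
    have := ModuleCat.subsingleton_of_isZero this
    infer_instance

/-- A surjection from a free module onto a finite-dimensional module. -/
theorem FinDimAlg.exists_free_epi (M : A.RMod) (hM : Module.Finite k M) :
    ∃ (F : A.RMod) (p : F ⟶ M), Module.Finite A.carrierᵐᵒᵖ F ∧ Projective F ∧ Epi p := by
  have := (FinDimAlg.finite_iff M).1 hM
  obtain ⟨n, f, hf⟩ := Module.Finite.exists_fin' A.carrierᵐᵒᵖ M
  refine ⟨ModuleCat.of _ (Fin n → A.carrierᵐᵒᵖ), ModuleCat.ofHom f, ?_, ?_, ?_⟩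
  · change Module.Finite A.carrierᵐᵒᵖ (Fin n → A.carrierᵐᵒᵖ)
    infer_instance
  · exact (IsProjective.iff_projective (Fin n → A.carrierᵐᵒᵖ)).1 inferInstance
  · exact (ModuleCat.epi_iff_surjective _).2 hf

/-- The cohomology of a retract is concentrated in the same degree, so `P` is a module in degree
`n`; full faithfulness of `singleFunctor` makes this module a direct summand of `F`. -/
theorem isPerfect_of_retract_single {P : A.D} {F : A.RMod} [Module.Finite A.carrierᵐᵒᵖ F]
    [Projective F] {n : ℤ} (s : P ⟶ (singleFunctor A.RMod n).obj F)
    (p : (singleFunctor A.RMod n).obj F ⟶ P) (h : s ≫ p = 𝟙 P) : IsPerfect P := by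
  have hz : ∀ i, i ≠ n → IsZero ((homologyFunctor A.RMod i).obj P) := fun i hi => by
    have : IsZero ((homologyFunctor A.RMod i).obj ((singleFunctor A.RMod n).obj F)) := by
      rcases lt_or_gt_of_ne hi with h | h
      · exact isZero_of_isGE _ n i h
      · exact isZero_of_isLE _ n i h
    rw [IsZero.iff_id_eq_zero, ← CategoryTheory.Functor.map_id, ← h, Functor.map_comp,
      this.eq_of_tgt ((homologyFunctor A.RMod i).map s) 0, zero_comp]
  have : P.IsGE n := (isGE_iff _ _).2 fun i hi => hz i (by lia)
  have : P.IsLE n := (isLE_iff _ _).2 fun i hi => hz i (by lia)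
  obtain ⟨M, ⟨e⟩⟩ := exists_iso_singleFunctor_obj_of_isGE_of_isLE P n
  let i : M ⟶ F := (singleFunctor A.RMod n).preimage (e.inv ≫ s)
  let q : F ⟶ M := (singleFunctor A.RMod n).preimage (p ≫ e.hom)
  have hiq : i ≫ q = 𝟙 M := by
    apply (singleFunctor A.RMod n).map_injective
    simp only [i, q, Functor.map_comp, Functor.map_preimage, Category.assoc,
      CategoryTheory.Functor.map_id]
    rw [reassoc_of% h, e.inv_hom_id]
  have : Projective M := ⟨fun {E X} f g _ => ⟨i ≫ Projective.factorThru (q ≫ f) g, by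
    rw [Category.assoc, Projective.factorThru_comp, ← Category.assoc, hiq, Category.id_comp]⟩⟩
  have : Module.Finite A.carrierᵐᵒᵖ M := by
    refine Module.Finite.of_surjective q.hom fun x => ⟨i.hom x, ?_⟩
    exact congrArg (fun f : M ⟶ M => f.hom x) hiq
  exact (IsPerfect.single M n).of_iso e.symm

/-- One step of a projective resolution: a free cover of the top cohomology lifts to a morphism to
`P`, and passing to the cone lowers the top degree by one. -/
theorem exists_single_cover {P : A.D} (hfin : A.finiteCohomology P) {b : ℤ} (hb : P.IsLE b) :
    ∃ (F : A.RMod) (P' : A.D) (f : (singleFunctor A.RMod b).obj F ⟶ P) (g : P ⟶ P')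
      (δ : P' ⟶ ((singleFunctor A.RMod b).obj F)⟦(1 : ℤ)⟧),
      Module.Finite A.carrierᵐᵒᵖ F ∧ Projective F ∧ Triangle.mk f g δ ∈ distTriang A.D ∧
      A.finiteCohomology P' ∧ P'.IsLE (b - 1) := by
  obtain ⟨F, p, hF, hF', hp⟩ := FinDimAlg.exists_free_epi _ (hfin.1 b)
  obtain ⟨f, hf⟩ := exists_single_hom ((homologySingleIso F b).hom ≫ p)
  obtain ⟨P', g, δ, hT⟩ := distinguished_cocone_triangle f
  refine ⟨F, P', f, g, δ, hF, hF', hT, ?_, ?_⟩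
  · exact A.finiteCohomology.ext_of_isTriangulatedClosed₃ _ hT
      (FinDimAlg.finiteCohomology_single F ((FinDimAlg.finite_iff F).2 hF) b) hfin
  · rw [isLE_iff]
    intro i hi
    have h1 : Epi ((homologyFunctor A.RMod i).map g) :=
      (HomologySequence.epi_homologyMap_mor₂_iff _ hT i (i + 1) rfl).2
        ((isZero_of_isLE ((singleFunctor A.RMod b).obj F) b (i + 1) (by lia)).eq_of_tgt _ _)
    have h2 : (homologyFunctor A.RMod i).map g = 0 := by
      by_cases hib : i = b
      · subst hib
        have h3 : Epi ((homologyFunctor A.RMod i).map f) := by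
          rw [hf]
          infer_instance
        have h0 : f ≫ g = 0 := comp_distTriang_mor_zero₁₂ _ hT
        rw [← cancel_epi ((homologyFunctor A.RMod i).map f), comp_zero, ← Functor.map_comp, h0,
          Functor.map_zero]
      · exact (isZero_of_isLE P b i (by lia)).eq_of_src _ _
    exact IsZero.of_epi_eq_zero _ h2

/-- An object with finite-dimensional total cohomology is perfect if it has no nonzero morphisms
to any such object that is concentrated in sufficiently small degrees. -/
theorem isPerfect_of_hom_eq_zero (N : ℤ) (d : ℕ) (P : A.D) (hfin : A.finiteCohomology P)
    (hb : P.IsLE (N + d))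
    (hP : ∀ X : A.D, A.finiteCohomology X → X.IsLE N → ∀ f : P ⟶ X, f = 0) : IsPerfect P := by
  induction d generalizing P with
  | zero =>
    refine IsPerfect.of_isZero ?_
    rw [IsZero.iff_id_eq_zero]
    exact hP P hfin (by simpa using hb) _
  | succ d IH =>
    obtain ⟨F, P', f, g, δ, hF, hF', hT, hfin', hb'⟩ := exists_single_cover hfin hb
    -- When the top degree is `N + 1`, the cone lies in degrees at most `N`. The hypothesis then
    -- kills `g`, so `P` is a retract of the projective module `F` placed in one degree.
    by_cases hd : d = 0
    · have hg : g = 0 := hP P' hfin' (by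
        subst hd
        convert hb' using 1
        simp) g
      obtain ⟨s, hs⟩ := Triangle.coyoneda_exact₂ _ hT (𝟙 P) (by
        change 𝟙 P ≫ g = 0
        rw [hg, comp_zero])
      exact isPerfect_of_retract_single s f hs.symm
    · have hP' : IsPerfect P' := by
        refine IH P' hfin' (by convert hb' using 1; push_cast; ring) fun X hX hXN h => ?_
        -- The orthogonality passes to `P'`: a morphism `P' ⟶ X` factors through `F` in degree `N +
        -- d`, which lies above `N` since `d ≠ 0`, where `X` has no cohomology.
        obtain ⟨h', hh'⟩ := Triangle.yoneda_exact₃ _ hT h (hP X hX hXN (g ≫ h))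
        have e : ((singleFunctor A.RMod (N + (d + 1 : ℕ))).obj F)⟦(1 : ℤ)⟧ ≅
            (singleFunctor A.RMod (N + d)).obj F :=
          ((singleFunctors A.RMod).shiftIso 1 (N + d) (N + (d + 1 : ℕ))
            (by push_cast; ring)).app F
        have h0 : e.inv ≫ h' = 0 :=
          single_hom_eq_zero_of_isZero (isZero_of_isLE X N _ (by lia)) _
        have h1 : h' = 0 := by
          have h3 : h' = e.hom ≫ (e.inv ≫ h') := (e.hom_inv_id_assoc h').symm
          rw [h3, h0]
          exact comp_zero
        rw [hh', h1]
        exact comp_zero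
      exact IsPerfect.obj₂ _ hT (IsPerfect.single F _) hP'

/-- Induction on the length of `M`: each simple subquotient is a retract of the ring modulo its
radical. -/
theorem hom_single_eq_zero_of_finite (P : A.D)
    (h : ∀ f : P ⟶ (singleFunctor A.RMod 0).obj
      (ModuleCat.of _ (A.carrierᵐᵒᵖ ⧸ Ring.jacobson A.carrierᵐᵒᵖ)), f = 0)
    (M : A.RMod) (hM : Module.Finite k M) (f : P ⟶ (singleFunctor A.RMod 0).obj M) : f = 0 := by
  have := (FinDimAlg.finite_iff M).1 hM
  have hM' : IsFiniteLength A.carrierᵐᵒᵖ M :=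
    isFiniteLength_iff_isNoetherian_isArtinian.2 ⟨inferInstance, inferInstance⟩
  suffices ∀ (M : Type u) [AddCommGroup M] [Module A.carrierᵐᵒᵖ M],
      IsFiniteLength A.carrierᵐᵒᵖ M →
      ∀ f : P ⟶ (singleFunctor A.RMod 0).obj (ModuleCat.of _ M), f = 0 from this M hM' f
  intro M _ _ hM
  induction hM with
  | @of_subsingleton M _ _ _ =>
    intro f
    exact (Functor.map_isZero _ (ModuleCat.isZero_of_subsingleton (ModuleCat.of _ M))).eq_of_tgt _ _
  | @of_simple_quotient M _ _ N _ hN IH =>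
    intro f
    let S : ShortComplex A.RMod := ShortComplex.mk (ModuleCat.ofHom N.subtype)
      (ModuleCat.ofHom N.mkQ) (by ext x; simp)
    have hS : S.ShortExact :=
      { exact := by
          rw [ShortComplex.ShortExact.moduleCat_exact_iff_function_exact]
          exact LinearMap.exact_subtype_mkQ N
        mono_f := (ModuleCat.mono_iff_injective _).2 N.subtype_injective
        epi_g := (ModuleCat.epi_iff_surjective _).2 N.mkQ_surjective }
    obtain ⟨i, p, hip⟩ := exists_retract_quotient_jacobson (R := A.carrierᵐᵒᵖ) (M ⧸ N)
    have hQ : ∀ g : P ⟶ (singleFunctor A.RMod 0).obj (ModuleCat.of _ (M ⧸ N)), g = 0 := fun g => by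
      have h1 : (ModuleCat.ofHom i : ModuleCat.of _ (M ⧸ N) ⟶ _) ≫ ModuleCat.ofHom p = 𝟙 _ := by
        rw [← ModuleCat.ofHom_comp, hip]; rfl
      rw [← Category.comp_id g, ← CategoryTheory.Functor.map_id, ← h1, Functor.map_comp,
        ← Category.assoc, h (g ≫ _), zero_comp]
    obtain ⟨g, hg⟩ := Triangle.coyoneda_exact₂ _ hS.singleTriangle_distinguished f (hQ _)
    rw [hg, show g = 0 from IH g]
    exact zero_comp

theorem hom_eq_zero_of_isLE (P : A.D) (N : ℤ)
    (h : ∀ n ≤ N, ∀ f : P⟦n⟧ ⟶ (singleFunctor A.RMod 0).obj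
      (ModuleCat.of _ (A.carrierᵐᵒᵖ ⧸ Ring.jacobson A.carrierᵐᵒᵖ)), f = 0)
    (X : A.D) (hX : A.finiteCohomology X) (hXN : X.IsLE N) (f : P ⟶ X) : f = 0 := by
  have hs : ∀ n ≤ N, ∀ (M : A.RMod), Module.Finite k M →
      ∀ f : P ⟶ (singleFunctor A.RMod n).obj M, f = 0 := fun n hn M hM f => by
    have e : ((singleFunctor A.RMod n).obj M)⟦n⟧ ≅ (singleFunctor A.RMod 0).obj M :=
      ((singleFunctors A.RMod).shiftIso n 0 n (by simp)).app M
    have := hom_single_eq_zero_of_finite _ (h n hn) M hM (f⟦n⟧' ≫ e.hom)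
    have h2 : f⟦n⟧' = 0 := zero_of_comp_mono _ this
    exact (shiftFunctor A.D n).map_injective (by rw [h2, Functor.map_zero])
  obtain ⟨hfin, a, b, ha, -⟩ := (FinDimAlg.finiteCohomology_iff X).1 hX
  -- Here `d` bounds the number of degrees, counted down from `N`, that can carry cohomology.
  -- Truncation splits off the lowest one, `c = N - d` in the induction step, as a
  -- finite-dimensional module covered by `hs`.
  suffices ∀ (d : ℕ) (X : A.D), (∀ n, Module.Finite k ((homologyFunctor A.RMod n).obj X)) →
      X.IsGE (N + 1 - d) → X.IsLE N → ∀ f : P ⟶ X, f = 0 by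
    refine this (N + 1 - a).toNat X hfin ?_ hXN f
    exact t.isGE_of_ge X _ a (by lia)
  clear! X
  intro d
  induction d with
  | zero =>
    intro X _ h1 h2 f
    have h1' : X.IsGE (N + 1) := by simpa using h1
    exact (t.isZero X N (N + 1) (by lia)).eq_of_tgt _ _
  | succ d IH =>
    intro X hX h1 h2 f
    obtain ⟨c, hc⟩ : ∃ c, c = N + 1 - (d + 1 : ℕ) := ⟨_, rfl⟩
    rw [← hc] at h1
    obtain ⟨Y, Z, i, p, δ, hT, hY, hZ⟩ : ∃ (Y Z : A.D) (i : Y ⟶ X) (p : X ⟶ Z) (δ : Z ⟶ Y⟦(1 : ℤ)⟧),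
        Triangle.mk i p δ ∈ distTriang A.D ∧ Y.IsLE c ∧ Z.IsGE (c + 1) :=
      ⟨_, _, _, _, _, t.triangleLTGE_distinguished (c + 1) X, t.isLE_truncLT_obj X (c + 1) c, t.isGE_truncGE_obj X _ _⟩
    have hYX : ∀ n, n < c → IsZero ((homologyFunctor A.RMod n).obj Y) := fun n hn =>
      (HomologySequence.exact₁ _ hT (n - 1) n (by lia)).isZero_of_both_zeros
        ((isZero_of_isGE Z (c + 1) (n - 1) (by lia)).eq_of_src _ _)
        ((isZero_of_isGE X c n hn).eq_of_tgt _ _)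
    have hfin₀ : ∀ M : A.RMod, IsZero M → Module.Finite k M := fun M hM => by
      have := ModuleCat.subsingleton_of_isZero hM
      infer_instance
    have hYfin : Module.Finite k ((homologyFunctor A.RMod c).obj Y) :=
      moduleFinite_of_shortComplex_exact _ (HomologySequence.exact₁ _ hT (c - 1) c (by lia))
        (hfin₀ _ (isZero_of_isGE Z (c + 1) (c - 1) (by lia))) (hX c)
    have hZfin : ∀ n, Module.Finite k ((homologyFunctor A.RMod n).obj Z) := fun n => by
      rcases lt_or_ge n c with hn | hn
      · exact hfin₀ _ (isZero_of_isGE Z (c + 1) n (by lia))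
      · exact moduleFinite_of_shortComplex_exact _ (HomologySequence.exact₃ _ hT n (n + 1) rfl)
          (hX n) (hfin₀ _ (isZero_of_isLE Y c (n + 1) (by lia)))
    have hZN : Z.IsLE N := (isLE_iff _ _).2 fun n hn =>
      (HomologySequence.exact₃ _ hT n (n + 1) rfl).isZero_of_both_zeros
        ((isZero_of_isLE X N n hn).eq_of_src _ _)
        ((isZero_of_isLE Y c (n + 1) (by lia)).eq_of_tgt _ _)
    obtain ⟨g, hg⟩ := Triangle.coyoneda_exact₂ _ hT f
      (IH Z hZfin (by convert hZ using 1; lia) hZN _)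
    have hYc : Y.IsGE c := (isGE_iff _ _).2 hYX
    obtain ⟨M, ⟨e⟩⟩ := exists_iso_singleFunctor_obj_of_isGE_of_isLE Y c
    have hM : Module.Finite k M := moduleFinite_of_moduleCat_iso
      ((homologyFunctor A.RMod c).mapIso e ≪≫ homologySingleIso M c) hYfin
    have hg0 : (show P ⟶ Y from g) = 0 := zero_of_comp_mono e.hom (hs c (by lia) M hM _)
    rw [hg, show g = 0 from hg0]
    exact zero_comp

end Criterion

/-! ### Direct ring summands and their module categories -/

/-- The ring `S` as a direct summand of `R`: the projection `π`, and the multiplicative section `σ`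
whose image is the two-sided ideal generated by the central idempotent `σ 1`. -/
structure RingSummand (R S : Type*) [Ring R] [Ring S] where
  π : R →+* S
  σ : S →ₙ+* R
  π_σ : ∀ s, π (σ s) = s
  σ_π : ∀ r, σ (π r) = σ 1 * r
  σ_π' : ∀ r, σ (π r) = r * σ 1

namespace RingSummand

section Basic

variable {R S : Type*} [Ring R] [Ring S] (h : RingSummand R S)

/-- The opposite summand. -/
def op : RingSummand Rᵐᵒᵖ Sᵐᵒᵖ where
  π := h.π.op
  σ := NonUnitalRingHom.op h.σ
  π_σ s := congrArg MulOpposite.op (h.π_σ s.unop)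
  σ_π r := congrArg MulOpposite.op (h.σ_π' r.unop)
  σ_π' r := congrArg MulOpposite.op (h.σ_π r.unop)

theorem σ_one_mul (s : S) : h.σ 1 * h.σ s = h.σ s := by rw [← map_mul, one_mul]

end Basic

section Modules

variable {R S : Type u} [Ring R] [Ring S] (h : RingSummand R S)

/-- Modules over the summand as modules over the whole ring. -/
noncomputable abbrev inflation : ModuleCat.{u} S ⥤ ModuleCat.{u} R := ModuleCat.restrictScalars h.π

/-- The subgroup of the elements of `M` that are fixed by the idempotent of the summand. -/
def cutSubgroup (M : Type*) [AddCommGroup M] [Module R M] : AddSubgroup M where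
  carrier := {m | h.σ 1 • m = m}
  zero_mem' := smul_zero _
  add_mem' := fun {a b} (ha : _ = _) (hb : _ = _) => (by rw [smul_add, ha, hb] : _ • (a + b) = a + b)
  neg_mem' := fun {a} (ha : _ = _) => (by rw [smul_neg, ha] : _ • (-a) = -a)

theorem mem_cutSubgroup {M : Type*} [AddCommGroup M] [Module R M] (m : M) :
    m ∈ h.cutSubgroup M ↔ h.σ 1 • m = m := Iff.rfl

instance cutModule (M : Type*) [AddCommGroup M] [Module R M] : Module S (h.cutSubgroup M) where
  smul s m := ⟨h.σ s • m.1, by rw [mem_cutSubgroup, smul_smul, σ_one_mul]⟩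
  one_smul m := Subtype.ext m.2
  mul_smul s t m := Subtype.ext (by
    change h.σ (s * t) • m.1 = h.σ s • h.σ t • m.1
    rw [map_mul, mul_smul])
  smul_zero s := Subtype.ext (smul_zero _)
  smul_add s x y := Subtype.ext (smul_add _ _ _)
  add_smul s t x := Subtype.ext (by
    change h.σ (s + t) • x.1 = h.σ s • x.1 + h.σ t • x.1
    rw [map_add, add_smul])
  zero_smul x := Subtype.ext (by
    change h.σ 0 • x.1 = 0
    rw [map_zero, zero_smul])

theorem cut_smul_val {M : Type*} [AddCommGroup M] [Module R M] (s : S) (m : h.cutSubgroup M) :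
    (s • m).1 = h.σ s • m.1 := rfl

theorem π_smul_val {M : Type*} [AddCommGroup M] [Module R M] (r : R) (m : h.cutSubgroup M) :
    (h.π r • m).1 = r • m.1 := by
  rw [cut_smul_val, h.σ_π', mul_smul, (h.mem_cutSubgroup _).1 m.2]

/-- The component of a module on which the summand acts. -/
def cut : ModuleCat.{u} R ⥤ ModuleCat.{u} S where
  obj M := ModuleCat.of S (h.cutSubgroup M)
  map {M N} f := ModuleCat.ofHom
    { toFun := fun m => ⟨f.hom m.1, by
        rw [mem_cutSubgroup, ← map_smul, (h.mem_cutSubgroup _).1 m.2]⟩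
      map_add' := fun x y => Subtype.ext (map_add _ _ _)
      map_smul' := fun s x => Subtype.ext (map_smul _ _ _) }
  map_id M := rfl
  map_comp f g := rfl

instance : h.cut.Additive where
  map_add := rfl

/-- The projection of a module to the component on which the summand acts. -/
noncomputable def toCut (M : ModuleCat.{u} R) : M ⟶ h.inflation.obj (h.cut.obj M) :=
  ModuleCat.ofHom (Y := h.inflation.obj (h.cut.obj M))
    { toFun := fun m => (⟨h.σ 1 • m, by rw [mem_cutSubgroup, smul_smul, σ_one_mul]⟩ :
        h.cutSubgroup M)
      map_add' := fun x y => Subtype.ext (smul_add _ _ _)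
      map_smul' := fun r x => Subtype.ext (by
        change h.σ 1 • r • x = (h.π r • (_ : h.cutSubgroup M)).1
        rw [π_smul_val, smul_smul, smul_smul, ← h.σ_π, h.σ_π']) }

/-- The inclusion of the component of a module on which the summand acts. -/
noncomputable def ofCut (M : ModuleCat.{u} R) : h.inflation.obj (h.cut.obj M) ⟶ M :=
  ModuleCat.ofHom (X := h.inflation.obj (h.cut.obj M))
    { toFun := fun m => (show h.cutSubgroup M from m).1
      map_add' := fun _ _ => rfl
      map_smul' := fun r x => h.π_smul_val (M := M) r x }

theorem cut_inflation_mem (N : ModuleCat.{u} S) (n : h.inflation.obj N) :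
    n ∈ h.cutSubgroup (h.inflation.obj N) := by
  rw [mem_cutSubgroup]
  change h.π (h.σ 1) • (show N from n) = n
  rw [π_σ, one_smul]

/-- A module over the summand is its own component. -/
noncomputable def cutInflation (N : ModuleCat.{u} S) : h.cut.obj (h.inflation.obj N) ≅ N where
  hom := ModuleCat.ofHom
    { toFun := fun n => (show N from n.1)
      map_add' := fun x y => rfl
      map_smul' := fun s x => by
        change h.π (h.σ s) • (show N from x.1) = s • (show N from x.1)
        rw [π_σ] }
  inv := ModuleCat.ofHom
    { toFun := fun n => ⟨n, h.cut_inflation_mem N n⟩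
      map_add' := fun x y => rfl
      map_smul' := fun s x => Subtype.ext (by
        change s • x = h.π (h.σ s) • x
        rw [π_σ]) }
  hom_inv_id := rfl
  inv_hom_id := rfl

/-- The component functor is left adjoint to inflation. -/
noncomputable def cutAdj : h.cut ⊣ h.inflation where
  unit := { app := h.toCut, naturality := fun M N f => by
              ext m
              exact Subtype.ext (map_smul f.hom _ _).symm }
  counit := { app := fun N => (h.cutInflation N).hom, naturality := fun _ _ _ => rfl }
  left_triangle_components M := by
    ext m
    exact Subtype.ext m.2
  right_triangle_components N := by
    ext n
    exact h.cut_inflation_mem N n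

/-- The component functor is right adjoint to inflation. -/
noncomputable def inflationAdj : h.inflation ⊣ h.cut where
  unit := { app := fun N => (h.cutInflation N).inv, naturality := fun _ _ _ => rfl }
  counit := { app := h.ofCut, naturality := fun _ _ _ => rfl }
  left_triangle_components _ := rfl
  right_triangle_components _ := rfl

/-- The component functor and inflation are adjoint on both sides, hence both exact; they can be
derived without resolutions. -/
instance : PreservesFiniteLimits h.cut :=
  have := h.inflationAdj.rightAdjoint_preservesLimits
  inferInstance

instance : PreservesFiniteColimits h.cut :=
  have := h.cutAdj.leftAdjoint_preservesColimits
  inferInstance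

instance : PreservesFiniteLimits h.inflation :=
  have := h.cutAdj.rightAdjoint_preservesLimits
  inferInstance

instance : PreservesFiniteColimits h.inflation :=
  have := h.inflationAdj.leftAdjoint_preservesColimits
  inferInstance

instance (N : ModuleCat.{u} S) : IsIso (h.inflationAdj.unit.app N) :=
  inferInstanceAs (IsIso (h.cutInflation N).inv)

theorem finite_cut (M : ModuleCat.{u} R) [Module.Finite R M] :
    Module.Finite S (h.cut.obj M) := by
  have hf : Module.Finite R (h.inflation.obj (h.cut.obj M)) :=
    Module.Finite.of_surjective (h.toCut M).hom fun m => ⟨h.ofCut M m, Subtype.ext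
      (show h.cutSubgroup M from m).2⟩
  exact Module.Finite.of_surjective (σ := h.π) (M := h.inflation.obj (h.cut.obj M))
    (P := h.cut.obj M) { toFun := id, map_add' := fun _ _ => rfl, map_smul' := fun _ _ => rfl }
    Function.surjective_id

theorem finite_inflation (N : ModuleCat.{u} S) [Module.Finite S N] :
    Module.Finite R (h.inflation.obj N) := by
  obtain ⟨s, hs⟩ := Module.Finite.fg_top (R := S) (M := N)
  refine ⟨⟨s, eq_top_iff.2 fun (x : N) _ => ?_⟩⟩
  have hx : x ∈ Submodule.span S (s : Set N) := by
    rw [hs]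
    trivial
  induction hx using Submodule.span_induction with
  | mem x hx => exact Submodule.subset_span hx
  | zero => exact Submodule.zero_mem _
  | add x y _ _ hx hy => exact Submodule.add_mem _ (hx trivial) (hy trivial)
  | smul a x _ hx =>
    have h1 := Submodule.smul_mem _ (h.σ a) (hx trivial)
    have h2 : h.σ a • (show h.inflation.obj N from x) = (show h.inflation.obj N from a • x) := by
      change h.π (h.σ a) • (show N from x) = a • x
      rw [π_σ]
    rwa [h2] at h1

end Modules

section Complementary

variable {R S T : Type u} [Ring R] [Ring S] [Ring T]

/-- Two summands whose idempotents add up to one. -/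
def IsComplementary (h : RingSummand R S) (h' : RingSummand R T) : Prop :=
  h.σ 1 + h'.σ 1 = 1

variable {h : RingSummand R S} {h' : RingSummand R T}

theorem IsComplementary.symm (H : h.IsComplementary h') : h'.IsComplementary h :=
  (add_comm _ _).trans H

theorem IsComplementary.mul_eq_zero (H : h.IsComplementary h') : h.σ 1 * h'.σ 1 = 0 := by
  have h1 : h'.σ 1 = 1 - h.σ 1 := eq_sub_of_add_eq' H
  rw [h1, mul_sub, mul_one, σ_one_mul, sub_self]

theorem IsComplementary.isZero_cut_inflation (H : h.IsComplementary h') (N : ModuleCat.{u} T) :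
    IsZero (h.cut.obj (h'.inflation.obj N)) := by
  have : Subsingleton (h.cut.obj (h'.inflation.obj N)) := by
    refine subsingleton_of_forall_eq 0 fun x => Subtype.ext ?_
    obtain ⟨x, hx⟩ := x
    have h1 := (h'.mem_cutSubgroup _).1 (h'.cut_inflation_mem N x)
    change x = 0
    rw [← (h.mem_cutSubgroup _).1 hx, ← h1, smul_smul, H.mul_eq_zero, zero_smul]
  exact ModuleCat.isZero_of_subsingleton _

theorem IsComplementary.isZero_of_cut (H : h.IsComplementary h') (M : ModuleCat.{u} R)
    (h₁ : IsZero (h.cut.obj M)) (h₂ : IsZero (h'.cut.obj M)) : IsZero M := by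
  have h₁ := ModuleCat.subsingleton_of_isZero h₁
  have h₂ := ModuleCat.subsingleton_of_isZero h₂
  have : Subsingleton M := by
    refine subsingleton_of_forall_eq 0 fun x => ?_
    have e1 : h.σ 1 • x = 0 := congrArg Subtype.val (Subsingleton.elim (show h.cut.obj M from h.toCut M x) 0)
    have e2 : h'.σ 1 • x = 0 := congrArg Subtype.val (Subsingleton.elim (show h'.cut.obj M from h'.toCut M x) 0)
    rw [← one_smul R x, ← H, add_smul, e1, e2, add_zero]
  exact ModuleCat.isZero_of_subsingleton _

end Complementary

end RingSummand

/-! ### Deriving exact adjoint functors -/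

section Derive

universe w₁ w₂ v₁ v₂ u₁ u₂

variable {C : Type u₁} [Category.{v₁} C] [Abelian C] [HasDerivedCategory.{w₁} C]
  {D : Type u₂} [Category.{v₂} D] [Abelian D] [HasDerivedCategory.{w₂} D]
  {F : C ⥤ D} [F.Additive] {G : D ⥤ C} [G.Additive]

namespace CategoryTheory.Adjunction

/-- The adjunction on complexes induced by an adjunction between additive functors. -/
noncomputable def mapCochainComplex (adj : F ⊣ G) :
    F.mapHomologicalComplex (ComplexShape.up ℤ) ⊣ G.mapHomologicalComplex (ComplexShape.up ℤ) where
  unit :=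
    { app := fun K =>
        { f := fun i => adj.unit.app (K.X i)
          comm' := fun i j _ => (adj.unit.naturality (K.d i j)).symm }
      naturality := fun K L f => by
        ext i
        exact adj.unit.naturality (f.f i) }
  counit :=
    { app := fun K =>
        { f := fun i => adj.counit.app (K.X i)
          comm' := fun i j _ => (adj.counit.naturality (K.d i j)).symm }
      naturality := fun K L f => by
        ext i
        exact adj.counit.naturality (f.f i) }
  left_triangle_components K := by
    ext i
    exact adj.left_triangle_components (K.X i)
  right_triangle_components K := by
    ext i
    exact adj.right_triangle_components (K.X i)

variable [PreservesFiniteLimits F] [PreservesFiniteColimits F]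
  [PreservesFiniteLimits G] [PreservesFiniteColimits G]

noncomputable instance : CatCommSq (F.mapHomologicalComplex (ComplexShape.up ℤ)) DerivedCategory.Q
    DerivedCategory.Q F.mapDerivedCategory :=
  ⟨F.mapDerivedCategoryFactors.symm⟩

/-- The adjunction between derived categories induced by an adjunction between exact functors. -/
noncomputable def mapDerivedCategory (adj : F ⊣ G) :
    F.mapDerivedCategory ⊣ G.mapDerivedCategory :=
  adj.mapCochainComplex.localization
    DerivedCategory.Q (HomologicalComplex.quasiIso C (ComplexShape.up ℤ))
    DerivedCategory.Q (HomologicalComplex.quasiIso D (ComplexShape.up ℤ)) _ _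

/-- Every object of the derived category comes from a complex, and there the derived unit is the
original unit in each degree. It is used to show that derived inflation is fully faithful. -/
instance isIso_unit_mapDerivedCategory (adj : F ⊣ G) [∀ X, IsIso (adj.unit.app X)] :
    IsIso adj.mapDerivedCategory.unit := by
  rw [NatTrans.isIso_iff_isIso_app]
  intro X
  obtain ⟨K, ⟨e⟩⟩ : ∃ K, Nonempty (DerivedCategory.Q.obj K ≅ X) :=
    ⟨_, ⟨DerivedCategory.Q.objObjPreimageIso X⟩⟩
  have h1 : ∀ K, IsIso (adj.mapCochainComplex.unit.app K) := fun K => by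
    have : ∀ i, IsIso ((adj.mapCochainComplex.unit.app K).f i) := fun i =>
      inferInstanceAs (IsIso (adj.unit.app (K.X i)))
    exact HomologicalComplex.Hom.isIso_of_components _
  rw [← NatTrans.isIso_app_iff_of_iso _ e]
  unfold mapDerivedCategory
  rw [localization_unit_app]
  infer_instance

end CategoryTheory.Adjunction

namespace DerivedCategory

variable [PreservesFiniteLimits F] [PreservesFiniteColimits F]

/-- Exact functors commute with cohomology. -/
theorem exists_homologyFunctor_mapDerivedCategory_iso (X : DerivedCategory C) (n : ℤ) :
    Nonempty ((homologyFunctor D n).obj (F.mapDerivedCategory.obj X) ≅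
      F.obj ((homologyFunctor C n).obj X)) := by
  obtain ⟨K, ⟨e⟩⟩ : ∃ K, Nonempty (Q.obj K ≅ X) := ⟨_, ⟨Q.objObjPreimageIso X⟩⟩
  refine ⟨(homologyFunctor D n).mapIso (F.mapDerivedCategory.mapIso e.symm ≪≫
    F.mapDerivedCategoryFactors.app K) ≪≫ homologyQIso _ n ≪≫
    (K.sc n).mapHomologyIso F ≪≫ F.mapIso ((homologyQIso K n).symm ≪≫
    (homologyFunctor C n).mapIso e)⟩

end DerivedCategory

end Derive

/-! ### Bounded derived categories of direct summands -/

namespace RingSummand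

open DerivedCategory

variable {k : Type u} [Field k] {A B : FinDimAlg k} (h : RingSummand A.carrier B.carrier)

theorem finiteCohomology_inflation (X : B.D) (hX : B.finiteCohomology X) :
    A.finiteCohomology (h.op.inflation.mapDerivedCategory.obj X) := by
  refine ⟨fun n => ?_, hX.2.subset fun n hn hz => hn ?_⟩
  · obtain ⟨e⟩ := exists_homologyFunctor_mapDerivedCategory_iso (F := h.op.inflation) X n
    refine moduleFinite_of_moduleCat_iso e.symm ?_
    rw [FinDimAlg.finite_iff]
    have := (FinDimAlg.finite_iff _).1 (hX.1 n)
    exact h.op.finite_inflation _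
  · obtain ⟨e⟩ := exists_homologyFunctor_mapDerivedCategory_iso (F := h.op.inflation) X n
    exact (Functor.map_isZero _ hz).of_iso e

theorem finiteCohomology_cut (X : A.D) (hX : A.finiteCohomology X) :
    B.finiteCohomology (h.op.cut.mapDerivedCategory.obj X) := by
  refine ⟨fun n => ?_, hX.2.subset fun n hn hz => hn ?_⟩
  · obtain ⟨e⟩ := exists_homologyFunctor_mapDerivedCategory_iso (F := h.op.cut) X n
    refine moduleFinite_of_moduleCat_iso e.symm ?_
    rw [FinDimAlg.finite_iff]
    have := (FinDimAlg.finite_iff _).1 (hX.1 n)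
    exact h.op.finite_cut _
  · obtain ⟨e⟩ := exists_homologyFunctor_mapDerivedCategory_iso (F := h.op.cut) X n
    exact (Functor.map_isZero _ hz).of_iso e

/-- The derived inflation functor on bounded derived categories. -/
noncomputable abbrev dbInflation : B.Db ⥤ A.Db :=
  A.finiteCohomology.lift (B.finiteCohomology.ι ⋙ h.op.inflation.mapDerivedCategory)
    fun X => h.finiteCohomology_inflation X.obj X.property

/-- The derived component functor on bounded derived categories. -/
noncomputable abbrev dbCut : A.Db ⥤ B.Db :=
  B.finiteCohomology.lift (A.finiteCohomology.ι ⋙ h.op.cut.mapDerivedCategory)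
    fun X => h.finiteCohomology_cut X.obj X.property

/-- The derived component functor is left adjoint to the derived inflation functor. -/
noncomputable def dbCutAdj : h.dbCut ⊣ h.dbInflation :=
  h.op.cutAdj.mapDerivedCategory.restrictFullyFaithful A.finiteCohomology.fullyFaithfulι
    B.finiteCohomology.fullyFaithfulι (Iso.refl _) (Iso.refl _)

/-- The derived component functor is right adjoint to the derived inflation functor. -/
noncomputable def dbInflationAdj : h.dbInflation ⊣ h.dbCut :=
  h.op.inflationAdj.mapDerivedCategory.restrictFullyFaithful B.finiteCohomology.fullyFaithfulι
    A.finiteCohomology.fullyFaithfulι (Iso.refl _) (Iso.refl _)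

instance : h.op.inflation.mapDerivedCategory.Full :=
  h.op.inflationAdj.mapDerivedCategory.fullyFaithfulLOfIsIsoUnit.full

instance : h.op.inflation.mapDerivedCategory.Faithful :=
  h.op.inflationAdj.mapDerivedCategory.fullyFaithfulLOfIsIsoUnit.faithful

theorem isZero_db_iff (X : A.Db) : IsZero X ↔ IsZero X.obj :=
  ⟨fun hX => Functor.map_isZero A.finiteCohomology.ι hX,
    fun hX => IsZero.of_full_of_faithful_of_isZero A.finiteCohomology.ι X hX⟩

variable {C : FinDimAlg k} {h} {h' : RingSummand A.carrier C.carrier}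

theorem IsComplementary.op (H : h.IsComplementary h') : h.op.IsComplementary h'.op :=
  congrArg MulOpposite.op H

theorem IsComplementary.isZero_dbCut_dbInflation (H : h.IsComplementary h') (X : C.Db) :
    IsZero (h.dbCut.obj (h'.dbInflation.obj X)) := by
  rw [isZero_db_iff]
  refine isZero_of_isZero_homology fun n => ?_
  obtain ⟨e⟩ := exists_homologyFunctor_mapDerivedCategory_iso (F := h.op.cut)
    (h'.dbInflation.obj X).obj n
  obtain ⟨e'⟩ := exists_homologyFunctor_mapDerivedCategory_iso (F := h'.op.inflation) X.obj n
  exact (H.op.isZero_cut_inflation _).of_iso (e ≪≫ h.op.cut.mapIso e')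

theorem IsComplementary.isZero_of_dbCut (H : h.IsComplementary h') (X : A.Db)
    (h₁ : IsZero (h.dbCut.obj X)) (h₂ : IsZero (h'.dbCut.obj X)) : IsZero X := by
  rw [isZero_db_iff] at h₁ h₂ ⊢
  refine isZero_of_isZero_homology fun n => ?_
  obtain ⟨e⟩ := exists_homologyFunctor_mapDerivedCategory_iso (F := h.op.cut) X.obj n
  obtain ⟨e'⟩ := exists_homologyFunctor_mapDerivedCategory_iso (F := h'.op.cut) X.obj n
  exact H.op.isZero_of_cut _ ((Functor.map_isZero (homologyFunctor _ n) h₁).of_iso e.symm)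
    ((Functor.map_isZero (homologyFunctor _ n) h₂).of_iso e'.symm)

end RingSummand

/-! ### Orthogonal decompositions of triangulated categories -/

section Splitting

universe v₁ v₂ v₃ u₁ u₂ u₃

variable
    {C' : Type u₁} [Category.{v₁} C'] [HasZeroObject C'] [HasShift C' ℤ]
    [Preadditive C'] [∀ n : ℤ, (shiftFunctor C' n).Additive] [Pretriangulated C']
    {C : Type u₂} [Category.{v₂} C] [HasZeroObject C] [HasShift C ℤ]
    [Preadditive C] [∀ n : ℤ, (shiftFunctor C n).Additive] [Pretriangulated C]
    {C'' : Type u₃} [Category.{v₃} C''] [HasZeroObject C''] [HasShift C'' ℤ]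
    [Preadditive C''] [∀ n : ℤ, (shiftFunctor C'' n).Additive] [Pretriangulated C'']

theorem distinguished_of_isIso {X Y Z Z' : C} {f : X ⟶ Y} {g : Y ⟶ Z} {δ : Z ⟶ X⟦(1 : ℤ)⟧}
    (hT : Triangle.mk f g δ ∈ distTriang C) (θ : Z ⟶ Z') [IsIso θ] :
    Triangle.mk f (g ≫ θ) (inv θ ≫ δ) ∈ distTriang C :=
  have h : (g ≫ θ) ≫ inv θ = g := by simp
  isomorphic_distinguished _ hT _
    (Triangle.isoMk _ _ (Iso.refl _) (Iso.refl _) (asIso θ).symm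
      ((Category.comp_id f).trans (Category.id_comp f).symm)
      (h.trans (Category.id_comp g).symm)
      (((inv θ ≫ δ) ≫= (shiftFunctor C (1 : ℤ)).map_id X).trans (Category.comp_id _)))

variable (C' C C'') in
/-- An orthogonal decomposition of the triangulated category `C` into `C'` and `C''`. -/
structure TriangulatedSplitting where
  i : C' ⥤ C
  p : C ⥤ C'
  j : C'' ⥤ C
  q : C ⥤ C''
  [iShift : i.CommShift ℤ]
  [pShift : p.CommShift ℤ]
  [jShift : j.CommShift ℤ]
  [qShift : q.CommShift ℤ]
  [iTriangulated : i.IsTriangulated]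
  [pTriangulated : p.IsTriangulated]
  [jTriangulated : j.IsTriangulated]
  [qTriangulated : q.IsTriangulated]
  ip : i ⊣ p
  pi : p ⊣ i
  jq : j ⊣ q
  qj : q ⊣ j
  [i_full : i.Full]
  [i_faithful : i.Faithful]
  [j_full : j.Full]
  [j_faithful : j.Faithful]
  isZero_q_i : ∀ X, IsZero (q.obj (i.obj X))
  isZero_p_j : ∀ X, IsZero (p.obj (j.obj X))
  isZero_of : ∀ X, IsZero (p.obj X) → IsZero (q.obj X) → IsZero X

namespace TriangulatedSplitting

attribute [instance] iShift pShift jShift qShift iTriangulated pTriangulated jTriangulated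
  qTriangulated i_full i_faithful j_full j_faithful

variable (S : TriangulatedSplitting C' C C'')

/-- The decomposition with the two parts exchanged. -/
def swap : TriangulatedSplitting C'' C C' where
  i := S.j
  p := S.q
  j := S.i
  q := S.p
  ip := S.jq
  pi := S.qj
  jq := S.ip
  qj := S.pi
  isZero_q_i := S.isZero_p_j
  isZero_p_j := S.isZero_q_i
  isZero_of X h₁ h₂ := S.isZero_of X h₂ h₁

/-- The two projections jointly detect zero objects, hence the vanishing of a cone. -/
theorem isIso_of {X Y : C} (f : X ⟶ Y) (h₁ : IsIso (S.p.map f)) (h₂ : IsIso (S.q.map f)) :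
    IsIso f := by
  obtain ⟨Z, g, δ, hT⟩ := distinguished_cocone_triangle f
  refine (Triangle.isZero₃_iff_isIso₁ _ hT).1 (S.isZero_of _ ?_ ?_)
  · exact (Triangle.isZero₃_iff_isIso₁ _ (S.p.map_distinguished _ hT)).2 h₁
  · exact (Triangle.isZero₃_iff_isIso₁ _ (S.q.map_distinguished _ hT)).2 h₂

/-- The counit followed by the unit is zero, so the unit factors through the cone of the counit by
some `θ`. Both `p` and `q` send `θ` to an isomorphism, so the cone may be replaced by `j q X`. -/
theorem exists_triangle (X : C) :
    ∃ δ : S.j.obj (S.q.obj X) ⟶ (S.i.obj (S.p.obj X))⟦(1 : ℤ)⟧,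
      Triangle.mk (S.ip.counit.app X) (S.qj.unit.app X) δ ∈ distTriang C := by
  obtain ⟨Z, g, δ, hT⟩ := distinguished_cocone_triangle (S.ip.counit.app X)
  have hc : IsIso (S.p.map (S.ip.counit.app X)) := by
    have := S.ip.right_triangle_components X
    exact isIso_of_hom_comp_eq_id _ this
  have hu : IsIso (S.q.map (S.qj.unit.app X)) := by
    have := S.qj.left_triangle_components X
    exact isIso_of_comp_hom_eq_id _ this
  have hpZ : IsZero (S.p.obj Z) :=
    (Triangle.isZero₃_iff_isIso₁ _ (S.p.map_distinguished _ hT)).2 hc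
  have hqg : IsIso (S.q.map g) :=
    (Triangle.isZero₁_iff_isIso₂ _ (S.q.map_distinguished _ hT)).1 (S.isZero_q_i _)
  have hcu : S.ip.counit.app X ≫ S.qj.unit.app X = 0 :=
    (S.qj.homEquiv _ _).symm.injective ((S.isZero_q_i _).eq_of_src _ _)
  obtain ⟨θ, hθ⟩ := Triangle.yoneda_exact₂ _ hT (S.qj.unit.app X) hcu
  change Z ⟶ _ at θ
  have hθ' : S.qj.unit.app X = g ≫ θ := hθ
  have h₂ : IsIso (S.q.map θ) := by
    rw [hθ', Functor.map_comp] at hu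
    exact IsIso.of_isIso_comp_left (S.q.map g) _
  have h₁ : IsIso (S.p.map θ) :=
    ⟨0, hpZ.eq_of_src _ _, (S.isZero_p_j _).eq_of_src _ _⟩
  have hiso := S.isIso_of θ h₁ h₂
  refine ⟨inv θ ≫ δ, ?_⟩
  rw [hθ']
  exact distinguished_of_isIso hT θ

/-- The recollement given by an orthogonal decomposition. -/
def toRecollement : Recollement C' C C'' where
  iStar := S.i
  iUpperStar := S.p
  iUpperShriek := S.p
  jUpperStar := S.q
  jShriek := S.j
  jStar := S.j
  iUpperStarAdj := S.pi
  iUpperShriekAdj := S.ip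
  jShriekAdj := S.jq
  jStarAdj := S.qj
  iStar_full := inferInstance
  iStar_faithful := inferInstance
  jShriek_full := inferInstance
  jShriek_faithful := inferInstance
  jStar_full := inferInstance
  jStar_faithful := inferInstance
  isZero_iUpperShriek_jStar := S.isZero_p_j
  exists_triangle_shriek_star := S.exists_triangle
  exists_triangle_star_shriek := S.swap.exists_triangle

/-- If `i` were an equivalence, `q` would vanish on every object, although `q j Y` is isomorphic to
`Y`. -/
theorem not_isEquivalence_i (h : ∃ Y : C'', ¬ IsZero Y) : ¬ S.i.IsEquivalence := fun _ => by
  obtain ⟨Y, hY⟩ := h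
  have h1 : IsZero (S.q.obj (S.j.obj Y)) :=
    (S.isZero_q_i _).of_iso (S.q.mapIso (S.i.objObjPreimageIso (S.j.obj Y))).symm
  exact hY (h1.of_iso (asIso (S.jq.unit.app Y)))

theorem isNontrivial_toRecollement (h' : ∃ X : C', ¬ IsZero X) (h'' : ∃ X : C'', ¬ IsZero X) :
    S.toRecollement.IsNontrivial :=
  ⟨S.not_isEquivalence_i h'', S.swap.not_isEquivalence_i h', S.swap.not_isEquivalence_i h'⟩

theorem isIso_counit_of_isZero (X : C) (h : IsZero (S.q.obj X)) : IsIso (S.ip.counit.app X) := by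
  obtain ⟨δ, hT⟩ := S.exists_triangle X
  exact (Triangle.isZero₃_iff_isIso₁ _ hT).1 (Functor.map_isZero _ h)

/-- A fully faithful triangle functor with essential image the kernel of `q` is an equivalence
onto the component `C'`. -/
theorem triangleEquivalent_of_essImage {D : Type*} [Category* D] [HasZeroObject D] [HasShift D ℤ]
    [Preadditive D] [∀ n : ℤ, (shiftFunctor D n).Additive] [Pretriangulated D]
    (F : D ⥤ C) [F.CommShift ℤ] [F.IsTriangulated] [F.Full] [F.Faithful]
    (hF : ∀ X, F.essImage X ↔ IsZero (S.q.obj X)) : TriangleEquivalent D C' := by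
  -- The counit is invertible on the kernel of `q`. Hence `F` followed by `p` inherits full
  -- faithfulness from `F`.
  let e : (F ⋙ S.p) ⋙ S.i ≅ F := NatIso.ofComponents (fun X =>
    have := S.isIso_counit_of_isZero _ ((hF (F.obj X)).1 (F.obj_mem_essImage X))
    asIso (S.ip.counit.app (F.obj X))) (fun f => S.ip.counit.naturality (F.map f))
  have : ((F ⋙ S.p) ⋙ S.i).Full := Functor.Full.of_iso e.symm
  have : ((F ⋙ S.p) ⋙ S.i).Faithful := Functor.Faithful.of_iso e.symm
  refine ⟨F ⋙ S.p, inferInstance, inferInstance, { faithful := ?_, full := ?_, essSurj := ⟨?_⟩ }⟩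
  · exact Functor.Faithful.of_comp (F ⋙ S.p) S.i
  · exact Functor.Full.of_comp_faithful (F ⋙ S.p) S.i
  · intro Z
    obtain ⟨Y, ⟨f⟩⟩ := (hF (S.i.obj Z)).2 (S.isZero_q_i Z)
    exact ⟨Y, ⟨S.p.mapIso f ≪≫ (asIso (S.ip.unit.app Z)).symm⟩⟩

end TriangulatedSplitting

end Splitting

namespace RingSummand

variable {k : Type u} [Field k] {A B C : FinDimAlg k} {h : RingSummand A.carrier B.carrier}
  {h' : RingSummand A.carrier C.carrier}

/-- The decomposition of the bounded derived category of a product of two algebras. -/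
noncomputable def IsComplementary.splitting (H : h.IsComplementary h') :
    TriangulatedSplitting B.Db A.Db C.Db where
  i := h.dbInflation
  p := h.dbCut
  j := h'.dbInflation
  q := h'.dbCut
  ip := h.dbInflationAdj
  pi := h.dbCutAdj
  jq := h'.dbInflationAdj
  qj := h'.dbCutAdj
  isZero_q_i := H.symm.isZero_dbCut_dbInflation
  isZero_p_j := H.isZero_dbCut_dbInflation
  isZero_of := H.isZero_of_dbCut

end RingSummand

/-! ### Morphisms from the regular module in the bounded derived category -/

section Regular

open DerivedCategory DerivedCategory.TStructure

variable {k : Type u} [Field k] (A : FinDimAlg k)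

instance FinDimAlg.projective_regular : Projective A.regular :=
  (IsProjective.iff_projective A.carrierᵐᵒᵖ).1 inferInstance

instance FinDimAlg.finite_regular : Module.Finite A.carrierᵐᵒᵖ A.regular :=
  inferInstanceAs (Module.Finite A.carrierᵐᵒᵖ A.carrierᵐᵒᵖ)

/-- A finite-dimensional module as an object of the bounded derived category. -/
noncomputable def FinDimAlg.dbSingle (M : A.RMod) (hM : Module.Finite A.carrierᵐᵒᵖ M) : A.Db :=
  ⟨(singleFunctor A.RMod 0).obj M,
    FinDimAlg.finiteCohomology_single M ((FinDimAlg.finite_iff M).2 hM) 0⟩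

/-- The regular module as an object of the bounded derived category. -/
noncomputable def FinDimAlg.dbRegular : A.Db := A.dbSingle A.regular A.finite_regular

variable {A}

/-- Morphisms in the bounded derived category are morphisms in the derived category. -/
noncomputable def FinDimAlg.dbHomEquiv (X Y : A.Db) : (X ⟶ Y) ≃ (X.obj ⟶ Y.obj) :=
  A.finiteCohomology.fullyFaithfulι.homEquiv

/-- The shift of the bounded derived category is that of the derived category. -/
noncomputable def FinDimAlg.dbShiftIso (X : A.Db) (n : ℤ) : (X⟦n⟧).obj ≅ X.obj⟦n⟧ :=
  (A.finiteCohomology.ι.commShiftIso n).app X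

/-- Morphisms from `A[n]` to `X` compute the cohomology of `X` in degree `-n`. This turns vanishing
and boundedness into statements about morphisms, which adjunctions can move. -/
theorem subsingleton_dbRegular_hom_iff (X : A.Db) (n : ℤ) :
    Subsingleton (A.dbRegular⟦n⟧ ⟶ X) ↔ IsZero ((homologyFunctor A.RMod (-n)).obj X.obj) := by
  let e : (A.dbRegular⟦n⟧).obj ≅ (singleFunctor A.RMod (-n)).obj A.regular :=
    FinDimAlg.dbShiftIso _ n ≪≫ ((singleFunctors A.RMod).shiftIso n (-n) 0 (by simp)).app _
  rw [((FinDimAlg.dbHomEquiv _ X).trans (e.homCongr (Iso.refl _))).subsingleton_congr]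
  constructor
  · intro _
    have h1 : ∀ φ : A.regular ⟶ (homologyFunctor A.RMod (-n)).obj X.obj, φ = 0 := fun φ => by
      obtain ⟨f, hf⟩ := exists_single_hom ((homologySingleIso A.regular (-n)).hom ≫ φ)
      rw [Subsingleton.elim f 0, Functor.map_zero] at hf
      rw [← cancel_epi (homologySingleIso A.regular (-n)).hom, ← hf, comp_zero]
    have : Subsingleton ((homologyFunctor A.RMod (-n)).obj X.obj) := by
      refine subsingleton_of_forall_eq 0 fun x => ?_
      have h2 := congrArg (fun f => f.hom (1 : A.carrierᵐᵒᵖ))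
        (h1 (ModuleCat.ofHom (LinearMap.toSpanSingleton A.carrierᵐᵒᵖ _ x)))
      simpa using h2
    exact ModuleCat.isZero_of_subsingleton _
  · intro h
    exact subsingleton_of_forall_eq 0 fun f => single_hom_eq_zero_of_isZero h f

theorem isZero_of_subsingleton_dbRegular_hom (X : A.Db)
    (h : ∀ n : ℤ, Subsingleton (A.dbRegular⟦n⟧ ⟶ X)) : IsZero X := by
  rw [RingSummand.isZero_db_iff]
  refine isZero_of_isZero_homology fun n => ?_
  have := (subsingleton_dbRegular_hom_iff X (-n)).1 (h _)
  rwa [neg_neg] at this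

theorem exists_subsingleton_dbRegular_hom (X : A.Db) :
    ∃ N : ℤ, ∀ n ≤ N, Subsingleton (A.dbRegular⟦n⟧ ⟶ X) := by
  obtain ⟨-, -, b, -, hb⟩ := (FinDimAlg.finiteCohomology_iff X.obj).1 X.property
  exact ⟨-b - 1, fun n hn => (subsingleton_dbRegular_hom_iff X n).2
    (X.obj.isZero_of_isLE b (-n) (by lia))⟩

theorem subsingleton_hom_of_isPerfect (t : SymmetrizingForm k A.carrierᵐᵒᵖ) {X Y : A.Db}
    (hX : IsPerfect X.obj) (h : Subsingleton (Y ⟶ X)) : Subsingleton (X ⟶ Y) := by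
  rw [(FinDimAlg.dbHomEquiv _ _).subsingleton_congr] at h ⊢
  exact subsingleton_of_forall_eq 0 fun f =>
    hX.hom_eq_zero_of_dual t (fun g => Subsingleton.elim g 0) f

variable (A) in
/-- The semisimple module `A / rad A` as an object of the bounded derived category. -/
noncomputable def FinDimAlg.dbTop : A.Db :=
  A.dbSingle (ModuleCat.of _ (A.carrierᵐᵒᵖ ⧸ Ring.jacobson A.carrierᵐᵒᵖ))
    (inferInstanceAs (Module.Finite A.carrierᵐᵒᵖ (A.carrierᵐᵒᵖ ⧸ Ring.jacobson A.carrierᵐᵒᵖ)))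

theorem isPerfect_of_subsingleton_hom_dbTop (P : A.Db) (N : ℤ)
    (h : ∀ n ≤ N, Subsingleton (P⟦n⟧ ⟶ A.dbTop)) : IsPerfect P.obj := by
  obtain ⟨-, -, b, -, hb⟩ := (FinDimAlg.finiteCohomology_iff P.obj).1 P.property
  refine isPerfect_of_hom_eq_zero N (b - N).toNat P.obj P.property
    (t.isLE_of_le _ b _ (by lia)) fun X hX hXN f => hom_eq_zero_of_isLE P.obj N ?_ X hX hXN f
  intro n hn f
  have h1 := h n hn
  rw [((FinDimAlg.dbHomEquiv _ _).trans
    ((FinDimAlg.dbShiftIso P n).homCongr (Iso.refl _))).subsingleton_congr] at h1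
  exact Subsingleton.elim (α := P.obj⟦n⟧ ⟶ A.dbTop.obj) f 0

end Regular

/-! ### Vanishing of shifted morphisms under adjunction, and retracts -/

section Adjunction

variable {C D : Type*} [Category* C] [Category* D] [HasShift C ℤ] [HasShift D ℤ]

theorem CategoryTheory.Adjunction.subsingleton_shift_hom_iff {F : C ⥤ D} {G : D ⥤ C} (adj : F ⊣ G)
    [F.CommShift ℤ] (X : C) (Y : D) (n : ℤ) :
    Subsingleton ((F.obj X)⟦n⟧ ⟶ Y) ↔ Subsingleton (X⟦n⟧ ⟶ G.obj Y) :=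
  ((((F.commShiftIso n).app X).symm.homCongr (Iso.refl Y)).trans
    (adj.homEquiv _ _)).subsingleton_congr

theorem subsingleton_shift_hom_congr {X X' Y : C} (e : X ≅ X') (n : ℤ) :
    Subsingleton (X⟦n⟧ ⟶ Y) ↔ Subsingleton (X'⟦n⟧ ⟶ Y) :=
  (((shiftFunctor C n).mapIso e).homCongr (Iso.refl Y)).subsingleton_congr

/-- Two splittings of the same idempotent have isomorphic images. -/
def isoOfRetracts {X P P' : C} (a : X ⟶ P) (s : P ⟶ X) (a' : X ⟶ P') (s' : P' ⟶ X)
    (h : s ≫ a = 𝟙 P) (h' : s' ≫ a' = 𝟙 P') (H : a ≫ s = a' ≫ s') : P ≅ P' where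
  hom := s ≫ a'
  inv := s' ≫ a
  hom_inv_id := by
    rw [Category.assoc, ← Category.assoc a', ← H, Category.assoc, h, Category.comp_id, h]
  inv_hom_id := by
    rw [Category.assoc, ← Category.assoc a, H, Category.assoc, h', Category.comp_id, h']

end Adjunction

/-! ### The regular module of a summand as a retract of the regular module -/

namespace RingSummand

open DerivedCategory

variable {k : Type u} [Field k] {A B : FinDimAlg k} (h : RingSummand A.carrier B.carrier)

/-- The projection of the regular module to the regular module of a summand. -/
noncomputable def regularProj : A.regular ⟶ h.op.inflation.obj B.regular :=
  ModuleCat.ofHom (Y := h.op.inflation.obj B.regular)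
    { toFun := h.op.π
      map_add' := map_add _
      map_smul' := fun r x => map_mul h.op.π r x }

/-- The inclusion of the regular module of a summand in the regular module. -/
noncomputable def regularIncl : h.op.inflation.obj B.regular ⟶ A.regular :=
  ModuleCat.ofHom (X := h.op.inflation.obj B.regular)
    { toFun := h.op.σ
      map_add' := map_add _
      map_smul' := fun r x => by
        change h.op.σ (h.op.π r * (show B.carrierᵐᵒᵖ from x)) = r * h.op.σ x
        rw [map_mul, h.op.σ_π', mul_assoc, h.op.σ_one_mul] }

theorem regularIncl_proj : h.regularIncl ≫ h.regularProj = 𝟙 _ := by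
  ext x
  exact h.op.π_σ x

/-- The derived inflation of the regular `B`-module is the image of an explicit idempotent of the
regular `A`-module, so it can be compared with any other splitting of that idempotent. -/
theorem exists_retract_dbRegular :
    ∃ (a : A.dbRegular ⟶ h.dbInflation.obj B.dbRegular)
      (s : h.dbInflation.obj B.dbRegular ⟶ A.dbRegular), s ≫ a = 𝟙 _ ∧
      (a ≫ s).hom = (singleFunctor A.RMod 0).map (h.regularProj ≫ h.regularIncl) := by
  let e : h.op.inflation.mapDerivedCategory.obj ((singleFunctor B.RMod 0).obj B.regular) ≅
      (singleFunctor A.RMod 0).obj (h.op.inflation.obj B.regular) :=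
    (h.op.inflation.mapDerivedCategorySingleFunctor 0).app B.regular
  refine ⟨⟨(singleFunctor A.RMod 0).map h.regularProj ≫ e.inv⟩,
    ⟨e.hom ≫ (singleFunctor A.RMod 0).map h.regularIncl⟩, ?_, ?_⟩
  · apply A.finiteCohomology.ι.map_injective
    change (e.hom ≫ (singleFunctor A.RMod 0).map h.regularIncl) ≫
      (singleFunctor A.RMod 0).map h.regularProj ≫ e.inv = 𝟙 _
    rw [Category.assoc, ← Functor.map_comp_assoc, h.regularIncl_proj,
      CategoryTheory.Functor.map_id, Category.id_comp, e.hom_inv_id]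
  · change ((singleFunctor A.RMod 0).map h.regularProj ≫ e.inv) ≫
      e.hom ≫ (singleFunctor A.RMod 0).map h.regularIncl = _
    rw [Category.assoc, e.inv_hom_id_assoc, ← Functor.map_comp]

/-- The adjunction moves inflation to the other side, where shifts of the regular module detect zero
objects. -/
theorem isZero_dbCut_iff (X : A.Db) : IsZero (h.dbCut.obj X) ↔
    ∀ n : ℤ, Subsingleton ((h.dbInflation.obj B.dbRegular)⟦n⟧ ⟶ X) := by
  simp_rw [h.dbInflationAdj.subsingleton_shift_hom_iff]
  exact ⟨fun hX n => ⟨fun f g => hX.eq_of_tgt f g⟩, isZero_of_subsingleton_dbRegular_hom _⟩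

end RingSummand

/-! ### Recollements of bounded derived categories of symmetric algebras -/

section Pretriangulated

variable {C : Type*} [Category* C] [HasZeroObject C] [HasShift C ℤ]
  [Preadditive C] [∀ n : ℤ, (shiftFunctor C n).Additive] [Pretriangulated C]

/-- A distinguished triangle whose outer terms are orthogonal splits by central idempotents. -/
theorem exists_splitting_of_orthogonal {Q U P : C} {c : Q ⟶ U} {u : U ⟶ P} {δ : P ⟶ Q⟦(1 : ℤ)⟧}
    (hT : Triangle.mk c u δ ∈ distTriang C) (h₁ : Subsingleton (P ⟶ Q⟦(1 : ℤ)⟧))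
    (h₂ : Subsingleton (P ⟶ Q)) (h₃ : Subsingleton (Q ⟶ P)) :
    ∃ (s : P ⟶ U) (r : U ⟶ Q), s ≫ u = 𝟙 P ∧ c ≫ r = 𝟙 Q ∧ u ≫ s + r ≫ c = 𝟙 U ∧
      ∀ a : U ⟶ U, a ≫ u ≫ s = u ≫ s ≫ a := by
  -- With `δ = 0` the triangle splits.
  have hδ : δ = 0 := Subsingleton.elim _ _
  obtain ⟨s, hs⟩ := Triangle.coyoneda_exact₃ _ hT (𝟙 P) (by
    change 𝟙 P ≫ δ = 0
    rw [hδ, comp_zero])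
  change P ⟶ U at s
  have hs : s ≫ u = 𝟙 P := hs.symm
  have hc : Mono c := (Triangle.mor₃_eq_zero_iff_mono₁ _ hT).1 hδ
  have hcu : c ≫ u = 0 := comp_distTriang_mor_zero₁₂ _ hT
  obtain ⟨r, hr⟩ := Triangle.coyoneda_exact₂ _ hT (𝟙 U - u ≫ s) (by
    change (𝟙 U - u ≫ s) ≫ u = 0
    rw [Preadditive.sub_comp, Category.assoc, hs, Category.comp_id, Category.id_comp, sub_self])
  change U ⟶ Q at r
  have hr : 𝟙 U - u ≫ s = r ≫ c := hr
  refine ⟨s, r, hs, ?_, by rw [← hr]; abel, fun a => ?_⟩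
  · rw [← cancel_mono c, Category.assoc, ← hr, Preadditive.comp_sub, ← Category.assoc, hcu,
      zero_comp, sub_zero, Category.comp_id, Category.id_comp]
  -- Centrality: the off-diagonal blocks of `a` are morphisms `P ⟶ Q` and `Q ⟶ P`, which vanish.
  · have e1 : (u ≫ s) ≫ a ≫ (r ≫ c) = 0 := by
      have : s ≫ a ≫ r = 0 := Subsingleton.elim _ _
      rw [Category.assoc, ← Category.assoc a, ← Category.assoc s, this, zero_comp, comp_zero]
    have e2 : (r ≫ c) ≫ a ≫ (u ≫ s) = 0 := by
      have : c ≫ a ≫ u = 0 := Subsingleton.elim _ _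
      rw [Category.assoc, ← Category.assoc a, ← Category.assoc c, this, zero_comp, comp_zero]
    rw [← hr, Preadditive.comp_sub, Preadditive.comp_sub, Category.comp_id, sub_eq_zero] at e1
    rw [← hr, Preadditive.sub_comp, Category.id_comp, sub_eq_zero] at e2
    rw [e2, ← Category.assoc u s a, e1]

end Pretriangulated

namespace Recollement

universe v₁ v₂ v₃ u₁ u₂ u₃

variable
    {C' : Type u₁} [Category.{v₁} C'] [HasZeroObject C'] [HasShift C' ℤ]
    [Preadditive C'] [∀ n : ℤ, (shiftFunctor C' n).Additive] [Pretriangulated C']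
    {C : Type u₂} [Category.{v₂} C] [HasZeroObject C] [HasShift C ℤ]
    [Preadditive C] [∀ n : ℤ, (shiftFunctor C n).Additive] [Pretriangulated C]
    {C'' : Type u₃} [Category.{v₃} C''] [HasZeroObject C''] [HasShift C'' ℤ]
    [Preadditive C''] [∀ n : ℤ, (shiftFunctor C'' n).Additive] [Pretriangulated C'']

attribute [instance] iStarShift iUpperStarShift iUpperShriekShift jUpperStarShift jShriekShift
  jStarShift iStarTriangulated iUpperStarTriangulated iUpperShriekTriangulated
  jUpperStarTriangulated jShriekTriangulated jStarTriangulated iStar_full iStar_faithful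
  jShriek_full jShriek_faithful jStar_full jStar_faithful

variable (R : Recollement C' C C'')

/-- Two adjunctions give `Hom(j^* i_* Y, Z) = Hom(Y, i^! j_* Z) = 0`. -/
theorem isZero_jUpperStar_iStar (Y : C') : IsZero (R.jUpperStar.obj (R.iStar.obj Y)) := by
  rw [IsZero.iff_id_eq_zero]
  apply (R.jStarAdj.homEquiv _ _).injective
  apply (R.iUpperShriekAdj.homEquiv _ _).injective
  exact (R.isZero_iUpperShriek_jStar _).eq_of_tgt _ _

theorem mem_essImage_iStar_iff (X : C) : R.iStar.essImage X ↔ IsZero (R.jUpperStar.obj X) := by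
  constructor
  · rintro ⟨Y, ⟨e⟩⟩
    exact (R.isZero_jUpperStar_iStar Y).of_iso (R.jUpperStar.mapIso e.symm)
  · intro h
    obtain ⟨δ, hT⟩ := R.exists_triangle_shriek_star X
    have : IsIso (R.iUpperShriekAdj.counit.app X) :=
      (Triangle.isZero₃_iff_isIso₁ _ hT).1 (Functor.map_isZero _ h)
    exact ⟨_, ⟨asIso (R.iUpperShriekAdj.counit.app X)⟩⟩

theorem mem_essImage_jStar_iff (X : C) : R.jStar.essImage X ↔ IsZero (R.iUpperShriek.obj X) := by
  constructor
  · rintro ⟨Y, ⟨e⟩⟩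
    exact (R.isZero_iUpperShriek_jStar Y).of_iso (R.iUpperShriek.mapIso e.symm)
  · intro h
    obtain ⟨δ, hT⟩ := R.exists_triangle_shriek_star X
    have : IsIso (R.jStarAdj.unit.app X) :=
      (Triangle.isZero₁_iff_isIso₂ _ hT).1 (Functor.map_isZero _ h)
    exact ⟨_, ⟨(asIso (R.jStarAdj.unit.app X)).symm⟩⟩

theorem isZero_iStar_obj_iff (Y : C') : IsZero (R.iStar.obj Y) ↔ IsZero Y :=
  ⟨fun h => IsZero.of_full_of_faithful_of_isZero _ _ h, fun h => Functor.map_isZero _ h⟩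

theorem isZero_jStar_obj_iff (Y : C'') : IsZero (R.jStar.obj Y) ↔ IsZero Y :=
  ⟨fun h => IsZero.of_full_of_faithful_of_isZero _ _ h, fun h => Functor.map_isZero _ h⟩

/-- `i_* i^*` of an object `U` is left orthogonal to `X` as soon as `U` is to `i_* i^! X`. -/
theorem subsingleton_iStar_hom_iff (U X : C) (n : ℤ) :
    Subsingleton ((R.iStar.obj (R.iUpperStar.obj U))⟦n⟧ ⟶ X) ↔
      Subsingleton (U⟦n⟧ ⟶ R.iStar.obj (R.iUpperShriek.obj X)) := by
  rw [R.iUpperShriekAdj.subsingleton_shift_hom_iff, R.iUpperStarAdj.subsingleton_shift_hom_iff]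

/-- `j_! j^*` of an object `U` is left orthogonal to `X` as soon as `U` is to `j_* j^* X`. -/
theorem subsingleton_jShriek_hom_iff (U X : C) (n : ℤ) :
    Subsingleton ((R.jShriek.obj (R.jUpperStar.obj U))⟦n⟧ ⟶ X) ↔
      Subsingleton (U⟦n⟧ ⟶ R.jStar.obj (R.jUpperStar.obj X)) := by
  rw [R.jShriekAdj.subsingleton_shift_hom_iff, R.jStarAdj.subsingleton_shift_hom_iff]

theorem subsingleton_jShriek_hom_iStar (Z : C'') (Y : C') :
    Subsingleton (R.jShriek.obj Z ⟶ R.iStar.obj Y) := by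
  rw [(R.jShriekAdj.homEquiv _ _).subsingleton_congr]
  exact ⟨fun f g => (R.isZero_jUpperStar_iStar Y).eq_of_tgt f g⟩

theorem isEquivalence_iStar_of_isZero (h : ∀ Z : C'', IsZero Z) : R.iStar.IsEquivalence where
  essSurj := ⟨fun X => (R.mem_essImage_iStar_iff X).2 (h _)⟩

theorem isEquivalence_jStar_of_isZero (h : ∀ Z : C', IsZero Z) : R.jStar.IsEquivalence where
  essSurj := ⟨fun X => (R.mem_essImage_jStar_iff X).2 (h _)⟩

end Recollement

/-- The form is the image of `1`; bimodule linearity gives both `φ 1 (x * y)` and `φ 1 (y * x)` the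
value `φ x y`. -/
theorem IsSymmetricAlg.nonempty_symmetrizingForm {k A : Type u} [Field k] [Ring A] [Algebra k A]
    (h : IsSymmetricAlg k A) : Nonempty (SymmetrizingForm k A) := by
  obtain ⟨φ, hφ⟩ := h
  have h1 : ∀ x y, φ 1 (x * y) = φ x y := fun x y => by simpa using (hφ 1 1 x y).symm
  have h2 : ∀ x y, φ 1 (y * x) = φ x y := fun x y => by simpa using (hφ x 1 1 y).symm
  refine ⟨{ form := φ 1, comm := fun x y => (h1 x y).trans (h2 x y).symm,
            nondeg := fun x hx => ?_ }⟩
  refine (map_eq_zero_iff φ φ.injective).1 (LinearMap.ext fun y => ?_)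
  rw [← h2, hx, LinearMap.zero_apply]

/-- The symmetrizing form of the opposite algebra. -/
def SymmetrizingForm.op {k R : Type u} [Field k] [Ring R] [Algebra k R]
    (t : SymmetrizingForm k R) : SymmetrizingForm k Rᵐᵒᵖ where
  form := t.form ∘ₗ (MulOpposite.opLinearEquiv k).symm.toLinearMap
  comm x y := t.comm _ _
  nondeg x hx := MulOpposite.unop_injective (t.nondeg x.unop fun y => by
    rw [t.comm]
    exact hx (MulOpposite.op y))

/-! ### Corners of central idempotents as complementary summands -/

section Corner

variable {k : Type u} [Field k]

/-- The corner algebra of an idempotent. -/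
def FinDimAlg.corner (A : FinDimAlg k) {e : A.carrier} (he : IsIdempotentElem e) : FinDimAlg k where
  carrier := he.Corner

theorem corner_mul_left {A : Type*} [Ring A] {e : A} (he : IsIdempotentElem e) (x : he.Corner) :
    e * x.1 = x.1 := ((Subsemigroup.mem_corner_iff he).1 x.2).1

theorem corner_mul_right {A : Type*} [Ring A] {e : A} (he : IsIdempotentElem e) (x : he.Corner) :
    x.1 * e = x.1 := ((Subsemigroup.mem_corner_iff he).1 x.2).2

theorem mem_corner_of_central {A : Type*} [Ring A] {e : A} (he : IsIdempotentElem e)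
    (hc : ∀ a, e * a = a * e) (a : A) : e * a ∈ Subsemigroup.corner e :=
  (Subsemigroup.mem_corner_iff he).2 ⟨by rw [← mul_assoc, he.eq],
    by rw [hc, mul_assoc, he.eq]⟩

/-- The corner of a central idempotent is a direct summand. -/
def RingSummand.corner {A : Type*} [Ring A] {e : A} (he : IsIdempotentElem e)
    (hc : ∀ a, e * a = a * e) : RingSummand A he.Corner where
  π :=
    { toFun := fun a => ⟨e * a, mem_corner_of_central he hc a⟩
      map_one' := Subtype.ext (mul_one e)
      map_mul' := fun a b => Subtype.ext (by
        change e * (a * b) = e * a * (e * b)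
        rw [hc b, mul_assoc, ← mul_assoc a, ← hc, ← mul_assoc e e, he.eq])
      map_zero' := Subtype.ext (mul_zero e)
      map_add' := fun a b => Subtype.ext (mul_add _ _ _) }
  σ :=
    { toFun := fun x => x.1
      map_mul' := fun _ _ => rfl
      map_zero' := rfl
      map_add' := fun _ _ => rfl }
  π_σ s := Subtype.ext (corner_mul_left he s)
  σ_π r := rfl
  σ_π' r := hc r

theorem one_sub_central {A : Type*} [Ring A] {e : A} (hc : ∀ a, e * a = a * e) (a : A) :
    (1 - e) * a = a * (1 - e) := by
  rw [sub_mul, mul_sub, hc, one_mul, mul_one]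

theorem RingSummand.isComplementary_corner {A : Type u} [Ring A] {e : A} (he : IsIdempotentElem e)
    (hc : ∀ a, e * a = a * e) :
    (RingSummand.corner he hc).IsComplementary
      (RingSummand.corner he.one_sub (one_sub_central hc)) :=
  add_sub_cancel e 1

end Corner

/-! ### From a recollement to a central idempotent -/

section Main

open DerivedCategory

variable {k : Type u} [Field k] {A : FinDimAlg k}

theorem RingSummand.regularProj_incl_apply {B : FinDimAlg k}
    (h : RingSummand A.carrier B.carrier) (y : A.carrierᵐᵒᵖ) :
    (h.regularProj ≫ h.regularIncl).hom y = y * h.op.σ 1 := h.op.σ_π' y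

theorem RingSummand.IsComplementary.regularProj_incl_add {B C : FinDimAlg k}
    {h : RingSummand A.carrier B.carrier} {h' : RingSummand A.carrier C.carrier}
    (H : h.IsComplementary h') :
    h.regularProj ≫ h.regularIncl + h'.regularProj ≫ h'.regularIncl = 𝟙 A.regular := by
  refine ModuleCat.hom_ext (LinearMap.ext fun (y : A.carrierᵐᵒᵖ) => ?_)
  change (h.regularProj ≫ h.regularIncl).hom y + (h'.regularProj ≫ h'.regularIncl).hom y = y
  rw [h.regularProj_incl_apply, h'.regularProj_incl_apply, ← mul_add, H.op, mul_one]

/-- A central idempotent of the endomorphism ring of the regular module comes from the algebra. -/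
theorem exists_central_idempotent (f : A.dbRegular ⟶ A.dbRegular) (hf : f ≫ f = f)
    (hc : ∀ a : A.dbRegular ⟶ A.dbRegular, a ≫ f = f ≫ a) :
    ∃ (e : A.carrier) (he : IsIdempotentElem e) (hc : ∀ a, e * a = a * e),
      f.hom = (singleFunctor A.RMod 0).map
        ((RingSummand.corner he hc).regularProj (A := A) (B := A.corner he) ≫
          (RingSummand.corner he hc).regularIncl (A := A) (B := A.corner he)) := by
  -- Full faithfulness of `singleFunctor` turns `f` into an endomorphism of the regular module,
  -- which is right multiplication by the image `x` of `1`.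
  let φ : A.regular ⟶ A.regular := (singleFunctor A.RMod 0).preimage f.hom
  have hφf : (singleFunctor A.RMod 0).map φ = f.hom := Functor.map_preimage _ _
  obtain ⟨x, hx⟩ : ∃ x : A.carrierᵐᵒᵖ, x = φ.hom (1 : A.carrierᵐᵒᵖ) := ⟨_, rfl⟩
  have hφ : ∀ y : A.carrierᵐᵒᵖ, φ.hom y = y * x := fun y => by
    have := φ.hom.map_smul y (1 : A.carrierᵐᵒᵖ)
    rw [smul_eq_mul, mul_one, ← hx] at this
    exact this
  have hxx : x * x = x := by
    have h1 : φ ≫ φ = φ := (singleFunctor A.RMod 0).map_injective (by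
      rw [Functor.map_comp, hφf]
      exact congrArg (fun g => g.hom) hf)
    have h2 : φ.hom (φ.hom (1 : A.carrierᵐᵒᵖ)) = φ.hom (1 : A.carrierᵐᵒᵖ) :=
      congrArg (fun g => g.hom (1 : A.carrierᵐᵒᵖ)) h1
    rwa [← hx, hφ] at h2
  -- Commuting with all right multiplications makes `x` central.
  have hxc : ∀ y, y * x = x * y := fun y => by
    let ρ : A.regular ⟶ A.regular :=
      ModuleCat.ofHom (LinearMap.toSpanSingleton A.carrierᵐᵒᵖ A.carrierᵐᵒᵖ y)
    have h1 : ρ ≫ φ = φ ≫ ρ := (singleFunctor A.RMod 0).map_injective (by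
      rw [Functor.map_comp, Functor.map_comp, hφf]
      exact congrArg (fun g => g.hom) (hc ⟨(singleFunctor A.RMod 0).map ρ⟩))
    have h2 : φ.hom ((1 : A.carrierᵐᵒᵖ) * y) = φ.hom (1 : A.carrierᵐᵒᵖ) * y :=
      congrArg (fun g => g.hom (1 : A.carrierᵐᵒᵖ)) h1
    rwa [one_mul, hφ, ← hx] at h2
  refine ⟨x.unop, congrArg MulOpposite.unop hxx,
    fun a => congrArg MulOpposite.unop (hxc (MulOpposite.op a)), ?_⟩
  rw [← hφf]
  congr 1
  refine ModuleCat.hom_ext (LinearMap.ext fun (y : A.carrierᵐᵒᵖ) => ?_)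
  have he : IsIdempotentElem x.unop := congrArg MulOpposite.unop hxx
  have hc : ∀ a, x.unop * a = a * x.unop :=
    fun a => congrArg MulOpposite.unop (hxc (MulOpposite.op a))
  exact (hφ y).trans (RingSummand.regularProj_incl_apply (A := A) (B := A.corner he)
    (RingSummand.corner he hc) y).symm

/-- The heart of the proof. The triangle on the regular module splits by perfectness and duality,
its idempotent is central, and the essential images of `i_*` and `j_*` are the orthogonals of the
two resulting summands. -/
theorem exists_idempotent_of_recollement (hA : IsSymmetricAlg k A.carrier) {B' C' : FinDimAlg k}
    (R : Recollement B'.Db A.Db C'.Db) :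
    ∃ (e : A.carrier) (he : IsIdempotentElem e) (_ : ∀ a, e * a = a * e),
      TriangleEquivalent B'.Db (A.corner he).Db ∧
      TriangleEquivalent C'.Db (A.corner he.one_sub).Db := by
  obtain ⟨t⟩ := hA.nonempty_symmetrizingForm
  obtain ⟨P, hP⟩ : ∃ P, P = R.iStar.obj (R.iUpperStar.obj A.dbRegular) := ⟨_, rfl⟩
  obtain ⟨Q, hQ⟩ : ∃ Q, Q = R.jShriek.obj (R.jUpperStar.obj A.dbRegular) := ⟨_, rfl⟩
  have hPhom : ∀ X (n : ℤ), Subsingleton (P⟦n⟧ ⟶ X) ↔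
      Subsingleton (A.dbRegular⟦n⟧ ⟶ R.iStar.obj (R.iUpperShriek.obj X)) := by
    rw [hP]
    exact R.subsingleton_iStar_hom_iff _
  have hQhom : ∀ X (n : ℤ), Subsingleton (Q⟦n⟧ ⟶ X) ↔
      Subsingleton (A.dbRegular⟦n⟧ ⟶ R.jStar.obj (R.jUpperStar.obj X)) := by
    rw [hQ]
    exact R.subsingleton_jShriek_hom_iff _
  -- The bound `N` comes from the bounded cohomology of `i_* i^! (A / rad A)`.
  have hperf : IsPerfect P.obj := by
    obtain ⟨N, hN⟩ := exists_subsingleton_dbRegular_hom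
      (R.iStar.obj (R.iUpperShriek.obj A.dbTop))
    exact isPerfect_of_subsingleton_hom_dbTop P N fun n hn => (hPhom _ n).2 (hN n hn)
  have hQP : Subsingleton (Q ⟶ P) := by
    rw [hP, hQ]
    exact R.subsingleton_jShriek_hom_iStar _ _
  have hQP1 : Subsingleton (Q⟦(1 : ℤ)⟧ ⟶ P) := by
    rw [hQ, hP, R.jShriekAdj.subsingleton_shift_hom_iff]
    exact ⟨fun f g => (R.isZero_jUpperStar_iStar _).eq_of_tgt f g⟩
  obtain ⟨c, u, δ, hT⟩ : ∃ (c : Q ⟶ A.dbRegular) (u : A.dbRegular ⟶ P) (δ : P ⟶ Q⟦(1 : ℤ)⟧),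
      Triangle.mk c u δ ∈ distTriang A.Db := by
    obtain ⟨δ, hT⟩ := R.exists_triangle_star_shriek A.dbRegular
    subst hP hQ
    exact ⟨_, _, δ, hT⟩
  -- Duality reverses the vanishing of morphisms from `Q[1]` and `Q` to the perfect object `P`. The
  -- form is taken on the opposite algebra because right modules are left modules over it.
  obtain ⟨s, r, hsu, hcr, hsum, hcomm⟩ := exists_splitting_of_orthogonal hT
    (subsingleton_hom_of_isPerfect t.op hperf hQP1)
    (subsingleton_hom_of_isPerfect t.op hperf hQP) hQP
  obtain ⟨e, he, hc, hf⟩ := exists_central_idempotent (u ≫ s)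
    (by rw [Category.assoc, ← Category.assoc s, hsu, Category.id_comp])
    (fun a => by rw [hcomm, Category.assoc])
  refine ⟨e, he, hc, ?_⟩
  let h : RingSummand A.carrier (A.corner he).carrier := RingSummand.corner he hc
  let h' : RingSummand A.carrier (A.corner he.one_sub).carrier :=
    RingSummand.corner he.one_sub (one_sub_central hc)
  have H : h.IsComplementary h' := RingSummand.isComplementary_corner he hc
  obtain ⟨a₁, s₁, h₁, h₁'⟩ := h.exists_retract_dbRegular
  obtain ⟨a₂, s₂, h₂, h₂'⟩ := h'.exists_retract_dbRegular
  have e₁ : u ≫ s = a₁ ≫ s₁ := by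
    apply A.finiteCohomology.ι.map_injective
    exact hf.trans h₁'.symm
  have e₂ : r ≫ c = a₂ ≫ s₂ := by
    have : a₁ ≫ s₁ + a₂ ≫ s₂ = 𝟙 _ := by
      apply A.finiteCohomology.ι.map_injective
      change (a₁ ≫ s₁).hom + (a₂ ≫ s₂).hom = 𝟙 ((singleFunctor A.RMod 0).obj A.regular)
      refine (congrArg₂ (· + ·) h₁' h₂').trans ?_
      have h3 := (singleFunctor A.RMod 0).map_add (f := h.regularProj ≫ h.regularIncl)
        (g := h'.regularProj ≫ h'.regularIncl)
      rw [H.regularProj_incl_add, CategoryTheory.Functor.map_id] at h3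
      exact h3.symm
    rw [← e₁, ← hsum] at this
    exact (add_left_cancel this).symm
  -- `P` and `eA` split the same idempotent of the regular module, and `Q` and `(1 - e)A` split its
  -- complement.
  let iP := isoOfRetracts u s a₁ s₁ hsu h₁ e₁
  let iQ := isoOfRetracts r c a₂ s₂ hcr h₂ e₂
  -- The component at `e` vanishes when no shift of `P` maps nontrivially to `X`. By adjunction this
  -- means `i_* i^! X = 0`, so `X` is in the image of `j_*`.
  have hcut (X : A.Db) : IsZero (h.dbCut.obj X) ↔ R.jStar.essImage X := by
    rw [h.isZero_dbCut_iff, R.mem_essImage_jStar_iff, ← R.isZero_iStar_obj_iff]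
    simp_rw [← subsingleton_shift_hom_congr iP, hPhom]
    exact ⟨isZero_of_subsingleton_dbRegular_hom _, fun hX n => ⟨fun f g => hX.eq_of_tgt f g⟩⟩
  have hcut' (X : A.Db) : IsZero (h'.dbCut.obj X) ↔ R.iStar.essImage X := by
    rw [h'.isZero_dbCut_iff, R.mem_essImage_iStar_iff, ← R.isZero_jStar_obj_iff]
    simp_rw [← subsingleton_shift_hom_congr iQ, hQhom]
    exact ⟨isZero_of_subsingleton_dbRegular_hom _, fun hX n => ⟨fun f g => hX.eq_of_tgt f g⟩⟩
  exact ⟨H.splitting.triangleEquivalent_of_essImage R.iStar fun X => (hcut' X).symm,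
    H.splitting.swap.triangleEquivalent_of_essImage R.jStar fun X => (hcut X).symm⟩

end Main

/-! ### Transport along triangle equivalences -/

section Transport

universe v₁ v₂ v₃ v₄ u₁ u₂ u₃ u₄

variable
    {C' : Type u₁} [Category.{v₁} C'] [HasZeroObject C'] [HasShift C' ℤ]
    [Preadditive C'] [∀ n : ℤ, (shiftFunctor C' n).Additive] [Pretriangulated C']
    {C : Type u₂} [Category.{v₂} C] [HasZeroObject C] [HasShift C ℤ]
    [Preadditive C] [∀ n : ℤ, (shiftFunctor C n).Additive] [Pretriangulated C]
    {C'' : Type u₃} [Category.{v₃} C''] [HasZeroObject C''] [HasShift C'' ℤ]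
    [Preadditive C''] [∀ n : ℤ, (shiftFunctor C'' n).Additive] [Pretriangulated C'']
    {D : Type u₄} [Category.{v₄} D] [HasZeroObject D] [HasShift D ℤ]
    [Preadditive D] [∀ n : ℤ, (shiftFunctor D n).Additive] [Pretriangulated D]

theorem TriangleEquivalent.refl : TriangleEquivalent C C :=
  ⟨𝟭 C, inferInstance, inferInstance, inferInstance⟩

theorem TriangleEquivalent.exists_equivalence (h : TriangleEquivalent C D) :
    ∃ (E : C ≌ D) (_ : E.functor.CommShift ℤ) (_ : E.inverse.CommShift ℤ),
      E.functor.IsTriangulated ∧ E.inverse.IsTriangulated := by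
  obtain ⟨F, hF, hF', _⟩ := h
  obtain ⟨E, rfl⟩ : ∃ E : C ≌ D, E.functor = F := ⟨F.asEquivalence, rfl⟩
  let := E.commShiftInverse ℤ
  have := E.commShift_of_functor ℤ
  have : E.IsTriangulated := Equivalence.IsTriangulated.mk' E hF'
  exact ⟨E, hF, inferInstance, hF', inferInstance⟩

theorem TriangleEquivalent.symm (h : TriangleEquivalent C D) : TriangleEquivalent D C := by
  obtain ⟨E, _, _, _, _⟩ := h.exists_equivalence
  exact ⟨E.inverse, inferInstance, inferInstance, inferInstance⟩

theorem TriangleEquivalent.trans (h : TriangleEquivalent C D) (h' : TriangleEquivalent D C'') :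
    TriangleEquivalent C C'' := by
  obtain ⟨F, _, _, _⟩ := h
  obtain ⟨G, _, _, _⟩ := h'
  exact ⟨F ⋙ G, inferInstance, inferInstance, inferInstance⟩

theorem TriangleEquivalent.isZero (h : TriangleEquivalent C D) (hD : ∀ Y : D, IsZero Y) (X : C) :
    IsZero X := by
  obtain ⟨F, _, _, _⟩ := h
  exact IsZero.of_full_of_faithful_of_isZero F X (hD _)

theorem distinguished_of_iso₂ {X Y Y' Z : C} {f : X ⟶ Y} {g : Y ⟶ Z} {δ : Z ⟶ X⟦(1 : ℤ)⟧}
    (hT : Triangle.mk f g δ ∈ distTriang C) (e : Y ≅ Y') :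
    Triangle.mk (f ≫ e.hom) (e.inv ≫ g) δ ∈ distTriang C :=
  have h : (f ≫ e.hom) ≫ e.inv = f := by simp
  isomorphic_distinguished _ hT _
    (Triangle.isoMk _ _ (Iso.refl _) e.symm (Iso.refl _)
      (h.trans (Category.id_comp f).symm) (Category.comp_id (e.inv ≫ g))
      ((δ ≫= (shiftFunctor C (1 : ℤ)).map_id X).trans
        ((Category.comp_id _).trans (Category.id_comp _).symm)))

/-- Transport of a recollement along a triangle equivalence of the middle terms. -/
theorem Recollement.exists_transport (R : Recollement C' C C'') (hR : R.IsNontrivial)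
    (h : TriangleEquivalent C D) : ∃ R' : Recollement C' D C'', R'.IsNontrivial := by
  obtain ⟨E, _, _, _, _⟩ := h.exists_equivalence
  refine ⟨{
    iStar := R.iStar ⋙ E.functor
    iUpperStar := E.inverse ⋙ R.iUpperStar
    iUpperShriek := E.inverse ⋙ R.iUpperShriek
    jUpperStar := E.inverse ⋙ R.jUpperStar
    jShriek := R.jShriek ⋙ E.functor
    jStar := R.jStar ⋙ E.functor
    iUpperStarAdj := E.symm.toAdjunction.comp R.iUpperStarAdj
    iUpperShriekAdj := R.iUpperShriekAdj.comp E.toAdjunction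
    jShriekAdj := R.jShriekAdj.comp E.toAdjunction
    jStarAdj := E.symm.toAdjunction.comp R.jStarAdj
    iStar_full := inferInstance
    iStar_faithful := inferInstance
    jShriek_full := inferInstance
    jShriek_faithful := inferInstance
    jStar_full := inferInstance
    jStar_faithful := inferInstance
    isZero_iUpperShriek_jStar := fun X => (R.isZero_iUpperShriek_jStar X).of_iso
      (R.iUpperShriek.mapIso (E.unitIso.symm.app _))
    exists_triangle_shriek_star := fun X => ?_
    exists_triangle_star_shriek := fun X => ?_ }, ?_⟩
  · obtain ⟨δ, hT⟩ := R.exists_triangle_shriek_star (E.inverse.obj X)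
    have h₁ : (R.iUpperShriekAdj.comp E.toAdjunction).counit.app X =
        E.functor.map (R.iUpperShriekAdj.counit.app (E.inverse.obj X)) ≫ (E.counitIso.app X).hom := by
      rw [Adjunction.comp_counit_app]
      rfl
    have h₂ : (E.symm.toAdjunction.comp R.jStarAdj).unit.app X =
        (E.counitIso.app X).inv ≫ E.functor.map (R.jStarAdj.unit.app (E.inverse.obj X)) := by
      rw [Adjunction.comp_unit_app]
      rfl
    rw [h₁, h₂]
    exact ⟨_, distinguished_of_iso₂ (E.functor.map_distinguished _ hT) (E.counitIso.app X)⟩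
  · obtain ⟨δ, hT⟩ := R.exists_triangle_star_shriek (E.inverse.obj X)
    have h₁ : (R.jShriekAdj.comp E.toAdjunction).counit.app X =
        E.functor.map (R.jShriekAdj.counit.app (E.inverse.obj X)) ≫ (E.counitIso.app X).hom := by
      rw [Adjunction.comp_counit_app]
      rfl
    have h₂ : (E.symm.toAdjunction.comp R.iUpperStarAdj).unit.app X =
        (E.counitIso.app X).inv ≫ E.functor.map (R.iUpperStarAdj.unit.app (E.inverse.obj X)) := by
      rw [Adjunction.comp_unit_app]
      rfl
    rw [h₁, h₂]
    exact ⟨_, distinguished_of_iso₂ (E.functor.map_distinguished _ hT) (E.counitIso.app X)⟩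
  · exact ⟨fun _ => hR.1 (Functor.isEquivalence_of_comp_right R.iStar E.functor),
      fun _ => hR.2.1 (Functor.isEquivalence_of_comp_right R.jShriek E.functor),
      fun _ => hR.2.2 (Functor.isEquivalence_of_comp_right R.jStar E.functor)⟩

end Transport

/-! ### Bounded derived categories and central idempotents -/

section CentralIdempotents

open DerivedCategory

variable {k : Type u} [Field k]

theorem isZero_db_of_subsingleton (A : FinDimAlg k) [Subsingleton A.carrier] (X : A.Db) :
    IsZero X := by
  rw [RingSummand.isZero_db_iff]
  refine isZero_of_isZero_homology fun n => ?_
  have := Module.subsingleton A.carrierᵐᵒᵖ ((homologyFunctor A.RMod n).obj X.obj)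
  exact ModuleCat.isZero_of_subsingleton _

theorem not_isZero_dbRegular (A : FinDimAlg k) [Nontrivial A.carrier] : ¬ IsZero A.dbRegular := by
  rw [RingSummand.isZero_db_iff]
  intro h
  have h1 : IsZero A.regular :=
    (Functor.map_isZero (homologyFunctor A.RMod 0) h).of_iso (homologySingleIso A.regular 0).symm
  have h2 : Subsingleton A.carrierᵐᵒᵖ := ModuleCat.subsingleton_of_isZero h1
  exact not_subsingleton A.carrierᵐᵒᵖ h2

theorem TriangleEquivalent.nontrivial {A B : FinDimAlg k} (h : TriangleEquivalent A.Db B.Db)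
    [Nontrivial A.carrier] : Nontrivial B.carrier := by
  by_contra hB
  rw [not_nontrivial_iff_subsingleton] at hB
  exact not_isZero_dbRegular A (h.isZero (isZero_db_of_subsingleton B) _)

/-- A ring isomorphic to `R` as a direct summand of `R`. -/
def RingSummand.ofRingEquiv {R S : Type*} [Ring R] [Ring S] (e : R ≃+* S) : RingSummand R S where
  π := e
  σ := e.symm
  π_σ := e.apply_symm_apply
  σ_π r := by simp
  σ_π' r := by simp

/-- The zero ring as a direct summand. -/
def RingSummand.zero (R S : Type*) [Ring R] [Ring S] [Subsingleton S] : RingSummand R S where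
  π := { toFun := fun _ => 0
         map_one' := Subsingleton.elim _ _
         map_mul' := fun _ _ => Subsingleton.elim _ _
         map_zero' := rfl
         map_add' := fun _ _ => Subsingleton.elim _ _ }
  σ := 0
  π_σ _ := Subsingleton.elim _ _
  σ_π r := by simp
  σ_π' r := by simp

/-- A ring isomorphism is a summand with zero complement; in the resulting recollement the other
outer term vanishes, so `i_*` is an equivalence. -/
theorem triangleEquivalent_of_ringEquiv {A B : FinDimAlg k} (e : A.carrier ≃+* B.carrier) :
    TriangleEquivalent B.Db A.Db := by
  obtain ⟨Z, hZ⟩ : ∃ Z : FinDimAlg k, Subsingleton Z.carrier :=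
    ⟨{ carrier := PUnit.{u + 1} }, inferInstanceAs (Subsingleton PUnit)⟩
  have H : (RingSummand.ofRingEquiv e).IsComplementary (RingSummand.zero A.carrier Z.carrier) := by
    change e.symm 1 + 0 = 1
    rw [map_one, add_zero]
  exact ⟨H.splitting.i, inferInstance, inferInstance,
    H.splitting.toRecollement.isEquivalence_iStar_of_isZero (isZero_db_of_subsingleton Z)⟩

theorem nontrivial_corner {A : Type*} [Ring A] {e : A} (he : IsIdempotentElem e) (h : e ≠ 0) :
    Nontrivial he.Corner :=
  ⟨1, 0, fun h' => h (congrArg Subtype.val h')⟩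

theorem subsingleton_corner {A : Type*} [Ring A] {e : A} (he : IsIdempotentElem e) (h : e = 0) :
    Subsingleton he.Corner :=
  subsingleton_of_forall_eq 0 fun x => Subtype.ext <|
    (corner_mul_left he x).symm.trans ((congrArg (· * x.1) h).trans (zero_mul _))

theorem exists_recollement_of_central_idempotent (A : FinDimAlg k) {e : A.carrier}
    (he : IsIdempotentElem e) (hc : ∀ a, e * a = a * e) (h0 : e ≠ 0) (h1 : e ≠ 1) :
    ∃ R : Recollement (A.corner he).Db A.Db (A.corner he.one_sub).Db, R.IsNontrivial := by
  have H : RingSummand.IsComplementary (R := A.carrier) (S := (A.corner he).carrier)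
    (T := (A.corner he.one_sub).carrier) _ _ := RingSummand.isComplementary_corner he hc
  have : Nontrivial (A.corner he).carrier := nontrivial_corner he h0
  have : Nontrivial (A.corner he.one_sub).carrier :=
    nontrivial_corner he.one_sub (sub_ne_zero.2 h1.symm)
  exact ⟨H.splitting.toRecollement, H.splitting.isNontrivial_toRecollement
    ⟨_, not_isZero_dbRegular _⟩ ⟨_, not_isZero_dbRegular _⟩⟩

/-- A nontrivial recollement of a category which is triangle equivalent to the bounded derived
category of a symmetric algebra comes from a central idempotent of that algebra. -/
theorem exists_idempotent_of_nontrivial_recollement {A B L M : FinDimAlg k}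
    (hA : IsSymmetricAlg k A.carrier) (h : TriangleEquivalent B.Db A.Db)
    (R : Recollement L.Db B.Db M.Db) (hR : R.IsNontrivial) :
    ∃ (e : A.carrier) (he : IsIdempotentElem e), (∀ a, e * a = a * e) ∧ e ≠ 0 ∧ e ≠ 1 ∧
      TriangleEquivalent L.Db (A.corner he).Db ∧
      TriangleEquivalent M.Db (A.corner he.one_sub).Db := by
  obtain ⟨R, hR⟩ := R.exists_transport hR h
  obtain ⟨e, he, hc, hL, hM⟩ := exists_idempotent_of_recollement hA R
  refine ⟨e, he, hc, fun h0 => ?_, fun h1 => ?_, hL, hM⟩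
  -- If `e = 0` the left term vanishes and `j_*` is an equivalence; if `e = 1` the right term
  -- vanishes and `i_*` is one.
  · have : Subsingleton (A.corner he).carrier := subsingleton_corner he h0
    exact hR.2.2 (R.isEquivalence_jStar_of_isZero (hL.isZero (isZero_db_of_subsingleton _)))
  · have : Subsingleton (A.corner he.one_sub).carrier :=
      subsingleton_corner he.one_sub (by rw [h1, sub_self])
    exact hR.1 (R.isEquivalence_iStar_of_isZero (hM.isZero (isZero_db_of_subsingleton _)))

/-- A central idempotent other than `0` and `1` would give a nontrivial recollement, which
transports back to the simple category. -/
theorem FinDimAlg.IsDbSimple.nontrivial_and_eq_zero_or_one {A B : FinDimAlg k} (hB : B.IsDbSimple)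
    (h : TriangleEquivalent B.Db A.Db) : Nontrivial A.carrier ∧
      ∀ e : A.carrier, IsIdempotentElem e → (∀ a, e * a = a * e) → e = 0 ∨ e = 1 := by
  have := hB.1
  refine ⟨h.nontrivial, fun e he hc => ?_⟩
  by_contra! hcon
  obtain ⟨R, hR⟩ := exists_recollement_of_central_idempotent A he hc hcon.1 hcon.2
  obtain ⟨R', hR'⟩ := R.exists_transport hR h.symm
  exact hB.2 _ _ R' hR'

theorem isDbSimple_of_isSymmetricAlg {A : FinDimAlg k} (hA : IsSymmetricAlg k A.carrier)
    (h0 : Nontrivial A.carrier)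
    (h : ∀ e : A.carrier, IsIdempotentElem e → (∀ a, e * a = a * e) → e = 0 ∨ e = 1) :
    A.IsDbSimple := by
  refine ⟨h0, fun B C R hR => ?_⟩
  obtain ⟨e, he, hc, h0, h1, -⟩ :=
    exists_idempotent_of_nontrivial_recollement hA TriangleEquivalent.refl R hR
  exact (h e he hc).elim h0 h1

end CentralIdempotents

/-! ### Blocks and central idempotents -/

section Blocks

variable {k : Type u} [Field k] {A : Type u} [Ring A] [Algebra k A]

theorem SymmetrizingForm.isSymmetricAlg [Module.Finite k A] (t : SymmetrizingForm k A) :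
    IsSymmetricAlg k A := by
  let f : A →ₗ[k] Module.Dual k A := LinearMap.compr₂ (LinearMap.mul k A) t.form
  have hf : ∀ x y, f x y = t.form (x * y) := fun _ _ => rfl
  have hinj : Function.Injective f := by
    rw [injective_iff_map_eq_zero]
    intro x hx
    refine t.nondeg x fun y => ?_
    rw [t.comm, ← hf, hx, LinearMap.zero_apply]
  refine ⟨LinearEquiv.ofInjectiveOfFinrankEq f hinj (Subspace.dual_finrank_eq).symm,
    fun a x b y => ?_⟩
  change t.form (a * x * b * y) = t.form (x * (b * y * a))
  rw [mul_assoc, mul_assoc, t.comm]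
  simp only [mul_assoc]

/-- The restriction of a symmetrizing form to the corner of a central idempotent. -/
def SymmetrizingForm.corner (t : SymmetrizingForm k A) {e : A} (he : IsIdempotentElem e)
    (hc : ∀ a, e * a = a * e) : SymmetrizingForm k he.Corner where
  form :=
    { toFun := fun x => t.form x.1
      map_add' := fun x y => t.form.map_add x.1 y.1
      map_smul' := fun c x => t.form.map_smul c x.1 }
  comm x y := t.comm x.1 y.1
  nondeg x hx := Subtype.ext (t.nondeg x.1 fun y => by
    have := hx ⟨e * y, mem_corner_of_central he hc y⟩
    rw [← corner_mul_left he x, ← mul_assoc, ← hc]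
    exact this)

theorem IsSymmetricAlg.corner [Module.Finite k A] (hA : IsSymmetricAlg k A) {e : A}
    (he : IsIdempotentElem e) (hc : ∀ a, e * a = a * e) : IsSymmetricAlg k he.Corner := by
  obtain ⟨t⟩ := hA.nonempty_symmetrizingForm
  exact (t.corner he hc).isSymmetricAlg

/-- The inclusion of a corner. -/
def cornerVal (k : Type u) [Field k] [Algebra k A] {e : A} (he : IsIdempotentElem e) :
    he.Corner →ₗ[k] A where
  toFun x := x.1
  map_add' _ _ := rfl
  map_smul' _ _ := rfl

/-- The dimension is the induction measure. Equality would put `1` in the corner and force `e = 1`.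
-/
theorem finrank_corner_lt [Module.Finite k A] {e : A} (he : IsIdempotentElem e) (h1 : e ≠ 1) :
    Module.finrank k he.Corner < Module.finrank k A := by
  have hinj : Function.Injective (cornerVal k he) := Subtype.val_injective
  refine lt_of_le_of_ne (LinearMap.finrank_le_finrank_of_injective hinj) fun heq => h1 ?_
  obtain ⟨x, hx⟩ := ((cornerVal k he).injective_iff_surjective_of_finrank_eq_finrank heq).1 hinj 1
  have := corner_mul_left he x
  rw [show x.1 = 1 from hx, mul_one] at this
  exact this

/-- The decomposition of an algebra given by a central idempotent. -/
noncomputable def cornerProdEquiv (k : Type u) [Field k] [Algebra k A] {e : A} (he : IsIdempotentElem e)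
    (hc : ∀ a, e * a = a * e) : A ≃ₐ[k] he.Corner × he.one_sub.Corner :=
  AlgEquiv.ofBijective
    (AlgHom.ofLinearMap
      { toFun := fun a => ((RingSummand.corner he hc).π a,
          (RingSummand.corner he.one_sub (one_sub_central hc)).π a)
        map_add' := fun a b => Prod.ext (map_add _ a b) (map_add _ a b)
        map_smul' := fun c a => Prod.ext (Subtype.ext (mul_smul_comm c e a))
          (Subtype.ext (mul_smul_comm c (1 - e) a)) }
      (Prod.ext (map_one _) (map_one _)) fun a b => Prod.ext (map_mul _ a b) (map_mul _ a b)) <| by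
    constructor
    · intro a b hab
      have h1 : e * a = e * b := congrArg (fun p => p.1.1) hab
      have h2 : (1 - e) * a = (1 - e) * b := congrArg (fun p => p.2.1) hab
      rw [← one_mul a, ← one_mul b, ← add_sub_cancel e 1, add_mul, add_mul, h1, h2]
    · rintro ⟨x, y⟩
      refine ⟨x.1 + y.1, Prod.ext (Subtype.ext ?_) (Subtype.ext ?_)⟩
      · change e * (x.1 + y.1) = x.1
        rw [mul_add, corner_mul_left he x, ← corner_mul_left he.one_sub y, ← mul_assoc, mul_sub,
          he.eq, mul_one, sub_self, zero_mul, add_zero]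
      · change (1 - e) * (x.1 + y.1) = y.1
        rw [mul_add, corner_mul_left he.one_sub y, ← corner_mul_left he x, ← mul_assoc, sub_mul,
          he.eq, one_mul, sub_self, zero_mul, zero_add]

/-- A central idempotent splits the algebra into its two corners; conversely a product decomposition
yields the idempotent `(1, 0)`. -/
theorem isIndecomposableAlgebra_iff : IsIndecomposableAlgebra k A ↔ Nontrivial A ∧
    ∀ e : A, IsIdempotentElem e → (∀ a, e * a = a * e) → e = 0 ∨ e = 1 := by
  refine and_congr_right fun _ => ⟨fun h e he hc => ?_, fun h B C _ _ _ _ _ _ => ⟨fun φ => ?_⟩⟩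
  · by_contra! hcon
    exact (h he.Corner he.one_sub.Corner (nontrivial_corner he hcon.1)
      (nontrivial_corner he.one_sub (sub_ne_zero.2 hcon.2.symm))).false (cornerProdEquiv k he hc)
  · rcases h (φ.symm (1, 0)) (by
      rw [IsIdempotentElem, ← map_mul]
      simp) (fun a => φ.injective (by
        rw [map_mul, map_mul, φ.apply_symm_apply]
        ext <;> simp)) with h | h
    · rw [map_eq_zero_iff φ.symm φ.symm.injective] at h
      exact one_ne_zero (congrArg Prod.fst h)
    · rw [← map_one φ.symm] at h
      exact zero_ne_one (congrArg Prod.snd (φ.symm.injective h))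

theorem IsIndecomposableAlgebra.of_algEquiv {B : Type u} [Ring B] [Algebra k B] (e : A ≃ₐ[k] B)
    (hA : IsIndecomposableAlgebra k A) : IsIndecomposableAlgebra k B :=
  have := hA.1
  ⟨e.symm.toEquiv.nontrivial, fun B₁ B₂ _ _ _ _ h₁ h₂ =>
    ⟨fun φ => (hA.2 B₁ B₂ h₁ h₂).false (e.trans φ)⟩⟩

theorem isIdempotentElem_corner_val {e : A} {he : IsIdempotentElem e} {x : he.Corner}
    (hx : IsIdempotentElem x) : IsIdempotentElem x.1 := congrArg Subtype.val hx

/-- A corner of a corner is a corner. -/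
def cornerCornerEquiv (k : Type u) [Field k] [Algebra k A] {e : A} (he : IsIdempotentElem e)
    {x : he.Corner} (hx : IsIdempotentElem x) :
    hx.Corner ≃ₐ[k] (isIdempotentElem_corner_val hx).Corner :=
  AlgEquiv.ofLinearEquiv
    { toFun := fun y => ⟨y.1.1, (Subsemigroup.mem_corner_iff (isIdempotentElem_corner_val hx)).2
        ⟨congrArg Subtype.val (corner_mul_left hx y), congrArg Subtype.val (corner_mul_right hx y)⟩⟩
      invFun := fun y => ⟨⟨y.1, (Subsemigroup.mem_corner_iff he).2 (by
          have h1 := corner_mul_left (isIdempotentElem_corner_val hx) y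
          have h2 := corner_mul_right (isIdempotentElem_corner_val hx) y
          constructor
          · rw [← h1, ← mul_assoc, corner_mul_left he x]
          · rw [← h2, mul_assoc, corner_mul_right he x])⟩,
        (Subsemigroup.mem_corner_iff hx).2
          ⟨Subtype.ext (corner_mul_left (isIdempotentElem_corner_val hx) y),
            Subtype.ext (corner_mul_right (isIdempotentElem_corner_val hx) y)⟩⟩
      map_add' := fun _ _ => rfl
      map_smul' := fun _ _ => rfl
      left_inv := fun _ => rfl
      right_inv := fun _ => rfl } rfl fun _ _ => rfl

/-- The corner of the unit is the whole algebra. -/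
def cornerOneEquiv (k A : Type u) [Field k] [Ring A] [Algebra k A] :
    A ≃ₐ[k] (IsIdempotentElem.one (M := A)).Corner :=
  AlgEquiv.ofLinearEquiv
    { toFun := fun a => ⟨a, (Subsemigroup.mem_corner_iff IsIdempotentElem.one).2
        ⟨one_mul a, mul_one a⟩⟩
      invFun := fun a => a.1
      map_add' := fun _ _ => rfl
      map_smul' := fun _ _ => rfl
      left_inv := fun _ => rfl
      right_inv := fun _ => rfl } rfl fun _ _ => rfl

namespace Block

theorem idem_injective : Function.Injective (Block.idem : Block k A → A) := by
  rintro ⟨e, _, _, _⟩ ⟨e', _, _, _⟩ rfl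
  rfl

theorem idem_ne_zero (b : Block k A) : b.idem ≠ 0 := fun h => by
  have := subsingleton_corner b.isIdempotentElem h
  exact (not_subsingleton_iff_nontrivial.2 b.indecomposable.1) this

/-- The product is a central idempotent of the block, which is indecomposable. Hence each block lies
in exactly one of the two corners of `e`. -/
theorem idem_mul_eq_zero_or (b : Block k A) {e : A} (he : IsIdempotentElem e)
    (hc : ∀ a, e * a = a * e) : e * b.idem = 0 ∨ e * b.idem = b.idem := by
  have hi := b.isIdempotentElem
  rw [hc]
  let x : hi.Corner := ⟨b.idem * e, mem_corner_of_central hi b.central e⟩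
  have hx : IsIdempotentElem x := Subtype.ext (by
    change b.idem * e * (b.idem * e) = b.idem * e
    rw [mul_assoc, ← mul_assoc e, hc b.idem, mul_assoc, he.eq, ← mul_assoc, hi.eq])
  have hxc : ∀ a, x * a = a * x := fun a => Subtype.ext (by
    change b.idem * e * a.1 = a.1 * (b.idem * e)
    rw [mul_assoc, hc, ← mul_assoc, b.central, mul_assoc])
  exact ((isIndecomposableAlgebra_iff.1 b.indecomposable).2 x hx hxc).imp
    (congrArg Subtype.val) (congrArg Subtype.val)

/-- A block of the corner of a central idempotent is a block. -/
def ofCorner {e : A} (he : IsIdempotentElem e) (hc : ∀ a, e * a = a * e)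
    (b : Block k he.Corner) : Block k A where
  idem := b.idem.1
  isIdempotentElem := isIdempotentElem_corner_val b.isIdempotentElem
  central a := by
    have := congrArg Subtype.val (b.central ⟨e * a, mem_corner_of_central he hc a⟩)
    change b.idem.1 * (e * a) = e * a * b.idem.1 at this
    rwa [← mul_assoc, corner_mul_right, mul_assoc, hc, mul_assoc, corner_mul_right] at this
  indecomposable := b.indecomposable.of_algEquiv (cornerCornerEquiv k he b.isIdempotentElem)

theorem idem_mem_corner {e : A} (he : IsIdempotentElem e) (hc : ∀ a, e * a = a * e)
    (b : Block k A) (h : e * b.idem = b.idem) : b.idem ∈ Subsemigroup.corner e :=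
  (Subsemigroup.mem_corner_iff he).2 ⟨h, by rw [← hc, h]⟩

/-- The idempotent of a block, as an element of a corner that contains it. -/
def cornerIdem {e : A} (he : IsIdempotentElem e) (hc : ∀ a, e * a = a * e) (b : Block k A)
    (h : e * b.idem = b.idem) : he.Corner := ⟨b.idem, b.idem_mem_corner he hc h⟩

theorem isIdempotentElem_cornerIdem {e : A} (he : IsIdempotentElem e) (hc : ∀ a, e * a = a * e)
    (b : Block k A) (h : e * b.idem = b.idem) : IsIdempotentElem (b.cornerIdem he hc h) :=
  Subtype.ext b.isIdempotentElem

/-- A block that lies in the corner of a central idempotent is a block of that corner. -/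
def toCorner {e : A} (he : IsIdempotentElem e) (hc : ∀ a, e * a = a * e) (b : Block k A)
    (h : e * b.idem = b.idem) : Block k he.Corner where
  idem := b.cornerIdem he hc h
  isIdempotentElem := b.isIdempotentElem_cornerIdem he hc h
  central a := Subtype.ext (b.central a.1)
  indecomposable := b.indecomposable.of_algEquiv
    (cornerCornerEquiv k he (b.isIdempotentElem_cornerIdem he hc h)).symm

/-- The blocks of the two corners of a central idempotent are the blocks of the algebra. -/
noncomputable def cornerSumEquiv {e : A} (he : IsIdempotentElem e) (hc : ∀ a, e * a = a * e) :
    Block k he.Corner ⊕ Block k he.one_sub.Corner ≃ Block k A :=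
  Equiv.ofBijective (Sum.elim (ofCorner he hc) (ofCorner he.one_sub (one_sub_central hc))) <| by
    -- An idempotent in both corners is fixed and killed by `1 - e`, whereas block idempotents are
    -- nonzero.
    have hne : ∀ (b : Block k he.Corner) (b' : Block k he.one_sub.Corner),
        b.idem.1 ≠ b'.idem.1 := fun b b' h => by
      have h1 := corner_mul_left he.one_sub b'.idem
      rw [← h, sub_mul, one_mul, corner_mul_left he b.idem, sub_self] at h1
      exact b.idem_ne_zero (Subtype.ext h1.symm)
    constructor
    · rintro (b | b) (b' | b') h
      · exact congrArg Sum.inl (idem_injective (Subtype.ext (congrArg idem h)))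
      · exact (hne b b' (congrArg idem h)).elim
      · exact (hne b' b (congrArg idem h).symm).elim
      · exact congrArg Sum.inr (idem_injective (Subtype.ext (congrArg idem h)))
    · intro b
      rcases b.idem_mul_eq_zero_or he hc with h | h
      · exact ⟨Sum.inr (b.toCorner he.one_sub (one_sub_central hc)
          (by rw [sub_mul, h, sub_zero, one_mul])), idem_injective rfl⟩
      · exact ⟨Sum.inl (b.toCorner he hc h), idem_injective rfl⟩

/-- An indecomposable algebra has exactly one block. -/
theorem nonempty_unique (hA : IsIndecomposableAlgebra k A) : Nonempty (Unique (Block k A)) :=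
  ⟨{default :=
      { idem := 1
        isIdempotentElem := IsIdempotentElem.one
        central := fun a => (one_mul a).trans (mul_one a).symm
        indecomposable := hA.of_algEquiv (cornerOneEquiv k A) }
    uniq := fun b => idem_injective
      (((isIndecomposableAlgebra_iff.1 hA).2 b.idem b.isIdempotentElem b.central).resolve_left
        b.idem_ne_zero) }⟩

end Block

end Blocks

/-! ### Stratifications -/

section Stratification

variable {k : Type u} [Field k]

theorem Block.triangleEquivalent_ofCorner {A : Type u} [Ring A] [Algebra k A] [Module.Finite k A]
    {e : A} (he : IsIdempotentElem e) (hc : ∀ a, e * a = a * e) (b : Block k he.Corner) :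
    TriangleEquivalent b.alg.Db (b.ofCorner he hc).alg.Db :=
  (triangleEquivalent_of_ringEquiv (A := b.alg) (B := (b.ofCorner he hc).alg)
    (cornerCornerEquiv k he b.isIdempotentElem).toRingEquiv).symm

theorem Block.triangleEquivalent_of_idem_eq_one {A : FinDimAlg k} (b : Block k A.carrier)
    (h : b.idem = 1) : TriangleEquivalent A.Db b.alg.Db := by
  have h1 : ∀ a : A.carrier, a ∈ Subsemigroup.corner b.idem := fun a =>
    (Subsemigroup.mem_corner_iff b.isIdempotentElem).2 ⟨by rw [h, one_mul], by rw [h, mul_one]⟩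
  let e : b.alg.carrier ≃+* A.carrier :=
    { toFun := fun x => (show b.isIdempotentElem.Corner from x).1
      invFun := fun a => (⟨a, h1 a⟩ : b.isIdempotentElem.Corner)
      left_inv := fun _ => rfl
      right_inv := fun _ => rfl
      map_mul' := fun _ _ => rfl
      map_add' := fun _ _ => rfl }
  exact triangleEquivalent_of_ringEquiv e

namespace DbStratification

variable {A : FinDimAlg k} (S : DbStratification A)

theorem mem_of_append_mem (p : List Bool) {q : List Bool} (h : p ++ q ∈ S.nodes) : q ∈ S.nodes := by
  induction p with
  | nil => exact h
  | cons b p IH => exact IH (S.parent_mem _ b h)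

theorem mem_false_iff (b : Bool) : [b] ∈ S.nodes ↔ [false] ∈ S.nodes := by
  cases b
  · rfl
  · exact (S.full []).symm

/-- The part of a stratification that lies above a child of the root. -/
def sub (b : Bool) (hb : [b] ∈ S.nodes) : DbStratification (S.label [b]) where
  -- Paths list the last turn first, so the turn taken at the root is the final entry.
  nodes := {p | p ++ [b] ∈ S.nodes}
  label p := S.label (p ++ [b])
  root_mem := hb
  parent_mem p c h := S.parent_mem (p ++ [b]) c h
  full p := S.full (p ++ [b])
  label_root := rfl
  isDbSimple_of_leaf p h h' := S.isDbSimple_of_leaf (p ++ [b]) h h'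
  exists_recollement p h h' := S.exists_recollement (p ++ [b]) h h'

theorem eq_nil_of_mem (h : [false] ∉ S.nodes) {p : List Bool} (hp : p ∈ S.nodes) : p = [] := by
  rcases List.eq_nil_or_concat p with rfl | ⟨q, b, rfl⟩
  · rfl
  · rw [List.concat_eq_append] at hp
    exact (h ((S.mem_false_iff b).1 (S.mem_of_append_mem q hp))).elim

theorem nodes_finite_of_sub (hb : ∀ b, [b] ∈ S.nodes)
    (h : ∀ b, (S.sub b (hb b)).nodes.Finite) : S.nodes.Finite := by
  refine ((Set.finite_singleton []).union (Set.finite_iUnion fun b =>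
    (h b).image fun p => p ++ [b])).subset fun p hp => ?_
  rcases List.eq_nil_or_concat p with rfl | ⟨q, b, rfl⟩
  · exact Or.inl rfl
  · rw [List.concat_eq_append] at hp ⊢
    exact Or.inr (Set.mem_iUnion.2 ⟨b, q, hp, rfl⟩)

/-- The leaves of a stratification with more than one node lie above one of the two children of
the root. -/
noncomputable def leafSumEquiv (hb : ∀ b, [b] ∈ S.nodes) :
    (S.sub false (hb false)).Leaf ⊕ (S.sub true (hb true)).Leaf ≃ S.Leaf :=
  Equiv.ofBijective
    (Sum.elim (fun p => ⟨p.1 ++ [false], p.2⟩) (fun p => ⟨p.1 ++ [true], p.2⟩)) <| by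
    constructor
    · rintro (⟨p, hp⟩ | ⟨p, hp⟩) (⟨q, hq⟩ | ⟨q, hq⟩) h <;>
        have h' := List.append_inj' (congrArg Subtype.val h) rfl
      · exact congrArg Sum.inl (Subtype.ext h'.1)
      · simp at h'
      · simp at h'
      · exact congrArg Sum.inr (Subtype.ext h'.1)
    · rintro ⟨p, hp⟩
      rcases List.eq_nil_or_concat p with rfl | ⟨q, b, rfl⟩
      · exact (hp.2 (hb false)).elim
      · have hp' := hp
        simp only [List.concat_eq_append] at hp'
        cases b
        · exact ⟨Sum.inl ⟨q, hp'⟩, Subtype.ext (List.concat_eq_append).symm⟩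
        · exact ⟨Sum.inr ⟨q, hp'⟩, Subtype.ext (List.concat_eq_append).symm⟩

/-- The simple factors of a stratification of a category which is triangle equivalent to the bounded
derived category of a symmetric algebra are those of the blocks of the algebra. -/
theorem finite_and_exists_equiv (A : FinDimAlg k) (hA : IsSymmetricAlg k A.carrier)
    {B : FinDimAlg k} (S : DbStratification B) (h : TriangleEquivalent (S.label []).Db A.Db) :
    S.nodes.Finite ∧ ∃ e : S.Leaf ≃ Block k A.carrier,
      ∀ p : S.Leaf, TriangleEquivalent (S.label p.1).Db (e p).alg.Db := by
  -- The induction runs on the dimension of `A`, since the tree may a priori be infinite. `B` varies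
  -- separately because the label of a child is only known to be triangle equivalent to a corner.
  induction hn : Module.finrank k A.carrier using Nat.strong_induction_on generalizing A B with
  | _ n IH =>
  by_cases h0 : [false] ∈ S.nodes
  · obtain ⟨R, hR⟩ := S.exists_recollement [] S.root_mem h0
    obtain ⟨e, he, hc, he0, he1, hL, hM⟩ := exists_idempotent_of_nontrivial_recollement hA h R hR
    have hb : ∀ b, [b] ∈ S.nodes := fun b => (S.mem_false_iff b).2 h0
    obtain ⟨hf₁, e₁, h₁⟩ := IH _ (hn ▸ finrank_corner_lt he he1) (A.corner he) (hA.corner he hc)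
      (S.sub false (hb false)) hL rfl
    have he1' : 1 - e ≠ 1 := fun h => he0 (by rwa [sub_eq_self] at h)
    obtain ⟨hf₂, e₂, h₂⟩ := IH _ (hn ▸ finrank_corner_lt he.one_sub he1') (A.corner he.one_sub)
      (hA.corner he.one_sub (one_sub_central hc)) (S.sub true (hb true)) hM rfl
    refine ⟨S.nodes_finite_of_sub hb (by rintro (_ | _); exacts [hf₁, hf₂]),
      (S.leafSumEquiv hb).symm.trans ((e₁.sumCongr e₂).trans (Block.cornerSumEquiv he hc)),
      fun p => ?_⟩
    obtain ⟨p, rfl⟩ := (S.leafSumEquiv hb).surjective p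
    rw [Equiv.trans_apply, Equiv.symm_apply_apply]
    rcases p with p | p
    · exact (h₁ p).trans ((e₁ p).triangleEquivalent_ofCorner he hc)
    · exact (h₂ p).trans ((e₂ p).triangleEquivalent_ofCorner he.one_sub (one_sub_central hc))
  -- If the root is a leaf, simplicity makes `A` indecomposable, so the single leaf matches the
  -- single block, whose idempotent is `1`.
  · have hA' : IsIndecomposableAlgebra k A.carrier := isIndecomposableAlgebra_iff.2
      ((S.isDbSimple_of_leaf [] S.root_mem h0).nontrivial_and_eq_zero_or_one h)
    obtain ⟨_⟩ := Block.nonempty_unique hA'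
    let _ : Unique S.Leaf :=
      { default := ⟨[], S.root_mem, h0⟩
        uniq := fun p => Subtype.ext (S.eq_nil_of_mem h0 p.2.1) }
    refine ⟨(Set.finite_singleton []).subset fun p hp => S.eq_nil_of_mem h0 hp,
      Equiv.ofUnique _ _, fun p => ?_⟩
    rw [Unique.eq_default p]
    exact h.trans (Block.triangleEquivalent_of_idem_eq_one _
      (((isIndecomposableAlgebra_iff.1 hA').2 _ (Block.isIdempotentElem _)
        (Block.central _)).resolve_left (Block.idem_ne_zero _)))

theorem finite_and_exists_equiv_block (hA : IsSymmetricAlg k A.carrier) :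
    S.nodes.Finite ∧ ∃ e : S.Leaf ≃ Block k A.carrier,
      ∀ p : S.Leaf, TriangleEquivalent (S.label p.1).Db (e p).alg.Db :=
  S.finite_and_exists_equiv A hA (by
    rw [S.label_root]
    exact TriangleEquivalent.refl)

/-- The stratification with only one node. -/
def ofIsDbSimple (hA : A.IsDbSimple) : DbStratification A where
  nodes := {[]}
  label _ := A
  root_mem := rfl
  parent_mem _ _ h := (List.cons_ne_nil _ _ h).elim
  full _ := iff_of_false (List.cons_ne_nil _ _) (List.cons_ne_nil _ _)
  label_root := rfl
  isDbSimple_of_leaf _ _ _ := hA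
  exists_recollement _ _ h := (List.cons_ne_nil _ _ h).elim

/-- The nodes of the binary tree with the given trees above the children of its root. -/
def joinNodes (N : Bool → Set (List Bool)) : Set (List Bool) :=
  {p | p = [] ∨ ∃ b, ∃ q ∈ N b, p = q ++ [b]}

theorem nil_mem_joinNodes (N : Bool → Set (List Bool)) : [] ∈ joinNodes N := Or.inl rfl

theorem append_mem_joinNodes {N : Bool → Set (List Bool)} {q : List Bool} {b : Bool} :
    q ++ [b] ∈ joinNodes N ↔ q ∈ N b := by
  constructor
  · rintro (h | ⟨b', q', hq', h⟩)
    · simp at h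
    · have h' := List.append_inj' h rfl
      obtain rfl : b = b' := by simpa using h'.2
      rwa [h'.1]
  · exact fun h => Or.inr ⟨b, q, h, rfl⟩

/-- The labelling of the tree with the given trees above the children of its root. -/
def joinLabel (A : FinDimAlg k) (l : Bool → List Bool → FinDimAlg k) (p : List Bool) :
    FinDimAlg k :=
  match p.getLast? with
  | none => A
  | some b => l b p.dropLast

theorem joinLabel_append (A : FinDimAlg k) (l : Bool → List Bool → FinDimAlg k) (q : List Bool)
    (b : Bool) : joinLabel A l (q ++ [b]) = l b q := by
  simp [joinLabel]

/-- The stratification obtained from a recollement and stratifications of its outer terms. -/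
def join {B : Bool → FinDimAlg k} (S : ∀ b, DbStratification (B b))
    (h : ∃ R : Recollement (B false).Db A.Db (B true).Db, R.IsNontrivial) : DbStratification A where
  nodes := joinNodes fun b => (S b).nodes
  label := joinLabel A fun b => (S b).label
  root_mem := nil_mem_joinNodes _
  parent_mem p c hp := by
    rcases List.eq_nil_or_concat p with rfl | ⟨q, b, rfl⟩
    · exact nil_mem_joinNodes _
    · rw [List.concat_eq_append] at hp ⊢
      rw [← List.cons_append] at hp
      rw [append_mem_joinNodes] at hp ⊢
      exact (S b).parent_mem q c hp
  full p := by
    rcases List.eq_nil_or_concat p with rfl | ⟨q, b, rfl⟩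
    · exact iff_of_true ((append_mem_joinNodes (q := [])).2 (S false).root_mem)
        ((append_mem_joinNodes (q := [])).2 (S true).root_mem)
    · rw [List.concat_eq_append, ← List.cons_append, ← List.cons_append, append_mem_joinNodes,
        append_mem_joinNodes]
      exact (S b).full q
  label_root := rfl
  isDbSimple_of_leaf p hp hp' := by
    rcases List.eq_nil_or_concat p with rfl | ⟨q, b, rfl⟩
    · exact (hp' ((append_mem_joinNodes (q := [])).2 (S false).root_mem)).elim
    · rw [List.concat_eq_append] at hp hp' ⊢
      rw [← List.cons_append] at hp'
      rw [append_mem_joinNodes] at hp hp'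
      rw [joinLabel_append]
      exact (S b).isDbSimple_of_leaf q hp hp'
  exists_recollement p hp hp' := by
    rcases List.eq_nil_or_concat p with rfl | ⟨q, b, rfl⟩
    · rw [← List.nil_append [false], ← List.nil_append [true], joinLabel_append, joinLabel_append,
        (S false).label_root, (S true).label_root]
      exact h
    · rw [List.concat_eq_append] at hp hp' ⊢
      rw [← List.cons_append] at hp' ⊢
      rw [← List.cons_append]
      rw [append_mem_joinNodes] at hp hp'
      rw [joinLabel_append, joinLabel_append, joinLabel_append]
      exact (S b).exists_recollement q hp hp'

/-- Induction on the dimension: without a nontrivial central idempotent the category is simple and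
the tree is one node; otherwise trees for the two corners are joined. -/
theorem nonempty_of_isSymmetricAlg (A : FinDimAlg k) (hA : IsSymmetricAlg k A.carrier)
    (h0 : Nontrivial A.carrier) : Nonempty (DbStratification A) := by
  induction hn : Module.finrank k A.carrier using Nat.strong_induction_on generalizing A with
  | _ n IH =>
  by_cases hs : ∀ e : A.carrier, IsIdempotentElem e → (∀ a, e * a = a * e) → e = 0 ∨ e = 1
  · exact ⟨ofIsDbSimple (isDbSimple_of_isSymmetricAlg hA h0 hs)⟩
  · push Not at hs
    obtain ⟨e, he, hc, he0, he1⟩ := hs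
    have he1' : 1 - e ≠ 1 := fun h => he0 (by rwa [sub_eq_self] at h)
    obtain ⟨S₁⟩ := IH _ (hn ▸ finrank_corner_lt he he1) (A.corner he) (hA.corner he hc)
      (nontrivial_corner he he0) rfl
    obtain ⟨S₂⟩ := IH _ (hn ▸ finrank_corner_lt he.one_sub he1') (A.corner he.one_sub)
      (hA.corner he.one_sub (one_sub_central hc))
      (nontrivial_corner he.one_sub (sub_ne_zero.2 he1.symm)) rfl
    exact ⟨join (B := fun b => bif b then A.corner he.one_sub else A.corner he)
      (fun b => match b with | false => S₁ | true => S₂)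
      (exists_recollement_of_central_idempotent A he hc he0 he1)⟩

end DbStratification

end Stratification

theorem corollaryc (k : Type u) [Field k] (A : Type u) [Ring A] [Algebra k A] [Module.Finite k A]
    (hA : IsSymmetricAlg k A) :
    -- every stratification is finite, and its simple factors, with multiplicity, are the bounded
    -- derived categories of the blocks of `A`
    (∀ S : DbStratification (FinDimAlg.mk (k := k) A),
      S.nodes.Finite ∧
      ∃ e : S.Leaf ≃ Block k A,
        ∀ p : S.Leaf, TriangleEquivalent (S.label p.1).Db (e p).alg.Db) ∧
    -- any two stratifications have the same simple factors
    (∀ S T : DbStratification (FinDimAlg.mk (k := k) A),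
      ∃ e : S.Leaf ≃ T.Leaf,
        ∀ p : S.Leaf, TriangleEquivalent (S.label p.1).Db (T.label (e p).1).Db) ∧
    -- there is a stratification unless `A` is zero
    (Nontrivial A → Nonempty (DbStratification (FinDimAlg.mk (k := k) A))) := by
  have key (S : DbStratification (FinDimAlg.mk (k := k) A)) :=
    S.finite_and_exists_equiv_block hA
  refine ⟨key, fun S T => ?_, fun h =>
    DbStratification.nonempty_of_isSymmetricAlg (FinDimAlg.mk (k := k) A) hA h⟩
  obtain ⟨-, e, he⟩ := key S
  obtain ⟨-, f, hf⟩ := key T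
  -- Two stratifications are compared through their bijections with the blocks.
  refine ⟨e.trans f.symm, fun p => (he p).trans ?_⟩
  have := (hf (f.symm (e p))).symm
  rwa [Equiv.apply_symm_apply] at this
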